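/- Let $m\in\{1,2,3\}$, let $\Omega\subset\mathbb{R}^m$ be a bounded domain (non-empty, open, connected) with Lipschitz boundary, let $T>0$, and put $Q_T=\Omega\times(0,T)$. Let $\mathbf v\in C([0,T],C^2(\overline\Omega)^m)$ satisfy $\nabla\cdot\mathbf v(\cdot,t)=0$ in $\Omega$ for all $t\in[0,T]$. For each $t\in[0,T]$ let $\Omega$ be the disjoint union of sets $\Omega_1(t)$, $\Omega_2(t)$ and an interface $\Gamma(t)$, where $\Gamma(t)$ is transported by $\mathbf v$ (a particle moving in $\Omega$ with velocity $\mathbf v$ lies on the interface either at all times or never), the sets $Q_i=\bigcup_{t\in(0,T)}\Omega_i(t)\times\{t\}$ ($i=1,2$) are open, and $\Gamma^\ast=\bigcup_{t\in(0,T)}\Gamma(t)\times\{t\}$ is a $C^2$ hypersurface in $\mathbb{R}^{m+1}$. Let $\kappa_1,\kappa_2,\eta>0$ and let $\kappa=\kappa_i$ in $Q_i$, $i=1,2$. Let $\nabla$ denote the gradient in $x$. Let $H^{1,0}(Q_T)$ be the space of all $w\in L^2(Q_T)$ with weak gradient $\nabla w\in L^2(Q_T)^m$, with norm $\big(\|w\|_{L^2(Q_T)}^2+\|\nabla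 w\|_{L^2(Q_T)}^2\big)^{1/2}$; let $W$ be the closure in $H^{1,0}(Q_T)$ of $C^1_0(Q_T)$, the $C^1$ functions with compact support in $Q_T$, and let $W'$ be the dual of $W$, with duality pairing $\langle\cdot,\cdot\rangle$. Let $U$ be the space of all $w\in W$ with $\partial_t w\in W'$, that is, for which $\xi\mapsto-\int_{Q_T}w\,\partial_t\xi\,dx\,dt$, $\xi\in C_0^1(Q_T)$, extends to an element $\partial_t w$ of $W'$. Let $U_0=\{w\in U: w(\cdot,0)=0\}$ and $U_T=\{w\in U: w(\cdot,T)=0\}$, where $w(\cdot,s)\in L^2(\Omega)$ is the value at $s$ of the representative of $w$ in $C([0,T],L^2(\Omega))$. For $u\in U$ and $\varphi\in W$ put $$a(u,\varphi)=\langle\partial_t u,\varphi\rangle+\int_{Q_T}(\mathbf v\cdot\nabla u)\,\varphi+\kappa\nabla u\cdot\nabla\varphi\,dx\,dt .$$ For $u_d\in L^2(Q_T)$ consider the reduced coupled state–adjoint problem: find $(\overline u,\overline p)\in U_0\times W$ such that, for all $(\varphi,\phi)\in W\times U_0$, $$a(\overline u,\varphi)+\frac1\eta\int_{Q_T}\kappa\nabla\overline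 p\cdot\nabla\varphi\,dx\,dt+\int_{Q_T}\overline u\,\phi\,dx\,dt-a(\phi,\overline p)=\int_{Q_T}u_d\,\phi\,dx\,dt .$$ Then, for every $u_d\in L^2(Q_T)$, this problem has exactly one solution $(\overline u,\overline p)\in U_0\times W$, and this solution satisfies $\overline p\in U_T$; in particular it is the unique solution in $U_0\times U_T$. -/

import Mathlib

open MeasureTheory Set Filter Topology

noncomputable section

namespace MovingInterface

/-! ### Function spaces on a space-time set `Q ⊆ ℝᵐ × ℝ`; points are written `z = (x, t)`. -/

/-- The Euclidean space `ℝᵐ`. -/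
abbrev Space (m : ℕ) : Type := EuclideanSpace ℝ (Fin m)

variable {m : ℕ}

/-- Partial derivative `∂ξ/∂xᵢ` at `z = (x, t)`. -/
def dx (i : Fin m) (ξ : Space m × ℝ → ℝ) (z : Space m × ℝ) : ℝ :=
  fderiv ℝ ξ z (EuclideanSpace.single i 1, 0)

/-- Classical spatial gradient `∇ξ` at `z = (x, t)`. -/
def gradx (ξ : Space m × ℝ → ℝ) (z : Space m × ℝ) : Space m :=
  WithLp.toLp 2 fun i => dx i ξ z

/-- Partial derivative `∂ξ/∂t` at `z = (x, t)`. -/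
def dt (ξ : Space m × ℝ → ℝ) (z : Space m × ℝ) : ℝ :=
  fderiv ℝ ξ z (0, 1)

/-- `C¹₀(Q)`: continuously differentiable functions with compact support contained in `Q`. -/
def C10 (Q : Set (Space m × ℝ)) : Submodule ℝ (Space m × ℝ → ℝ) where
  carrier := {ξ | ContDiff ℝ 1 ξ ∧ HasCompactSupport ξ ∧ tsupport ξ ⊆ Q}
  add_mem' := fun ha hb => ⟨ha.1.add hb.1, ha.2.1.add hb.2.1,
    (tsupport_add _ _).trans (union_subset ha.2.2 hb.2.2)⟩
  zero_mem' := ⟨contDiff_const, HasCompactSupport.zero, by simp [tsupport]⟩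
  smul_mem' := fun c ξ h => ⟨h.1.const_smul c,
    h.2.1.mono (Function.support_const_smul_subset c ξ),
    (closure_mono (Function.support_const_smul_subset c ξ)).trans h.2.2⟩

section

variable {Q : Set (Space m × ℝ)}

lemma C10.memLp (ξ : C10 Q) (μ : Measure (Space m × ℝ)) [IsFiniteMeasureOnCompacts μ] :
    MemLp (ξ : Space m × ℝ → ℝ) 2 μ :=
  ξ.2.1.continuous.memLp_of_hasCompactSupport ξ.2.2.1

lemma C10.continuous_fderiv_apply (ξ : C10 Q) (e : Space m × ℝ) :
    Continuous fun z => fderiv ℝ (ξ : Space m × ℝ → ℝ) z e :=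
  (ξ.2.1.continuous_fderiv one_ne_zero).clm_apply continuous_const

lemma C10.hasCompactSupport_gradx (ξ : C10 Q) :
    HasCompactSupport (gradx (ξ : Space m × ℝ → ℝ)) := by
  refine (ξ.2.2.1.fderiv ℝ).mono fun z hz => ?_
  contrapose! hz
  have h0 : fderiv ℝ (ξ : Space m × ℝ → ℝ) z = 0 := by simpa using hz
  have : gradx (ξ : Space m × ℝ → ℝ) z = 0 := by
    ext i
    simp [gradx, dx, h0]
  simpa using this

lemma C10.continuous_gradx (ξ : C10 Q) : Continuous (gradx (ξ : Space m × ℝ → ℝ)) :=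
  (PiLp.continuous_toLp 2 _).comp (continuous_pi fun _ => C10.continuous_fderiv_apply ξ _)

lemma C10.memLp_gradx (ξ : C10 Q) (μ : Measure (Space m × ℝ)) [IsFiniteMeasureOnCompacts μ] :
    MemLp (gradx (ξ : Space m × ℝ → ℝ)) 2 μ :=
  (C10.continuous_gradx ξ).memLp_of_hasCompactSupport (C10.hasCompactSupport_gradx ξ)

/-- `L²(Q)`. -/
abbrev L2 (Q : Set (Space m × ℝ)) : Type := Lp ℝ 2 (volume.restrict Q)

/-- `L²(Q)ᵐ`. -/
abbrev L2Vec (Q : Set (Space m × ℝ)) : Type := Lp (Space m) 2 (volume.restrict Q)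

/-- The Hilbert space `L²(Q) × L²(Q)ᵐ`, with norm `(‖w‖² + ‖g‖²)^(1/2)`. -/
abbrev L2Pair (Q : Set (Space m × ℝ)) : Type := WithLp 2 (L2 Q × L2Vec Q)

lemma C10.integrable_mul_dx (w : L2 Q) (ξ : C10 Q) (i : Fin m) :
    Integrable (fun z => w z * dx i (ξ : Space m × ℝ → ℝ) z) (volume.restrict Q) := by
  have h : MemLp (dx i (ξ : Space m × ℝ → ℝ)) 2 (volume.restrict Q) := by
    refine (C10.continuous_fderiv_apply ξ _).memLp_of_hasCompactSupport
      ((ξ.2.2.1.fderiv ℝ).mono fun z hz => ?_)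
    contrapose! hz
    have h0 : fderiv ℝ (ξ : Space m × ℝ → ℝ) z = 0 := by simpa using hz
    simp [h0]
  exact (Lp.memLp w).integrable_mul h

lemma C10.integrable_coord_mul (g : L2Vec Q) (ξ : C10 Q) (i : Fin m) :
    Integrable (fun z => g z i * (ξ : Space m × ℝ → ℝ) z) (volume.restrict Q) := by
  have h : MemLp (fun z => g z i) 2 (volume.restrict Q) :=
    (EuclideanSpace.proj (𝕜 := ℝ) i).comp_memLp' (Lp.memLp g)
  exact h.integrable_mul (C10.memLp ξ _)

/-- The anisotropic Sobolev space `H^{1,0}(Q)` of all `w ∈ L²(Q)` with a weak spatial gradient in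
`L²(Q)ᵐ`. An element is recorded as the pair `(w, ∇w)` (the weak gradient is determined by `w`),
so that the norm inherited from `L²(Q) × L²(Q)ᵐ` is the norm of `H^{1,0}(Q)`. -/
def H10 (Q : Set (Space m × ℝ)) : Submodule ℝ (L2Pair Q) where
  carrier := {p | ∀ (ξ : C10 Q) (i : Fin m),
    ∫ z in Q, p.fst z * dx i (ξ : Space m × ℝ → ℝ) z
      = -∫ z in Q, p.snd z i * (ξ : Space m × ℝ → ℝ) z}
  add_mem' := by
    intro p q hp hq ξ i
    have h1 : ∫ z in Q, (p + q).fst z * dx i (ξ : Space m × ℝ → ℝ) z =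
        ∫ z in Q, (p.fst z * dx i (ξ : Space m × ℝ → ℝ) z
          + q.fst z * dx i (ξ : Space m × ℝ → ℝ) z) := by
      refine integral_congr_ae ?_
      filter_upwards [Lp.coeFn_add p.fst q.fst] with z hz
      simp only [WithLp.add_fst, hz, Pi.add_apply]
      ring
    have h2 : ∫ z in Q, (p + q).snd z i * (ξ : Space m × ℝ → ℝ) z =
        ∫ z in Q, (p.snd z i * (ξ : Space m × ℝ → ℝ) z
          + q.snd z i * (ξ : Space m × ℝ → ℝ) z) := by
      refine integral_congr_ae ?_
      filter_upwards [Lp.coeFn_add p.snd q.snd] with z hz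
      simp only [WithLp.add_snd, hz, Pi.add_apply, PiLp.add_apply]
      ring
    rw [h1, h2, integral_add (C10.integrable_mul_dx _ ξ i) (C10.integrable_mul_dx _ ξ i),
      integral_add (C10.integrable_coord_mul _ ξ i) (C10.integrable_coord_mul _ ξ i),
      hp ξ i, hq ξ i]
    ring
  zero_mem' := by
    intro ξ i
    have h1 : ∫ z in Q, (0 : L2Pair Q).fst z * dx i (ξ : Space m × ℝ → ℝ) z = 0 := by
      refine integral_eq_zero_of_ae ?_
      filter_upwards [Lp.coeFn_zero ℝ 2 (volume.restrict Q)] with z hz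
      have h0 : (0 : L2Pair Q).fst z = 0 := hz
      change (0 : L2Pair Q).fst z * dx i (ξ : Space m × ℝ → ℝ) z = 0
      rw [h0, zero_mul]
    have h2 : ∫ z in Q, (0 : L2Pair Q).snd z i * (ξ : Space m × ℝ → ℝ) z = 0 := by
      refine integral_eq_zero_of_ae ?_
      filter_upwards [Lp.coeFn_zero (Space m) 2 (volume.restrict Q)] with z hz
      have h0 : (0 : L2Pair Q).snd z = 0 := hz
      change (0 : L2Pair Q).snd z i * (ξ : Space m × ℝ → ℝ) z = 0
      rw [h0, PiLp.zero_apply, zero_mul]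
    rw [h1, h2, neg_zero]
  smul_mem' := by
    intro c p hp ξ i
    have h1 : ∫ z in Q, (c • p).fst z * dx i (ξ : Space m × ℝ → ℝ) z =
        ∫ z in Q, c * (p.fst z * dx i (ξ : Space m × ℝ → ℝ) z) := by
      refine integral_congr_ae ?_
      filter_upwards [Lp.coeFn_smul c p.fst] with z hz
      simp only [WithLp.smul_fst, hz, Pi.smul_apply, smul_eq_mul]
      ring
    have h2 : ∫ z in Q, (c • p).snd z i * (ξ : Space m × ℝ → ℝ) z =
        ∫ z in Q, c * (p.snd z i * (ξ : Space m × ℝ → ℝ) z) := by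
      refine integral_congr_ae ?_
      filter_upwards [Lp.coeFn_smul c p.snd] with z hz
      simp only [WithLp.smul_snd, hz, Pi.smul_apply, PiLp.smul_apply, smul_eq_mul]
      ring
    rw [h1, h2, integral_const_mul, integral_const_mul, hp ξ i]
    ring

/-- The pair `(ξ, ∇ξ)` of a function `ξ ∈ C¹₀(Q)`, depending linearly on `ξ`. -/
def testToL2Pair (Q : Set (Space m × ℝ)) : C10 Q →ₗ[ℝ] L2Pair Q where
  toFun ξ := WithLp.toLp 2 ((C10.memLp ξ (volume.restrict Q)).toLp _,
    (C10.memLp_gradx ξ (volume.restrict Q)).toLp _)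
  map_add' := by
    intro ξ ζ
    have hd : gradx ((ξ + ζ : C10 Q) : Space m × ℝ → ℝ)
        = gradx (ξ : Space m × ℝ → ℝ) + gradx (ζ : Space m × ℝ → ℝ) := by
      funext z
      ext i
      simp [gradx, dx, fderiv_add (ξ.2.1.differentiable one_ne_zero z)
        (ζ.2.1.differentiable one_ne_zero z)]
    rw [← WithLp.toLp_add, Prod.mk_add_mk, ← MemLp.toLp_add, ← MemLp.toLp_add]
    congr 2
    simp only [hd]
  map_smul' := by
    intro c ξ
    have hd : gradx ((c • ξ : C10 Q) : Space m × ℝ → ℝ) = c • gradx (ξ : Space m × ℝ → ℝ) := by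
      funext z
      ext i
      simp [gradx, dx, fderiv_const_smul (ξ.2.1.differentiable one_ne_zero z)]
    rw [RingHom.id_apply, ← WithLp.toLp_smul, Prod.smul_mk, ← MemLp.toLp_const_smul,
      ← MemLp.toLp_const_smul]
    congr 2
    simp only [hd]

lemma testToL2Pair_mem_H10 (ξ : C10 Q) : testToL2Pair Q ξ ∈ H10 Q := by
  intro ζ i
  have e1 : ∫ z in Q, (testToL2Pair Q ξ).fst z * dx i (ζ : Space m × ℝ → ℝ) z
      = ∫ z, (ξ : Space m × ℝ → ℝ) z * dx i (ζ : Space m × ℝ → ℝ) z := by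
    have h : ∫ z in Q, (ξ : Space m × ℝ → ℝ) z * dx i (ζ : Space m × ℝ → ℝ) z
        = ∫ z, (ξ : Space m × ℝ → ℝ) z * dx i (ζ : Space m × ℝ → ℝ) z :=
      setIntegral_eq_integral_of_forall_compl_eq_zero fun z hz => by
        rw [image_eq_zero_of_notMem_tsupport fun h => hz (ξ.2.2.2 h), zero_mul]
    rw [← h]
    refine integral_congr_ae ?_
    filter_upwards [(C10.memLp ξ (volume.restrict Q)).coeFn_toLp] with z hz
    simp [testToL2Pair, hz]
  have e2 : ∫ z in Q, (testToL2Pair Q ξ).snd z i * (ζ : Space m × ℝ → ℝ) z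
      = ∫ z, dx i (ξ : Space m × ℝ → ℝ) z * (ζ : Space m × ℝ → ℝ) z := by
    have h : ∫ z in Q, dx i (ξ : Space m × ℝ → ℝ) z * (ζ : Space m × ℝ → ℝ) z
        = ∫ z, dx i (ξ : Space m × ℝ → ℝ) z * (ζ : Space m × ℝ → ℝ) z :=
      setIntegral_eq_integral_of_forall_compl_eq_zero fun z hz => by
        rw [image_eq_zero_of_notMem_tsupport fun h => hz (ζ.2.2.2 h), mul_zero]
    rw [← h]
    refine integral_congr_ae ?_
    filter_upwards [(C10.memLp_gradx ξ (volume.restrict Q)).coeFn_toLp] with z hz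
    simp [testToL2Pair, hz, gradx]
  have : (volume : Measure (Space m × ℝ)).IsAddHaarMeasure := by
    rw [Measure.volume_eq_prod]
    infer_instance
  rw [e1, e2]
  have hξ := ξ.2.1.continuous
  have hζ := ζ.2.1.continuous
  refine integral_mul_fderiv_eq_neg_fderiv_mul_of_integrable
    (((C10.continuous_fderiv_apply ξ _).mul hζ).integrable_of_hasCompactSupport ζ.2.2.1.mul_left)
    ((hξ.mul (C10.continuous_fderiv_apply ζ _)).integrable_of_hasCompactSupport ξ.2.2.1.mul_right)
    ((hξ.mul hζ).integrable_of_hasCompactSupport ξ.2.2.1.mul_right)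
    (fun z _ => ξ.2.1.differentiable one_ne_zero z)
    (fun z _ => ζ.2.1.differentiable one_ne_zero z)

/-- The space `W`: the closure of `C¹₀(Q)` in `H^{1,0}(Q)`. It carries the norm of `H^{1,0}(Q)`. -/
def W (Q : Set (Space m × ℝ)) : Submodule ℝ (L2Pair Q) :=
  H10 Q ⊓ (LinearMap.range (testToL2Pair Q)).topologicalClosure

/-- The function underlying an element of `W`. -/
def valW (w : W Q) : L2 Q := (w : L2Pair Q).fst

/-- The spatial gradient of an element of `W`. -/
def gradW (w : W Q) : L2Vec Q := (w : L2Pair Q).snd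

/-- The inclusion of `C¹₀(Q)` in `W`. -/
def testToW (ξ : C10 Q) : W Q :=
  ⟨testToL2Pair Q ξ, testToL2Pair_mem_H10 ξ, subset_closure ⟨ξ, rfl⟩⟩

/-- `ℓ ∈ W'` is the distributional time derivative of `w ∈ W`. -/
def IsTimeDeriv (w : W Q) (ℓ : StrongDual ℝ (W Q)) : Prop :=
  ∀ ξ : C10 Q, ℓ (testToW ξ) = -∫ z in Q, valW w z * dt (ξ : Space m × ℝ → ℝ) z

lemma C10.integrable_mul_dt (w : L2 Q) (ξ : C10 Q) :
    Integrable (fun z => w z * dt (ξ : Space m × ℝ → ℝ) z) (volume.restrict Q) := by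
  have h : MemLp (dt (ξ : Space m × ℝ → ℝ)) 2 (volume.restrict Q) := by
    refine (C10.continuous_fderiv_apply ξ _).memLp_of_hasCompactSupport
      ((ξ.2.2.1.fderiv ℝ).mono fun z hz => ?_)
    contrapose! hz
    have h0 : fderiv ℝ (ξ : Space m × ℝ → ℝ) z = 0 := by simpa using hz
    simp [h0]
  exact (Lp.memLp w).integrable_mul h

/-- The space `U` of all `w ∈ W` with `∂ₜw ∈ W'`. -/
def U (Q : Set (Space m × ℝ)) : Submodule ℝ (W Q) where
  carrier := {w | ∃ ℓ : StrongDual ℝ (W Q), IsTimeDeriv w ℓ}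
  add_mem' := by
    rintro w w' ⟨ℓ, h⟩ ⟨ℓ', h'⟩
    refine ⟨ℓ + ℓ', fun ξ => ?_⟩
    have h1 : ∫ z in Q, valW (w + w') z * dt (ξ : Space m × ℝ → ℝ) z =
        ∫ z in Q, (valW w z * dt (ξ : Space m × ℝ → ℝ) z
          + valW w' z * dt (ξ : Space m × ℝ → ℝ) z) := by
      refine integral_congr_ae ?_
      filter_upwards [Lp.coeFn_add (valW w) (valW w')] with z hz
      have : valW (w + w') z = valW w z + valW w' z := hz
      rw [this]
      ring
    rw [add_apply, h ξ, h' ξ, h1,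
      integral_add (C10.integrable_mul_dt _ ξ) (C10.integrable_mul_dt _ ξ)]
    ring
  zero_mem' := by
    refine ⟨0, fun ξ => ?_⟩
    have h1 : ∫ z in Q, valW (0 : W Q) z * dt (ξ : Space m × ℝ → ℝ) z = 0 := by
      refine integral_eq_zero_of_ae ?_
      filter_upwards [Lp.coeFn_zero ℝ 2 (volume.restrict Q)] with z hz
      have : valW (0 : W Q) z = 0 := hz
      simp [this]
    rw [h1]
    simp
  smul_mem' := by
    rintro c w ⟨ℓ, h⟩
    refine ⟨c • ℓ, fun ξ => ?_⟩
    have h1 : ∫ z in Q, valW (c • w) z * dt (ξ : Space m × ℝ → ℝ) z =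
        ∫ z in Q, c * (valW w z * dt (ξ : Space m × ℝ → ℝ) z) := by
      refine integral_congr_ae ?_
      filter_upwards [Lp.coeFn_smul c (valW w)] with z hz
      have : valW (c • w) z = c * valW w z := hz
      rw [this]
      ring
    rw [smul_apply, h ξ, h1, integral_const_mul, smul_eq_mul]
    ring

/-- The time derivative `∂ₜw ∈ W'` of `w ∈ U`. -/
def timeDeriv (w : U Q) : StrongDual ℝ (W Q) := Classical.choose w.2

lemma isTimeDeriv_timeDeriv (w : U Q) : IsTimeDeriv (w : W Q) (timeDeriv w) :=
  Classical.choose_spec w.2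

/-- The time derivative is unique, because `C¹₀(Q)` is dense in `W`. -/
lemma IsTimeDeriv.unique {w : W Q} {ℓ ℓ' : StrongDual ℝ (W Q)} (h : IsTimeDeriv w ℓ)
    (h' : IsTimeDeriv w ℓ') : ℓ = ℓ' := by
  have hd : DenseRange (testToW : C10 Q → W Q) := by
    intro w
    rw [closure_subtype]
    refine closure_mono ?_ w.2.2
    rintro _ ⟨ξ, rfl⟩
    exact ⟨(testToW ξ), ⟨ξ, rfl⟩, rfl⟩
  exact DFunLike.coe_injective (hd.equalizer ℓ.continuous ℓ'.continuous
    (funext fun ξ => (h ξ).trans (h' ξ).symm))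

end

/-! ### The space-time cylinder and the traces in time -/

/-- The space-time cylinder `Q_T = Ω × (0, T)`. -/
def cylinder (Ω : Set (Space m)) (T : ℝ) : Set (Space m × ℝ) := Ω ×ˢ Ioo 0 T

/-- `w(·, s) = 0` for a function `w` on `Ω × (0, T)` and a time `s ∈ [0, T]`, in the sense of traces
in `L²(Ω)`: the representative of `w` in `C([0, T], L²(Ω))` vanishes at `s`. -/
def VanishesAt (Ω : Set (Space m)) (T s : ℝ) (w : L2 (cylinder Ω T)) : Prop :=
  ∃ c : ℝ → Lp ℝ 2 (volume.restrict Ω), ContinuousOn c (Icc 0 T) ∧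
    (∀ᵐ t ∂(volume.restrict (Ioo 0 T)), c t =ᵐ[volume.restrict Ω] fun x => w (x, t)) ∧
    c s = 0

/-- The space `U₀` of all `w ∈ U` with `w(·, 0) = 0`. -/
def U0 (Ω : Set (Space m)) (T : ℝ) : Set (U (cylinder Ω T)) :=
  {w | VanishesAt Ω T 0 (valW (w : W (cylinder Ω T)))}

/-- The space `U_T` of all `w ∈ U` with `w(·, T) = 0`. -/
def UT (Ω : Set (Space m)) (T : ℝ) : Set (U (cylinder Ω T)) :=
  {w | VanishesAt Ω T T (valW (w : W (cylinder Ω T)))}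

/-! ### Data of the moving-interface problem -/

/-- `Ω` has a Lipschitz boundary: near every boundary point, in suitable Cartesian coordinates, `Ω`
is the region below the graph of a Lipschitz function of the coordinates orthogonal to the
vertical unit vector `e`. -/
def HasLipschitzBoundary (Ω : Set (Space m)) : Prop :=
  ∀ x₀ ∈ frontier Ω, ∃ (e : Space m) (r : ℝ) (K : NNReal) (g : Space m → ℝ),
    ‖e‖ = 1 ∧ 0 < r ∧ LipschitzWith K g ∧
    ∀ x ∈ Metric.ball x₀ r, x ∈ Ω ↔ inner ℝ e x < g (x - inner ℝ e x • e)

/-- `v ∈ C([0, T], C²(Ω̄)ᵐ)`: for every `t ∈ [0, T]` the field `v(·, t)` is `C²` in `Ω`, and its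
derivatives in `x` of order at most two extend continuously to `Ω̄ × [0, T]`. (As `Ω̄` and `[0, T]` are
compact, continuity on the product is continuity in `t` for the norm of `C²(Ω̄)`.) -/
def IsC0C2 (Ω : Set (Space m)) (T : ℝ) (v : Space m × ℝ → Space m) : Prop :=
  (∀ t ∈ Icc 0 T, ContDiffOn ℝ 2 (fun x => v (x, t)) Ω) ∧
  ∀ k : ℕ, k ≤ 2 → ∃ G : Space m × ℝ → ContinuousMultilinearMap ℝ (fun _ : Fin k => Space m) (Space m),
    ContinuousOn G (closure Ω ×ˢ Icc 0 T) ∧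
    ∀ t ∈ Icc 0 T, ∀ x ∈ Ω, G (x, t) = iteratedFDeriv ℝ k (fun y => v (y, t)) x

/-- The divergence in `x` of a time-dependent vector field. -/
def divx (v : Space m × ℝ → Space m) (x : Space m) (t : ℝ) : ℝ :=
  ∑ i : Fin m, fderiv ℝ (fun y => v (y, t)) x (EuclideanSpace.single i 1) i

/-- A set of `ℝᵐ × ℝ` is a `C²` hypersurface: near each of its points it is the zero set of a `C²`
function with non-vanishing differential. -/
def IsC2Hypersurface (S : Set (Space m × ℝ)) : Prop :=
  ∀ z ∈ S, ∃ (O : Set (Space m × ℝ)) (F : Space m × ℝ → ℝ), IsOpen O ∧ z ∈ O ∧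
    ContDiffOn ℝ 2 F O ∧ (∀ y ∈ O, fderiv ℝ F y ≠ 0) ∧ ∀ y ∈ O, y ∈ S ↔ F y = 0

/-- The time-dependent set `Γ(t) ⊆ Ω`, `t ∈ [0, T]`, is transported by the velocity field `v`: a
particle that moves in `Ω` with velocity `v` is on `Γ` either all the time or never. -/
def IsTransported (Ω : Set (Space m)) (T : ℝ) (v : Space m × ℝ → Space m)
    (Γ : ℝ → Set (Space m)) : Prop :=
  ∀ (a b : ℝ) (γ : ℝ → Space m), 0 ≤ a → a ≤ b → b ≤ T →
    (∀ t ∈ Icc a b, γ t ∈ Ω ∧ HasDerivWithinAt γ (v (γ t, t)) (Icc a b) t) →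
    (γ a ∈ Γ a ↔ γ b ∈ Γ b)

/-- The data of the optimal control problem: the domain `Ω`, the final time `T`, the velocity field
`v(x, t)`, the time-dependent subdomains `Ω₁(t)`, `Ω₂(t)` and interface `Γ(t)`, the diffusion
coefficients `κ₁`, `κ₂`, and the regularization parameter `η`. -/
structure Data (m : ℕ) where
  Ω : Set (Space m)
  T : ℝ
  v : Space m × ℝ → Space m
  Ω₁ : ℝ → Set (Space m)
  Ω₂ : ℝ → Set (Space m)
  Γ : ℝ → Set (Space m)
  κ₁ : ℝ
  κ₂ : ℝ
  η : ℝ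

namespace Data

/-- The space-time tube over `(0, T)` swept by a time-dependent set. -/
def tube (T : ℝ) (A : ℝ → Set (Space m)) : Set (Space m × ℝ) :=
  {z | z.2 ∈ Ioo 0 T ∧ z.1 ∈ A z.2}

/-- The space-time cylinder `Q_T`. -/
abbrev Q (D : Data m) : Set (Space m × ℝ) := cylinder D.Ω D.T

/-- Standing assumptions on the data. -/
structure IsAdmissible (D : Data m) : Prop where
  isOpen_Ω : IsOpen D.Ω
  isConnected_Ω : IsConnected D.Ω
  isBounded_Ω : Bornology.IsBounded D.Ω
  lipschitz_Ω : HasLipschitzBoundary D.Ω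
  T_pos : 0 < D.T
  v_regular : IsC0C2 D.Ω D.T D.v
  v_div_free : ∀ x ∈ D.Ω, ∀ t ∈ Icc 0 D.T, divx D.v x t = 0
  /-- `Ω` is partitioned into `Ω₁(t)`, `Ω₂(t)` and `Γ(t)`. -/
  partition : ∀ t ∈ Icc 0 D.T, D.Ω₁ t ∪ D.Ω₂ t ∪ D.Γ t = D.Ω ∧
    Disjoint (D.Ω₁ t) (D.Ω₂ t) ∧ Disjoint (D.Ω₁ t) (D.Γ t) ∧ Disjoint (D.Ω₂ t) (D.Γ t)
  isOpen_Q₁ : IsOpen (tube D.T D.Ω₁)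
  isOpen_Q₂ : IsOpen (tube D.T D.Ω₂)
  hypersurface_Γ : IsC2Hypersurface (tube D.T D.Γ)
  transported_Γ : IsTransported D.Ω D.T D.v D.Γ
  κ₁_pos : 0 < D.κ₁
  κ₂_pos : 0 < D.κ₂
  η_pos : 0 < D.η

/-- The diffusion coefficient: `κ₁` in `Q₁` and `κ₂` in `Q₂`. (Its values on the interface, a null
set, are immaterial.) -/
def κ (D : Data m) (z : Space m × ℝ) : ℝ :=
  open Classical in if z ∈ tube D.T D.Ω₁ then D.κ₁ else D.κ₂

/-- `∫_{Q_T} κ ∇w · ∇φ`. -/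
def diffusion (D : Data m) (w φ : W D.Q) : ℝ :=
  ∫ z in D.Q, D.κ z * inner ℝ (gradW w z) (gradW φ z)

/-- `a(u, φ) = ⟨∂ₜu, φ⟩ + ∫_{Q_T} (v · ∇u) φ + κ ∇u · ∇φ`. -/
def a (D : Data m) (u : U D.Q) (φ : W D.Q) : ℝ :=
  timeDeriv u φ
    + ∫ z in D.Q, (inner ℝ (D.v z) (gradW (u : W D.Q) z) * valW φ z
        + D.κ z * inner ℝ (gradW (u : W D.Q) z) (gradW φ z))

/-- The bilinear form
`𝒜((u, p), (φ, ϕ)) = a(u, φ) + η⁻¹ ∫ κ ∇p · ∇φ + ∫ u ϕ - a(ϕ, p)`. -/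
def bilin (D : Data m) (u : U D.Q) (p : W D.Q) (φ : W D.Q) (ϕ : U D.Q) : ℝ :=
  D.a u φ + 1 / D.η * D.diffusion p φ
    + (∫ z in D.Q, valW (u : W D.Q) z * valW (ϕ : W D.Q) z) - D.a ϕ p

/-- `(u, p) ∈ U₀ × W` solves the reduced coupled state-adjoint problem with desired state `ud`:
`𝒜((u, p), (φ, ϕ)) = ∫ ud ϕ` for all `(φ, ϕ) ∈ W × U₀`. -/
def IsSolution (D : Data m) (ud : L2 D.Q) (u : U D.Q) (p : W D.Q) : Prop :=
  u ∈ U0 D.Ω D.T ∧ ∀ φ : W D.Q, ∀ ϕ ∈ U0 D.Ω D.T,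
    D.bilin u p φ ϕ = ∫ z in D.Q, ud z * valW (ϕ : W D.Q) z

end Data

end MovingInterface

end

open MeasureTheory Set Filter Topology

noncomputable section

namespace MovingInterface

variable {m : ℕ}

/-! ### Generalities on `L²` -/

section L2General

variable {α E : Type*} [MeasurableSpace α] {μ : Measure α} [NormedAddCommGroup E]
  [InnerProductSpace ℝ E]

lemma inner_toLp_eq_integral {h : α → E} (hh : MemLp h 2 μ) (f : Lp E 2 μ) :
    inner ℝ (hh.toLp h) f = ∫ z, inner ℝ (h z) (f z) ∂μ := by
  rw [L2.inner_def]
  refine integral_congr_ae ?_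
  filter_upwards [hh.coeFn_toLp] with z hz
  rw [hz]

lemma inner_toLp_toLp {h k : α → E} (hh : MemLp h 2 μ) (hk : MemLp k 2 μ) :
    inner ℝ (hh.toLp h) (hk.toLp k) = ∫ z, inner ℝ (h z) (k z) ∂μ := by
  rw [inner_toLp_eq_integral]
  refine integral_congr_ae ?_
  filter_upwards [hk.coeFn_toLp] with z hz
  rw [hz]

lemma norm_toLp_sq {h : α → E} (hh : MemLp h 2 μ) :
    ‖hh.toLp h‖ ^ 2 = ∫ z, ‖h z‖ ^ 2 ∂μ := by
  rw [← real_inner_self_eq_norm_sq, inner_toLp_toLp]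
  simp

lemma tendsto_toLp_of_dominated {F : ℕ → α → E} {f : α → E} {g : α → ℝ}
    (hF : ∀ n, MemLp (F n) 2 μ) (hf : MemLp f 2 μ) (hg : MemLp g 2 μ)
    (hb : ∀ n z, ‖F n z‖ ≤ g z) (hlim : ∀ z, Tendsto (fun n => F n z) atTop (𝓝 (f z))) :
    Tendsto (fun n => (hF n).toLp (F n)) atTop (𝓝 (hf.toLp f)) := by
  rw [tendsto_iff_norm_sub_tendsto_zero]
  have key : Tendsto (fun n => ‖(hF n).toLp (F n) - hf.toLp f‖ ^ 2) atTop (𝓝 0) := by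
    have e : ∀ n, ‖(hF n).toLp (F n) - hf.toLp f‖ ^ 2 = ∫ z, ‖F n z - f z‖ ^ 2 ∂μ := by
      intro n
      rw [← MemLp.toLp_sub, norm_toLp_sq]
      rfl
    simp_rw [e]
    have h0 : (0 : ℝ) = ∫ _z, (0 : ℝ) ∂μ := by simp
    rw [h0]
    refine tendsto_integral_of_dominated_convergence (fun z => (2 * g z) ^ 2) ?_ ?_ ?_ ?_
    · exact fun n => (((hF n).1.sub hf.1).norm.pow 2)
    · exact (hg.const_mul 2).integrable_sq
    · refine fun n => ae_of_all _ fun z => ?_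
      have hfz : ‖f z‖ ≤ g z := le_of_tendsto (hlim z).norm (Eventually.of_forall fun n => hb n z)
      rw [Real.norm_of_nonneg (by positivity)]
      refine pow_le_pow_left₀ (norm_nonneg _) ?_ 2
      calc _ ≤ ‖F n z‖ + ‖f z‖ := norm_sub_le _ _
        _ ≤ 2 * g z := by linarith [hb n z]
    · refine ae_of_all _ fun z => ?_
      have := ((hlim z).sub_const (f z)).norm.pow 2
      simpa using this
  have := key.sqrt
  simpa using this

end L2General

/-! ### Compactly supported functions on space-time -/

instance : (volume : Measure (Space m × ℝ)).IsAddHaarMeasure := by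
  rw [Measure.volume_eq_prod]
  infer_instance

section TestFunctions

variable {S S' Q : Set (Space m × ℝ)}

lemma C10.eq_zero (ξ : C10 S) {z : Space m × ℝ} (hz : z ∉ S) :
    (ξ : Space m × ℝ → ℝ) z = 0 :=
  image_eq_zero_of_notMem_tsupport fun h => hz (ξ.2.2.2 h)

lemma C10.fderiv_eq_zero (ξ : C10 S) {z : Space m × ℝ} (hz : z ∉ S) :
    fderiv ℝ (ξ : Space m × ℝ → ℝ) z = 0 :=
  image_eq_zero_of_notMem_tsupport fun h => hz (ξ.2.2.2 (tsupport_fderiv_subset ℝ h))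

lemma C10.gradx_eq_zero (ξ : C10 S) {z : Space m × ℝ} (hz : z ∉ S) :
    gradx (ξ : Space m × ℝ → ℝ) z = 0 := by
  ext i
  simp [gradx, dx, C10.fderiv_eq_zero ξ hz]

lemma C10.dt_eq_zero (ξ : C10 S) {z : Space m × ℝ} (hz : z ∉ S) :
    dt (ξ : Space m × ℝ → ℝ) z = 0 := by
  simp [dt, C10.fderiv_eq_zero ξ hz]

lemma C10.hasCompactSupport_fderiv_apply (ξ : C10 S) (e : Space m × ℝ) :
    HasCompactSupport fun z => fderiv ℝ (ξ : Space m × ℝ → ℝ) z e := by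
  refine (ξ.2.2.1.fderiv ℝ).mono fun z hz => ?_
  contrapose! hz
  have h0 : fderiv ℝ (ξ : Space m × ℝ → ℝ) z = 0 := by simpa using hz
  simp [h0]

lemma C10.continuous_dx (ξ : C10 S) (i : Fin m) : Continuous (dx i (ξ : Space m × ℝ → ℝ)) :=
  C10.continuous_fderiv_apply ξ _

lemma C10.continuous_dt (ξ : C10 S) : Continuous (dt (ξ : Space m × ℝ → ℝ)) :=
  C10.continuous_fderiv_apply ξ _

lemma C10.hasCompactSupport_dx (ξ : C10 S) (i : Fin m) :
    HasCompactSupport (dx i (ξ : Space m × ℝ → ℝ)) := C10.hasCompactSupport_fderiv_apply ξ _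

lemma C10.hasCompactSupport_dt (ξ : C10 S) : HasCompactSupport (dt (ξ : Space m × ℝ → ℝ)) :=
  C10.hasCompactSupport_fderiv_apply ξ _

lemma C10.memLp_dx (ξ : C10 S) (i : Fin m) (μ : Measure (Space m × ℝ))
    [IsFiniteMeasureOnCompacts μ] : MemLp (dx i (ξ : Space m × ℝ → ℝ)) 2 μ :=
  (C10.continuous_dx ξ i).memLp_of_hasCompactSupport (C10.hasCompactSupport_dx ξ i)

lemma C10.memLp_dt (ξ : C10 S) (μ : Measure (Space m × ℝ))
    [IsFiniteMeasureOnCompacts μ] : MemLp (dt (ξ : Space m × ℝ → ℝ)) 2 μ :=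
  (C10.continuous_dt ξ).memLp_of_hasCompactSupport (C10.hasCompactSupport_dt ξ)

lemma C10.differentiable (ξ : C10 S) : Differentiable ℝ (ξ : Space m × ℝ → ℝ) :=
  ξ.2.1.differentiable one_ne_zero

lemma C10.dt_add (ξ ζ : C10 S) : dt ((ξ + ζ : C10 S) : Space m × ℝ → ℝ)
    = dt (ξ : Space m × ℝ → ℝ) + dt (ζ : Space m × ℝ → ℝ) := by
  funext z
  simp [dt, fderiv_add (C10.differentiable ξ z) (C10.differentiable ζ z)]

lemma C10.dt_smul (c : ℝ) (ξ : C10 S) : dt ((c • ξ : C10 S) : Space m × ℝ → ℝ)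
    = c • dt (ξ : Space m × ℝ → ℝ) := by
  funext z
  simp [dt, fderiv_const_smul (C10.differentiable ξ z)]

lemma C10.gradx_add (ξ ζ : C10 S) : gradx ((ξ + ζ : C10 S) : Space m × ℝ → ℝ)
    = gradx (ξ : Space m × ℝ → ℝ) + gradx (ζ : Space m × ℝ → ℝ) := by
  funext z
  ext i
  simp [gradx, dx, fderiv_add (C10.differentiable ξ z) (C10.differentiable ζ z)]

lemma C10.gradx_smul (c : ℝ) (ξ : C10 S) : gradx ((c • ξ : C10 S) : Space m × ℝ → ℝ)
    = c • gradx (ξ : Space m × ℝ → ℝ) := by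
  funext z
  ext i
  simp [gradx, dx, fderiv_const_smul (C10.differentiable ξ z)]

/-- Integration by parts in the direction `e` on space-time. -/
lemma C10.integral_mul_fderiv (ξ : C10 S) (ζ : C10 S') (e : Space m × ℝ) :
    ∫ z, (ξ : Space m × ℝ → ℝ) z * fderiv ℝ (ζ : Space m × ℝ → ℝ) z e
      = -∫ z, fderiv ℝ (ξ : Space m × ℝ → ℝ) z e * (ζ : Space m × ℝ → ℝ) z := by
  have hξ := ξ.2.1.continuous
  have hζ := ζ.2.1.continuous
  exact integral_mul_fderiv_eq_neg_fderiv_mul_of_integrable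
    (((C10.continuous_fderiv_apply ξ _).mul hζ).integrable_of_hasCompactSupport ζ.2.2.1.mul_left)
    ((hξ.mul (C10.continuous_fderiv_apply ζ _)).integrable_of_hasCompactSupport ξ.2.2.1.mul_right)
    ((hξ.mul hζ).integrable_of_hasCompactSupport ξ.2.2.1.mul_right)
    (fun z _ => ξ.2.1.differentiable one_ne_zero z)
    (fun z _ => ζ.2.1.differentiable one_ne_zero z)

/-- Multiplication of a test function by a `C¹` function of time. -/
lemma C10.exists_mul_time {χ : ℝ → ℝ} (hχ : ContDiff ℝ 1 χ) (ξ : C10 S)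
    (hs : ∀ z ∈ S, z.2 ∈ tsupport χ → z ∈ S') :
    ∃ ζ : C10 S', (∀ z, (ζ : Space m × ℝ → ℝ) z = χ z.2 * (ξ : Space m × ℝ → ℝ) z) ∧
      ∀ z, gradx (ζ : Space m × ℝ → ℝ) z = χ z.2 • gradx (ξ : Space m × ℝ → ℝ) z := by
  have h1 : ContDiff ℝ 1 fun z : Space m × ℝ => χ z.2 := hχ.comp contDiff_snd
  refine ⟨⟨fun z => χ z.2 * (ξ : Space m × ℝ → ℝ) z, h1.mul ξ.2.1,
    ξ.2.2.1.mul_left, fun z hz => ?_⟩, fun z => rfl, fun z => ?_⟩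
  · refine hs z (ξ.2.2.2 (closure_mono (Function.support_mul_subset_right _ _) hz)) ?_
    have h2 : z ∈ closure (Function.support fun z : Space m × ℝ => χ z.2) :=
      closure_mono (Function.support_mul_subset_left _ _) hz
    exact closure_mono (image_subset_iff.2 fun y hy => hy)
      (image_closure_subset_closure_image continuous_snd ⟨z, h2, rfl⟩)
  · ext i
    have hd : fderiv ℝ (fun z : Space m × ℝ => χ z.2 * (ξ : Space m × ℝ → ℝ) z) z
        (EuclideanSpace.single i 1, 0)
        = χ z.2 * fderiv ℝ (ξ : Space m × ℝ → ℝ) z (EuclideanSpace.single i 1, 0) := by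
      have h3 : HasFDerivAt (fun z : Space m × ℝ => χ z.2)
          ((fderiv ℝ χ z.2).comp (ContinuousLinearMap.snd ℝ (Space m) ℝ)) z :=
        (hχ.differentiable one_ne_zero z.2).hasFDerivAt.comp z hasFDerivAt_snd
      have h4 : fderiv ℝ (fun z : Space m × ℝ => χ z.2 * (ξ : Space m × ℝ → ℝ) z) z = _ :=
        (h3.mul (C10.differentiable ξ z).hasFDerivAt).fderiv
      rw [h4]
      simp
    simpa [gradx, dx] using hd

/-- The pair `(ξ, ∇ξ)` restricted to `Q`, for a test function `ξ` on another set. -/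
def restrictPair (Q : Set (Space m × ℝ)) : C10 S →ₗ[ℝ] L2Pair Q where
  toFun ξ := WithLp.toLp 2 ((C10.memLp ξ (volume.restrict Q)).toLp _,
    (C10.memLp_gradx ξ (volume.restrict Q)).toLp _)
  map_add' := by
    intro ξ ζ
    rw [← WithLp.toLp_add, Prod.mk_add_mk, ← MemLp.toLp_add, ← MemLp.toLp_add]
    congr 2
    simp only [C10.gradx_add]
  map_smul' := by
    intro c ξ
    rw [RingHom.id_apply, ← WithLp.toLp_smul, Prod.smul_mk, ← MemLp.toLp_const_smul,
      ← MemLp.toLp_const_smul]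
    congr 2
    simp only [C10.gradx_smul]

lemma restrictPair_fst (ξ : C10 S) :
    ((restrictPair Q ξ).fst : Space m × ℝ → ℝ) =ᵐ[volume.restrict Q] (ξ : Space m × ℝ → ℝ) :=
  (C10.memLp ξ (volume.restrict Q)).coeFn_toLp

lemma restrictPair_snd (ξ : C10 S) :
    ((restrictPair Q ξ).snd : Space m × ℝ → Space m) =ᵐ[volume.restrict Q]
      gradx (ξ : Space m × ℝ → ℝ) :=
  (C10.memLp_gradx ξ (volume.restrict Q)).coeFn_toLp

lemma inner_restrictPair_restrictPair (ξ : C10 S) (ζ : C10 S') :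
    inner ℝ (restrictPair Q ξ) (restrictPair Q ζ)
      = (∫ z in Q, (ζ : Space m × ℝ → ℝ) z * (ξ : Space m × ℝ → ℝ) z)
      + ∫ z in Q, inner ℝ (gradx (ξ : Space m × ℝ → ℝ) z) (gradx (ζ : Space m × ℝ → ℝ) z) := by
  rw [WithLp.prod_inner_apply]
  exact congrArg₂ (· + ·) (inner_toLp_toLp (C10.memLp ξ _) (C10.memLp ζ _))
    (inner_toLp_toLp (C10.memLp_gradx ξ _) (C10.memLp_gradx ζ _))

lemma norm_restrictPair_sq (ξ : C10 S) :
    ‖restrictPair Q ξ‖ ^ 2 = (∫ z in Q, (ξ : Space m × ℝ → ℝ) z ^ 2)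
      + ∫ z in Q, ‖gradx (ξ : Space m × ℝ → ℝ) z‖ ^ 2 := by
  rw [← real_inner_self_eq_norm_sq, inner_restrictPair_restrictPair]
  simp [sq]

lemma isClosed_H10 : IsClosed (H10 Q : Set (L2Pair Q)) := by
  have h : (H10 Q : Set (L2Pair Q)) = ⋂ (ξ : C10 Q) (i : Fin m), {p |
      ∫ z in Q, p.fst z * dx i (ξ : Space m × ℝ → ℝ) z
        = -∫ z in Q, p.snd z i * (ξ : Space m × ℝ → ℝ) z} := by
    ext p
    simp [H10]
  rw [h]
  refine isClosed_iInter fun ξ => isClosed_iInter fun i => isClosed_eq ?_ ?_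
  · have e : (fun p : L2Pair Q => ∫ z in Q, p.fst z * dx i (ξ : Space m × ℝ → ℝ) z)
        = fun p => inner ℝ ((C10.memLp_dx ξ i (volume.restrict Q)).toLp _) p.fst := by
      funext p
      rw [inner_toLp_eq_integral]
      rfl
    rw [e]
    exact continuous_const.inner (WithLp.prod_continuous_ofLp 2 _ _).fst
  · have hm : MemLp (fun z => (ξ : Space m × ℝ → ℝ) z • EuclideanSpace.single i (1 : ℝ)) 2
        (volume.restrict Q) :=
      (ξ.2.1.continuous.smul continuous_const).memLp_of_hasCompactSupport ξ.2.2.1.smul_right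
    have e : (fun p : L2Pair Q => ∫ z in Q, p.snd z i * (ξ : Space m × ℝ → ℝ) z)
        = fun p => inner ℝ (hm.toLp _) p.snd := by
      funext p
      rw [inner_toLp_eq_integral]
      refine integral_congr_ae (ae_of_all _ fun z => ?_)
      simp [inner_smul_left, EuclideanSpace.inner_single_left, mul_comm]
    refine Continuous.neg ?_
    rw [e]
    exact continuous_const.inner (WithLp.prod_continuous_ofLp 2 _ _).snd

lemma W_eq_closure : (W Q : Set (L2Pair Q)) = closure (range (testToL2Pair Q)) := by
  have h : (LinearMap.range (testToL2Pair Q)).topologicalClosure ≤ H10 Q := by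
    refine Submodule.topologicalClosure_minimal _ ?_ isClosed_H10
    rintro _ ⟨ξ, rfl⟩
    exact testToL2Pair_mem_H10 ξ
  rw [W, inf_eq_right.2 h, Submodule.topologicalClosure_coe]
  rfl

lemma isClosed_W : IsClosed (W Q : Set (L2Pair Q)) := by
  rw [W_eq_closure]
  exact isClosed_closure

instance : CompleteSpace (W Q) := isClosed_W.completeSpace_coe

lemma denseRange_testToW : DenseRange (testToW : C10 Q → W Q) := by
  intro w
  rw [closure_subtype]
  refine closure_mono ?_ w.2.2
  rintro _ ⟨ξ, rfl⟩
  exact ⟨(testToW ξ), ⟨ξ, rfl⟩, rfl⟩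

end TestFunctions

/-! ### Functions that are smooth up to the initial and the final time -/

/-- `C¹` functions with compact support in `Ω × ℝ`. -/
abbrev TimeTest (Ω : Set (Space m)) : Type := C10 (Ω ×ˢ (univ : Set ℝ))

/-- `valW` as a continuous linear map. -/
def valCLM (Q : Set (Space m × ℝ)) : W Q →L[ℝ] L2 Q :=
  (WithLp.fstL 2 ℝ (L2 Q) (L2Vec Q)).comp (W Q).subtypeL

/-- `gradW` as a continuous linear map. -/
def gradCLM (Q : Set (Space m × ℝ)) : W Q →L[ℝ] L2Vec Q :=
  (WithLp.sndL 2 ℝ (L2 Q) (L2Vec Q)).comp (W Q).subtypeL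

section Cylinder

variable {S S' Q : Set (Space m × ℝ)}

lemma norm_W_sq (w : W Q) : ‖w‖ ^ 2 = ‖valW w‖ ^ 2 + ‖gradW w‖ ^ 2 :=
  WithLp.prod_norm_sq_eq_of_L2 (w : L2Pair Q)

lemma norm_valW_le (w : W Q) : ‖valW w‖ ≤ ‖w‖ := by
  refine le_of_sq_le_sq ?_ (norm_nonneg _)
  rw [norm_W_sq]
  nlinarith [sq_nonneg ‖gradW w‖]

/-- The functional `φ ↦ ∫ h φ` on `W`. -/
def pairing (h : L2 Q) : StrongDual ℝ (W Q) := (innerSL ℝ h).comp (valCLM Q)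

lemma pairing_apply (h : L2 Q) (φ : W Q) : pairing h φ = inner ℝ h (valW φ) := rfl

variable {Ω : Set (Space m)} {T : ℝ}

lemma measurableSet_cylinder (hΩ : MeasurableSet Ω) : MeasurableSet (cylinder Ω T) :=
  hΩ.prod measurableSet_Ioo

lemma measurableSet_timeSlab (a b : ℝ) : MeasurableSet {z : Space m × ℝ | z.2 ∈ Ioo a b} :=
  measurable_snd measurableSet_Ioo

lemma cylinder_inter_timeSlab {a b : ℝ} (ha : 0 ≤ a) (hb : b ≤ T) :
    cylinder Ω T ∩ {z : Space m × ℝ | z.2 ∈ Ioo a b} = Ω ×ˢ Ioo a b := by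
  ext z
  simp only [cylinder, mem_inter_iff, mem_prod, mem_Ioo, mem_ofPred_eq]
  constructor
  · tauto
  · rintro ⟨h1, h2, h3⟩
    exact ⟨⟨h1, by linarith, by linarith⟩, h2, h3⟩

/-- A smooth cutoff of `(a, b)`. -/
def timeCutoff (a b : ℝ) (n : ℕ) (t : ℝ) : ℝ :=
  Real.smoothTransition ((n + 1) * (t - a) - 1) * Real.smoothTransition ((n + 1) * (b - t) - 1)

lemma contDiff_timeCutoff (a b : ℝ) (n : ℕ) : ContDiff ℝ 1 (timeCutoff a b n) := by
  have h : ContDiff ℝ 1 Real.smoothTransition := Real.smoothTransition.contDiff (n := 1)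
  exact (h.comp (by fun_prop)).mul (h.comp (by fun_prop))

lemma timeCutoff_nonneg (a b : ℝ) (n : ℕ) (t : ℝ) : 0 ≤ timeCutoff a b n t :=
  mul_nonneg (Real.smoothTransition.nonneg _) (Real.smoothTransition.nonneg _)

lemma timeCutoff_le_one (a b : ℝ) (n : ℕ) (t : ℝ) : timeCutoff a b n t ≤ 1 :=
  mul_le_one₀ (Real.smoothTransition.le_one _) (Real.smoothTransition.nonneg _)
    (Real.smoothTransition.le_one _)

lemma timeCutoff_eq_zero {a b t : ℝ} {n : ℕ}
    (h : t ∉ Icc (a + 1 / ((n : ℝ) + 1)) (b - 1 / ((n : ℝ) + 1))) :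
    timeCutoff a b n t = 0 := by
  have hn : (0 : ℝ) < n + 1 := by positivity
  have e : ((n : ℝ) + 1) * (1 / (n + 1)) = 1 := by field_simp
  rw [mem_Icc, not_and_or, not_le, not_le] at h
  rcases h with h | h
  · rw [timeCutoff, Real.smoothTransition.zero_of_nonpos, zero_mul]
    nlinarith
  · rw [timeCutoff, Real.smoothTransition.zero_of_nonpos (x := (n + 1) * (b - t) - 1), mul_zero]
    nlinarith

lemma tsupport_timeCutoff (a b : ℝ) (n : ℕ) : tsupport (timeCutoff a b n) ⊆ Ioo a b := by
  have hn : (0 : ℝ) < 1 / ((n : ℝ) + 1) := by positivity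
  refine (closure_minimal (t := Icc (a + 1 / ((n : ℝ) + 1)) (b - 1 / ((n : ℝ) + 1)))
    (fun t ht => ?_) isClosed_Icc).trans fun t ht => ⟨by linarith [ht.1], by linarith [ht.2]⟩
  by_contra h
  exact ht (timeCutoff_eq_zero h)

lemma tendsto_timeCutoff (a b t : ℝ) :
    Tendsto (fun n => timeCutoff a b n t) atTop (𝓝 ((Ioo a b).indicator 1 t)) := by
  by_cases h : t ∈ Ioo a b
  · rw [indicator_of_mem h]
    refine tendsto_const_nhds.congr' ?_
    obtain ⟨N, hN⟩ := exists_nat_gt (max (2 / (t - a)) (2 / (b - t)))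
    filter_upwards [eventually_ge_atTop N] with n hn
    have hn' : (N : ℝ) ≤ n := by exact_mod_cast hn
    have h1 : 0 < t - a := sub_pos.2 h.1
    have h2 : 0 < b - t := sub_pos.2 h.2
    have h3 : 2 / (t - a) < n := ((le_max_left _ _).trans_lt hN).trans_le hn'
    have h4 : 2 / (b - t) < n := ((le_max_right _ _).trans_lt hN).trans_le hn'
    rw [div_lt_iff₀ h1] at h3
    rw [div_lt_iff₀ h2] at h4
    rw [timeCutoff, Real.smoothTransition.one_of_one_le (by nlinarith),
      Real.smoothTransition.one_of_one_le (by nlinarith)]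
    simp
  · rw [indicator_of_notMem h]
    refine tendsto_const_nhds.congr' (Eventually.of_forall fun n => ?_)
    by_contra h'
    exact h (tsupport_timeCutoff a b n (subset_closure (Ne.symm h')))

/-- The restriction of a function in `C¹₀(Ω × ℝ)` to a time interval, extended by zero, is in `W`. -/
lemma exists_W_timeSlab (ξ : TimeTest Ω) {a b : ℝ} (ha : 0 ≤ a) (hb : b ≤ T) :
    ∃ w : W (cylinder Ω T),
      (valW w =ᵐ[volume.restrict (cylinder Ω T)]
        {z | z.2 ∈ Ioo a b}.indicator (ξ : Space m × ℝ → ℝ)) ∧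
      (gradW w =ᵐ[volume.restrict (cylinder Ω T)]
        {z | z.2 ∈ Ioo a b}.indicator (gradx (ξ : Space m × ℝ → ℝ))) := by
  set μ := (volume : Measure (Space m × ℝ)).restrict (cylinder Ω T)
  have h1 := (C10.memLp ξ μ).indicator (measurableSet_timeSlab (m := m) a b)
  have h2 := (C10.memLp_gradx ξ μ).indicator (measurableSet_timeSlab (m := m) a b)
  have hζ : ∀ n : ℕ, ∃ ζ : C10 (cylinder Ω T),
      (∀ z, (ζ : Space m × ℝ → ℝ) z = timeCutoff a b n z.2 * (ξ : Space m × ℝ → ℝ) z) ∧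
      ∀ z, gradx (ζ : Space m × ℝ → ℝ) z
        = timeCutoff a b n z.2 • gradx (ξ : Space m × ℝ → ℝ) z := fun n => by
    refine C10.exists_mul_time (contDiff_timeCutoff a b n) ξ fun z hz ht => ?_
    have := tsupport_timeCutoff a b n ht
    exact ⟨hz.1, ha.trans_lt this.1, this.2.trans_le hb⟩
  choose ζ hζ1 hζ2 using hζ
  have hlim : ∀ z : Space m × ℝ, Tendsto (fun n => timeCutoff a b n z.2) atTop
      (𝓝 ((Ioo a b).indicator 1 z.2)) := fun z => tendsto_timeCutoff a b z.2
  have habs : ∀ n t, ‖timeCutoff a b n t‖ ≤ 1 := fun n t => by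
    rw [Real.norm_of_nonneg (timeCutoff_nonneg _ _ _ _)]
    exact timeCutoff_le_one _ _ _ _
  have t1 : Tendsto (fun n => (C10.memLp (ζ n) μ).toLp _) atTop (𝓝 (h1.toLp _)) := by
    refine tendsto_toLp_of_dominated _ _ (C10.memLp ξ μ).norm (fun n z => ?_) fun z => ?_
    · rw [hζ1, norm_mul]
      exact mul_le_of_le_one_left (norm_nonneg _) (habs _ _)
    · simp_rw [hζ1]
      convert (hlim z).mul_const ((ξ : Space m × ℝ → ℝ) z) using 2
      by_cases h : z.2 ∈ Ioo a b
      · rw [indicator_of_mem h, indicator_of_mem (by exact h)]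
        simp
      · rw [indicator_of_notMem h, indicator_of_notMem (by exact h)]
        simp
  have t2 : Tendsto (fun n => (C10.memLp_gradx (ζ n) μ).toLp _) atTop (𝓝 (h2.toLp _)) := by
    refine tendsto_toLp_of_dominated _ _ (C10.memLp_gradx ξ μ).norm (fun n z => ?_) fun z => ?_
    · rw [hζ2, norm_smul]
      exact mul_le_of_le_one_left (norm_nonneg _) (habs _ _)
    · simp_rw [hζ2]
      have h := (hlim z).smul_const (gradx (ξ : Space m × ℝ → ℝ) z)
      have e : {z : Space m × ℝ | z.2 ∈ Ioo a b}.indicator (gradx (ξ : Space m × ℝ → ℝ)) z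
          = (Ioo a b).indicator (1 : ℝ → ℝ) z.2 • gradx (ξ : Space m × ℝ → ℝ) z := by
        by_cases h : z.2 ∈ Ioo a b
        · rw [indicator_of_mem h, indicator_of_mem (by exact h)]
          simp
        · rw [indicator_of_notMem h, indicator_of_notMem (by exact h)]
          simp
      rw [e]
      exact h
  have t3 : Tendsto (fun n => testToL2Pair (cylinder Ω T) (ζ n)) atTop
      (𝓝 (WithLp.toLp 2 (h1.toLp _, h2.toLp _))) :=
    ((WithLp.prod_continuous_toLp 2 _ _).tendsto _).comp (t1.prodMk_nhds t2)
  refine ⟨⟨WithLp.toLp 2 (h1.toLp _, h2.toLp _), ?_⟩, h1.coeFn_toLp, h2.coeFn_toLp⟩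
  rw [← SetLike.mem_coe, W_eq_closure]
  exact mem_closure_of_tendsto t3 (Eventually.of_forall fun n => ⟨ζ n, rfl⟩)

lemma ae_mem_timeSlab : ∀ᵐ z ∂(volume.restrict (cylinder Ω T)), z.2 ∈ Ioo 0 T := by
  have h0 : ∀ᵐ z ∂(volume.restrict (cylinder Ω T)),
      z ∈ {z : Space m × ℝ | z.2 ∈ Ioo 0 T} := by
    rw [ae_iff]
    have hm : MeasurableSet {z : Space m × ℝ | z ∉ {z : Space m × ℝ | z.2 ∈ Ioo 0 T}} :=
      (measurableSet_timeSlab 0 T).compl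
    rw [Measure.restrict_apply hm]
    refine measure_mono_null (t := ∅) ?_ measure_empty
    rintro z ⟨h3, h4⟩
    exact h3 h4.2
  exact h0

lemma restrictPair_mem_W (ξ : TimeTest Ω) : restrictPair (cylinder Ω T) ξ ∈ W (cylinder Ω T) := by
  obtain ⟨w, h1, h2⟩ := exists_W_timeSlab (T := T) ξ le_rfl le_rfl
  have e : restrictPair (cylinder Ω T) ξ = w := by
    refine WithLp.ofLp_injective 2 (Prod.ext (Lp.ext ?_) (Lp.ext ?_))
    · filter_upwards [restrictPair_fst (Q := cylinder Ω T) ξ, h1, ae_mem_timeSlab] with z a b c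
      refine a.trans (Eq.trans ?_ b.symm)
      rw [indicator_of_mem (by exact c)]
    · filter_upwards [restrictPair_snd (Q := cylinder Ω T) ξ, h2, ae_mem_timeSlab] with z a b c
      refine a.trans (Eq.trans ?_ b.symm)
      rw [indicator_of_mem (by exact c)]
  rw [e]
  exact w.2

/-- The inclusion of `C¹₀(Ω × ℝ)` in `W`. -/
def timeTestToW (T : ℝ) : TimeTest Ω →ₗ[ℝ] W (cylinder Ω T) :=
  (restrictPair (cylinder Ω T)).codRestrict _ restrictPair_mem_W

lemma valW_timeTestToW (ξ : TimeTest Ω) :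
    valW (timeTestToW T ξ) =ᵐ[volume.restrict (cylinder Ω T)] (ξ : Space m × ℝ → ℝ) :=
  restrictPair_fst ξ

lemma gradW_timeTestToW (ξ : TimeTest Ω) :
    gradW (timeTestToW T ξ) =ᵐ[volume.restrict (cylinder Ω T)] gradx (ξ : Space m × ℝ → ℝ) :=
  restrictPair_snd ξ

/-- The time derivative of a function in `C¹₀(Ω × ℝ)`, as an element of `W'`. -/
def timeTestDt (T : ℝ) : TimeTest Ω →ₗ[ℝ] StrongDual ℝ (W (cylinder Ω T)) where
  toFun ξ := pairing ((C10.memLp_dt ξ (volume.restrict (cylinder Ω T))).toLp _)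
  map_add' ξ ζ := by
    ext φ
    rw [add_apply, pairing_apply, pairing_apply, pairing_apply, ← inner_add_left,
      ← MemLp.toLp_add]
    simp only [C10.dt_add]
  map_smul' c ξ := by
    ext φ
    rw [smul_apply, pairing_apply, pairing_apply, RingHom.id_apply, smul_eq_mul,
      ← real_inner_smul_left, ← MemLp.toLp_const_smul]
    simp only [C10.dt_smul]

lemma timeTestDt_apply (ξ : TimeTest Ω) (φ : W (cylinder Ω T)) :
    timeTestDt T ξ φ = ∫ z in cylinder Ω T, dt (ξ : Space m × ℝ → ℝ) z * valW φ z := by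
  refine (inner_toLp_eq_integral (C10.memLp_dt ξ _) (valW φ)).trans ?_
  refine integral_congr_ae (ae_of_all _ fun z => ?_)
  simp [mul_comm]

lemma setIntegral_mul_dt (ξ : C10 S) (ζ : C10 Q) :
    ∫ z in Q, dt (ξ : Space m × ℝ → ℝ) z * (ζ : Space m × ℝ → ℝ) z
      = -∫ z in Q, (ξ : Space m × ℝ → ℝ) z * dt (ζ : Space m × ℝ → ℝ) z := by
  rw [setIntegral_eq_integral_of_forall_compl_eq_zero fun z hz => by
      rw [C10.eq_zero ζ hz, mul_zero],
    setIntegral_eq_integral_of_forall_compl_eq_zero fun z hz => by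
      rw [C10.dt_eq_zero ζ hz, mul_zero]]
  exact (neg_eq_iff_eq_neg.2 (C10.integral_mul_fderiv ξ ζ (0, 1))).symm

lemma isTimeDeriv_timeTest (ξ : TimeTest Ω) :
    IsTimeDeriv (timeTestToW T ξ) (timeTestDt T ξ) := by
  intro ζ
  have h1 : ∫ z in cylinder Ω T, dt (ξ : Space m × ℝ → ℝ) z * valW (testToW ζ) z
      = ∫ z in cylinder Ω T, dt (ξ : Space m × ℝ → ℝ) z * (ζ : Space m × ℝ → ℝ) z := by
    refine integral_congr_ae ?_
    filter_upwards [restrictPair_fst (Q := cylinder Ω T) ζ] with z hz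
    exact congrArg _ hz
  have h2 : ∫ z in cylinder Ω T, valW (timeTestToW T ξ) z * dt (ζ : Space m × ℝ → ℝ) z
      = ∫ z in cylinder Ω T, (ξ : Space m × ℝ → ℝ) z * dt (ζ : Space m × ℝ → ℝ) z := by
    refine integral_congr_ae ?_
    filter_upwards [valW_timeTestToW (T := T) ξ] with z hz
    rw [hz]
  rw [timeTestDt_apply, h1, h2, setIntegral_mul_dt]

/-! ### Time slices -/

lemma C10.continuous_slice (ξ : C10 S) (s : ℝ) :
    Continuous fun x => (ξ : Space m × ℝ → ℝ) (x, s) :=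
  ξ.2.1.continuous.comp (by fun_prop)

lemma C10.hasCompactSupport_slice (ξ : C10 S) (s : ℝ) :
    HasCompactSupport fun x => (ξ : Space m × ℝ → ℝ) (x, s) := by
  refine HasCompactSupport.intro (ξ.2.2.1.isCompact.image continuous_fst) fun x hx => ?_
  exact image_eq_zero_of_notMem_tsupport fun h => hx ⟨_, h, rfl⟩

lemma C10.memLp_slice (ξ : C10 S) (s : ℝ) (μ : Measure (Space m)) [IsFiniteMeasureOnCompacts μ] :
    MemLp (fun x => (ξ : Space m × ℝ → ℝ) (x, s)) 2 μ :=
  (C10.continuous_slice ξ s).memLp_of_hasCompactSupport (C10.hasCompactSupport_slice ξ s)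

/-- The slice `ξ(·, s)` in `L²(Ω)`. -/
def slice (Ω : Set (Space m)) (ξ : C10 S) (s : ℝ) : Lp ℝ 2 (volume.restrict Ω) :=
  (C10.memLp_slice ξ s (volume.restrict Ω)).toLp _

lemma slice_sub (ξ ζ : C10 S) (s : ℝ) : slice Ω (ξ - ζ) s = slice Ω ξ s - slice Ω ζ s :=
  MemLp.toLp_sub _ _

lemma inner_slice (ξ : C10 S) (ζ : C10 S') (s : ℝ) :
    inner ℝ (slice Ω ξ s) (slice Ω ζ s)
      = ∫ x in Ω, (ξ : Space m × ℝ → ℝ) (x, s) * (ζ : Space m × ℝ → ℝ) (x, s) := by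
  refine (inner_toLp_toLp (C10.memLp_slice ξ s _) (C10.memLp_slice ζ s _)).trans ?_
  simp [mul_comm]

lemma continuous_slice (hb : Bornology.IsBounded Ω) (ξ : C10 S) : Continuous (slice Ω ξ) := by
  have hfin : IsFiniteMeasure (volume.restrict Ω) := ⟨by
    rw [Measure.restrict_apply_univ]
    exact hb.measure_lt_top⟩
  have hu : UniformContinuous (ξ : Space m × ℝ → ℝ) :=
    ξ.2.2.1.uniformContinuous_of_continuous ξ.2.1.continuous
  set C : ℝ := (measureUnivNNReal (volume.restrict Ω) : ℝ) ^ ((2 : ENNReal).toReal⁻¹)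
  have hC : 0 ≤ C := Real.rpow_nonneg (NNReal.coe_nonneg _) _
  refine Metric.continuous_iff.2 fun b ε hε => ?_
  obtain ⟨δ, hδ, H⟩ := Metric.uniformContinuous_iff.1 hu (ε / (C + 1)) (by positivity)
  refine ⟨δ, hδ, fun a hab => ?_⟩
  have h1 : ‖slice Ω ξ a - slice Ω ξ b‖ ≤ C * (ε / (C + 1)) := by
    refine Lp.norm_le_of_ae_bound (by positivity) ?_
    rw [slice, slice, ← MemLp.toLp_sub]
    filter_upwards [((C10.memLp_slice ξ a (volume.restrict Ω)).sub
      (C10.memLp_slice ξ b (volume.restrict Ω))).coeFn_toLp] with x hx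
    rw [hx, Pi.sub_apply, ← dist_eq_norm]
    refine (H ?_).le
    rw [Prod.dist_eq]
    simp only [dist_self]
    exact max_lt hδ hab
  rw [dist_eq_norm]
  refine h1.trans_lt ?_
  rw [mul_div_assoc', div_lt_iff₀ (by positivity)]
  nlinarith

/-- The product rule in time, integrated over `Ω × (a, b)`. -/
lemma inner_slice_sub_inner_slice (ξ : C10 S) (ζ : C10 S') {a b : ℝ} (hab : a ≤ b) :
    inner ℝ (slice Ω ξ b) (slice Ω ζ b) - inner ℝ (slice Ω ξ a) (slice Ω ζ a)
      = ∫ z in Ω ×ˢ Ioo a b, ((ξ : Space m × ℝ → ℝ) z * dt (ζ : Space m × ℝ → ℝ) z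
        + dt (ξ : Space m × ℝ → ℝ) z * (ζ : Space m × ℝ → ℝ) z) := by
  have hξ := ξ.2.1.continuous
  have hζ := ζ.2.1.continuous
  have hc : Continuous fun z : Space m × ℝ => (ξ : Space m × ℝ → ℝ) z * dt (ζ : Space m × ℝ → ℝ) z
        + dt (ξ : Space m × ℝ → ℝ) z * (ζ : Space m × ℝ → ℝ) z :=
    (hξ.mul (C10.continuous_dt ζ)).add ((C10.continuous_dt ξ).mul hζ)
  have hi : Integrable (fun z : Space m × ℝ =>
      (ξ : Space m × ℝ → ℝ) z * dt (ζ : Space m × ℝ → ℝ) z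
        + dt (ξ : Space m × ℝ → ℝ) z * (ζ : Space m × ℝ → ℝ) z) :=
    hc.integrable_of_hasCompactSupport (ξ.2.2.1.mul_right.add ζ.2.2.1.mul_left)
  rw [Measure.volume_eq_prod, setIntegral_prod _ (by
    rw [← Measure.volume_eq_prod]; exact hi.integrableOn)]
  have hs : ∀ s, Integrable (fun x => (ξ : Space m × ℝ → ℝ) (x, s) * (ζ : Space m × ℝ → ℝ) (x, s))
      (volume.restrict Ω) := fun s =>
    (C10.memLp_slice ξ s _).integrable_mul (C10.memLp_slice ζ s _)
  rw [inner_slice, inner_slice, ← integral_sub (hs b) (hs a)]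
  refine integral_congr_ae (ae_of_all _ fun x => ?_)
  have hd : ∀ t : ℝ, HasDerivAt (fun t : ℝ =>
      (ξ : Space m × ℝ → ℝ) (x, t) * (ζ : Space m × ℝ → ℝ) (x, t))
      (dt (ξ : Space m × ℝ → ℝ) (x, t) * (ζ : Space m × ℝ → ℝ) (x, t)
        + (ξ : Space m × ℝ → ℝ) (x, t) * dt (ζ : Space m × ℝ → ℝ) (x, t)) t := fun t => by
    have hl : HasDerivAt (fun t : ℝ => (x, t)) ((0 : Space m), (1 : ℝ)) t :=
      (hasDerivAt_const t x).prodMk (hasDerivAt_id t)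
    exact ((C10.differentiable ξ (x, t)).hasFDerivAt.comp_hasDerivAt t hl).mul
      ((C10.differentiable ζ (x, t)).hasFDerivAt.comp_hasDerivAt t hl)
  have hft := intervalIntegral.integral_eq_sub_of_hasDerivAt (a := a) (b := b) (fun t _ => hd t)
    (Continuous.intervalIntegrable (by
      have := hc.comp (Continuous.prodMk continuous_const continuous_id : Continuous fun t => (x, t))
      simpa [Function.comp_def, add_comm] using this) _ _)
  rw [intervalIntegral.integral_of_le hab, integral_Ioc_eq_integral_Ioo] at hft
  dsimp only
  rw [← hft]
  refine integral_congr_ae (ae_of_all _ fun t => ?_)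
  dsimp only
  ring

lemma integral_norm_slice_sq (ξ : C10 S) (a b : ℝ) :
    Integrable (fun s => ‖slice Ω ξ s‖ ^ 2) (volume.restrict (Ioo a b)) ∧
    ∫ s in Ioo a b, ‖slice Ω ξ s‖ ^ 2
      = ∫ z in Ω ×ˢ Ioo a b, (ξ : Space m × ℝ → ℝ) z ^ 2 := by
  have e : ∀ s, ‖slice Ω ξ s‖ ^ 2 = ∫ x in Ω, (ξ : Space m × ℝ → ℝ) (x, s) ^ 2 := fun s => by
    rw [← real_inner_self_eq_norm_sq, inner_slice]
    simp [sq]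
  have hi : Integrable (fun z : Space m × ℝ => (ξ : Space m × ℝ → ℝ) z ^ 2)
      ((volume.restrict Ω).prod (volume.restrict (Ioo a b))) := by
    rw [Measure.prod_restrict, ← Measure.volume_eq_prod]
    exact (C10.memLp ξ _).integrable_sq
  simp_rw [e]
  refine ⟨hi.integral_prod_right, ?_⟩
  rw [Measure.volume_eq_prod, ← Measure.prod_restrict, integral_prod_symm _ hi]

/-- The norm of `C([0, T], L²(Ω))` is controlled by the norm of `U`. -/
lemma norm_slice_sq_le (hT : 0 < T) (ξ : TimeTest Ω)
    {s : ℝ} (hs : s ∈ Icc 0 T) :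
    ‖slice Ω ξ s‖ ^ 2 ≤ T⁻¹ * ‖timeTestToW T ξ‖ ^ 2
      + 2 * (‖timeTestDt T ξ‖ * ‖timeTestToW T ξ‖) := by
  have hval : ∫ z in cylinder Ω T, (ξ : Space m × ℝ → ℝ) z ^ 2 ≤ ‖timeTestToW T ξ‖ ^ 2 := by
    have h := norm_restrictPair_sq (Q := cylinder Ω T) ξ
    have h' : ‖timeTestToW T ξ‖ = ‖restrictPair (cylinder Ω T) ξ‖ := rfl
    rw [h', h]
    have : 0 ≤ ∫ z in cylinder Ω T, ‖gradx (ξ : Space m × ℝ → ℝ) z‖ ^ 2 :=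
      integral_nonneg fun z => by positivity
    linarith
  obtain ⟨hi, he⟩ := integral_norm_slice_sq (Ω := Ω) ξ 0 T
  obtain ⟨a, ha, hav⟩ := exists_le_setAverage (μ := volume) (s := Ioo 0 T)
    (f := fun s => ‖slice Ω ξ s‖ ^ 2) (by simp [hT]) (by simp) hi
  have hav' : ‖slice Ω ξ a‖ ^ 2 ≤ T⁻¹ * ‖timeTestToW T ξ‖ ^ 2 := by
    refine hav.trans ?_
    rw [setAverage_eq, he, smul_eq_mul]
    have : volume.real (Ioo 0 T) = T := by simp [hT.le]
    rw [this]
    exact mul_le_mul_of_nonneg_left hval (by positivity)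
  have key : ∀ c d, 0 ≤ c → c ≤ d → d ≤ T →
      |‖slice Ω ξ d‖ ^ 2 - ‖slice Ω ξ c‖ ^ 2|
        ≤ 2 * (‖timeTestDt T ξ‖ * ‖timeTestToW T ξ‖) := by
    intro c d hc hcd hd
    obtain ⟨w, hw1, hw2⟩ := exists_W_timeSlab (T := T) ξ hc hd
    have hslab := measurableSet_timeSlab (m := m) c d
    have hw : ‖w‖ ≤ ‖timeTestToW T ξ‖ := by
      refine le_of_sq_le_sq ?_ (norm_nonneg _)
      rw [norm_W_sq, norm_W_sq]
      refine add_le_add (pow_le_pow_left₀ (norm_nonneg _) (Lp.norm_le_norm_of_ae_le ?_) 2)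
        (pow_le_pow_left₀ (norm_nonneg _) (Lp.norm_le_norm_of_ae_le ?_) 2)
      · filter_upwards [hw1, valW_timeTestToW (T := T) ξ] with z h1 h2
        rw [h1, h2]
        exact norm_indicator_le_norm_self _ _
      · filter_upwards [hw2, gradW_timeTestToW (T := T) ξ] with z h1 h2
        rw [h1, h2]
        exact norm_indicator_le_norm_self _ _
    have e1 : timeTestDt T ξ w = ∫ z in Ω ×ˢ Ioo c d,
        dt (ξ : Space m × ℝ → ℝ) z * (ξ : Space m × ℝ → ℝ) z := by
      rw [timeTestDt_apply, ← cylinder_inter_timeSlab hc hd, ← setIntegral_indicator hslab]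
      refine integral_congr_ae ?_
      filter_upwards [hw1] with z h1
      rw [h1]
      by_cases hz : z ∈ {z : Space m × ℝ | z.2 ∈ Ioo c d}
      · simp only [indicator_of_mem hz]
      · simp only [indicator_of_notMem hz, mul_zero]
    have e2 : ‖slice Ω ξ d‖ ^ 2 - ‖slice Ω ξ c‖ ^ 2 = 2 * timeTestDt T ξ w := by
      rw [← real_inner_self_eq_norm_sq, ← real_inner_self_eq_norm_sq,
        inner_slice_sub_inner_slice ξ ξ hcd, e1, ← integral_const_mul]
      refine integral_congr_ae (ae_of_all _ fun z => ?_)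
      dsimp only
      ring
    rw [e2, abs_mul, abs_two]
    refine mul_le_mul_of_nonneg_left ?_ (by norm_num)
    exact ((timeTestDt T ξ).le_opNorm w).trans 
      (mul_le_mul_of_nonneg_left hw (ContinuousLinearMap.opNorm_nonneg _))
  rcases le_total a s with h | h
  · have := (abs_le.1 (key a s ha.1.le h hs.2)).2
    linarith
  · have := (abs_le.1 (key s a hs.1 h ha.2.le)).1
    linarith

end Cylinder

/-! ### Weighted averages in time -/

section TimeAverage

variable {E : Type*} [NormedAddCommGroup E] [NormedSpace ℝ E] {S S' : Set (Space m × ℝ)}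
  {ρ : ℝ → ℝ} {α β γ : ℝ} {f g : Space m × ℝ → E}

/-- The average `∫ ρ(s) f(x, α t + β + γ s) ds`. -/
def timeAvg (ρ : ℝ → ℝ) (α β γ : ℝ) (f : Space m × ℝ → E) (z : Space m × ℝ) : E :=
  ∫ s, ρ s • f (z.1, α * z.2 + β + γ * s)

lemma integrable_timeAvg (hρ : Continuous ρ) (hρs : HasCompactSupport ρ) (hf : Continuous f)
    (z : Space m × ℝ) : Integrable fun s => ρ s • f (z.1, α * z.2 + β + γ * s) :=
  (hρ.smul (hf.comp (by fun_prop))).integrable_of_hasCompactSupport hρs.smul_right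

lemma continuous_timeAvg (hρ : Continuous ρ) (hρs : HasCompactSupport ρ) (hf : Continuous f)
    (hfs : HasCompactSupport f) : Continuous (timeAvg ρ α β γ f) := by
  obtain ⟨C, hC⟩ := hfs.exists_bound_of_continuous hf
  refine continuous_of_dominated (bound := fun s => ‖ρ s‖ * C) ?_ ?_ ?_ ?_
  · exact fun z => (integrable_timeAvg hρ hρs hf z).1
  · refine fun z => ae_of_all _ fun s => ?_
    rw [norm_smul]
    exact mul_le_mul_of_nonneg_left (hC _) (norm_nonneg _)
  · exact (hρ.norm.integrable_of_hasCompactSupport hρs.norm).mul_const _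
  · exact ae_of_all _ fun s => (continuous_const (y := ρ s)).smul (hf.comp (by fun_prop))

lemma timeAvg_kernel_ne_zero (hα : α ≠ 0) {z : Space m × ℝ} {s : ℝ}
    (h : ρ s • f (z.1, α * z.2 + β + γ * s) ≠ 0) :
    z ∈ (fun q : (Space m × ℝ) × ℝ => (q.1.1, (q.1.2 - β - γ * q.2) / α)) ''
      (tsupport f ×ˢ tsupport ρ) := by
  refine ⟨((z.1, α * z.2 + β + γ * s), s),
    ⟨subset_closure fun h0 => h (by rw [h0, smul_zero]),
      subset_closure fun h0 => h (by rw [h0, zero_smul])⟩, Prod.ext rfl ?_⟩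
  dsimp only
  field_simp
  ring

lemma isCompact_timeAvg_image {F : Type*} [NormedAddCommGroup F] {f : Space m × ℝ → F}
    (hρs : HasCompactSupport ρ) (hfs : HasCompactSupport f) :
    IsCompact ((fun q : (Space m × ℝ) × ℝ => (q.1.1, (q.1.2 - β - γ * q.2) / α)) ''
      (tsupport f ×ˢ tsupport ρ)) :=
  (hfs.isCompact.prod hρs.isCompact).image (by fun_prop)

lemma hasCompactSupport_timeAvg_kernel (hα : α ≠ 0) (hρs : HasCompactSupport ρ)
    (hfs : HasCompactSupport f) :
    HasCompactSupport fun q : (Space m × ℝ) × ℝ =>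
      ρ q.2 • f (q.1.1, α * q.1.2 + β + γ * q.2) := by
  refine HasCompactSupport.intro ((isCompact_timeAvg_image (α := α) (β := β) (γ := γ)
    hρs hfs).prod hρs.isCompact) fun q hq => ?_
  by_contra h
  exact hq ⟨timeAvg_kernel_ne_zero hα h, subset_closure fun h0 => h (by rw [h0, zero_smul])⟩

lemma tsupport_timeAvg (hα : α ≠ 0) (hρs : HasCompactSupport ρ) (hfs : HasCompactSupport f) :
    tsupport (timeAvg ρ α β γ f) ⊆
      (fun q : (Space m × ℝ) × ℝ => (q.1.1, (q.1.2 - β - γ * q.2) / α)) ''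
        (tsupport f ×ˢ tsupport ρ) := by
  refine closure_minimal (fun z hz => ?_) (isCompact_timeAvg_image hρs hfs).isClosed
  by_contra h
  refine hz (integral_eq_zero_of_ae (ae_of_all _ fun s => ?_))
  by_contra h0
  exact h (timeAvg_kernel_ne_zero hα h0)

lemma hasCompactSupport_timeAvg (hα : α ≠ 0) (hρs : HasCompactSupport ρ)
    (hfs : HasCompactSupport f) : HasCompactSupport (timeAvg ρ α β γ f) :=
  (isCompact_timeAvg_image hρs hfs).of_isClosed_subset (isClosed_tsupport _)
    (tsupport_timeAvg hα hρs hfs)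

lemma hasFDerivAt_timeAvg (hρ : Continuous ρ) (hρs : HasCompactSupport ρ) (hf : ContDiff ℝ 1 f)
    (hfs : HasCompactSupport f) (z : Space m × ℝ) :
    HasFDerivAt (timeAvg ρ α β γ f)
      (timeAvg ρ α β γ (fun y => (fderiv ℝ f y).comp
        ((ContinuousLinearMap.fst ℝ (Space m) ℝ).prod
          (α • ContinuousLinearMap.snd ℝ (Space m) ℝ))) z) z := by
  set L : Space m × ℝ →L[ℝ] Space m × ℝ := (ContinuousLinearMap.fst ℝ (Space m) ℝ).prod
    (α • ContinuousLinearMap.snd ℝ (Space m) ℝ)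
  have hc : Continuous fun y => (fderiv ℝ f y).comp L :=
    (hf.continuous_fderiv one_ne_zero).clm_comp continuous_const
  have hcs : HasCompactSupport fun y => (fderiv ℝ f y).comp L :=
    (hfs.fderiv ℝ).comp_left (g := fun A : Space m × ℝ →L[ℝ] E => A.comp L)
      (ContinuousLinearMap.zero_comp L)
  obtain ⟨C, hC⟩ := hcs.exists_bound_of_continuous hc
  refine hasFDerivAt_integral_of_dominated_of_fderiv_le (s := univ)
    (bound := fun s => ‖ρ s‖ * C)
    (F' := fun z s => ρ s • (fderiv ℝ f (z.1, α * z.2 + β + γ * s)).comp L) univ_mem ?_ ?_ ?_ ?_ ?_ ?_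
  · exact Eventually.of_forall fun z => (integrable_timeAvg hρ hρs hf.continuous z).1
  · exact integrable_timeAvg hρ hρs hf.continuous z
  · exact (integrable_timeAvg hρ hρs hc z).1
  · refine ae_of_all _ fun s z _ => ?_
    rw [norm_smul]
    exact mul_le_mul_of_nonneg_left (hC _) (norm_nonneg _)
  · exact (hρ.norm.integrable_of_hasCompactSupport hρs.norm).mul_const _
  · refine ae_of_all _ fun s z _ => ?_
    refine HasFDerivAt.const_smul ?_ _
    have h1 : HasFDerivAt (fun z : Space m × ℝ => (z.1, α * z.2 + β + γ * s)) L z := by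
      refine hasFDerivAt_fst.prodMk ?_
      exact ((hasFDerivAt_snd.const_mul α).add_const β).add_const (γ * s)
    exact (hf.differentiable one_ne_zero _).hasFDerivAt.comp z h1

lemma contDiff_timeAvg (hρ : Continuous ρ) (hρs : HasCompactSupport ρ) (hf : ContDiff ℝ 1 f)
    (hfs : HasCompactSupport f) : ContDiff ℝ 1 (timeAvg ρ α β γ f) := by
  rw [contDiff_one_iff_hasFDerivAt]
  refine ⟨_, ?_, fun z => hasFDerivAt_timeAvg hρ hρs hf hfs z⟩
  refine continuous_timeAvg hρ hρs ((hf.continuous_fderiv one_ne_zero).clm_comp continuous_const) ?_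
  exact (hfs.fderiv ℝ).comp_left
    (g := fun A : Space m × ℝ →L[ℝ] E => A.comp ((ContinuousLinearMap.fst ℝ (Space m) ℝ).prod
          (α • ContinuousLinearMap.snd ℝ (Space m) ℝ)))
      (ContinuousLinearMap.zero_comp _)

lemma fderiv_timeAvg_apply (hρ : Continuous ρ) (hρs : HasCompactSupport ρ) (hf : ContDiff ℝ 1 f)
    (hfs : HasCompactSupport f) (z e : Space m × ℝ) :
    fderiv ℝ (timeAvg ρ α β γ f) z e
      = timeAvg ρ α β γ (fun y => fderiv ℝ f y (e.1, α * e.2)) z := by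
  have hi := integrable_timeAvg (α := α) (β := β) (γ := γ) hρ hρs (f := fun y =>
    (fderiv ℝ f y).comp ((ContinuousLinearMap.fst ℝ (Space m) ℝ).prod
      (α • ContinuousLinearMap.snd ℝ (Space m) ℝ)))
    ((hf.continuous_fderiv one_ne_zero).clm_comp continuous_const) z
  rw [(hasFDerivAt_timeAvg hρ hρs hf hfs z).fderiv]
  refine (ContinuousLinearMap.integral_apply hi e).trans
    (integral_congr_ae (ae_of_all _ fun s => ?_))
  simp

lemma gradx_timeAvg (hρ : Continuous ρ) (hρs : HasCompactSupport ρ) (ξ : C10 S)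
    (z : Space m × ℝ) :
    gradx (timeAvg ρ α β γ (ξ : Space m × ℝ → ℝ)) z
      = timeAvg ρ α β γ (gradx (ξ : Space m × ℝ → ℝ)) z := by
  ext i
  let P : Space m →L[ℝ] ℝ := EuclideanSpace.proj i
  have h := P.integral_comp_comm
    (integrable_timeAvg (α := α) (β := β) (γ := γ) hρ hρs (C10.continuous_gradx ξ) z)
  change dx i _ z = P (timeAvg ρ α β γ (gradx (ξ : Space m × ℝ → ℝ)) z)
  rw [timeAvg, ← h, dx, fderiv_timeAvg_apply hρ hρs ξ.2.1 ξ.2.2.1, timeAvg]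
  refine integral_congr_ae (ae_of_all _ fun s => ?_)
  simp [gradx, dx, P]

lemma dt_timeAvg (hρ : Continuous ρ) (hρs : HasCompactSupport ρ) (ξ : C10 S)
    (z : Space m × ℝ) :
    dt (timeAvg ρ α β γ (ξ : Space m × ℝ → ℝ)) z
      = α * timeAvg ρ α β γ (dt (ξ : Space m × ℝ → ℝ)) z := by
  rw [dt, fderiv_timeAvg_apply hρ hρs ξ.2.1 ξ.2.2.1, timeAvg, timeAvg, ← integral_const_mul]
  refine integral_congr_ae (ae_of_all _ fun s => ?_)
  have : ((0 : Space m), α * (1 : ℝ)) = α • ((0 : Space m), (1 : ℝ)) := by simp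
  simp only [this, map_smul, dt, smul_eq_mul]
  ring

/-- Averages of test functions are test functions. -/
lemma exists_C10_timeAvg (hα : α ≠ 0) (hρ : Continuous ρ) (hρs : HasCompactSupport ρ) (ξ : C10 S)
    (h : ∀ z ∈ S, ∀ s ∈ tsupport ρ, (z.1, (z.2 - β - γ * s) / α) ∈ S') :
    ∃ ζ : C10 S', (ζ : Space m × ℝ → ℝ) = timeAvg ρ α β γ (ξ : Space m × ℝ → ℝ) := by
  refine ⟨⟨_, contDiff_timeAvg hρ hρs ξ.2.1 ξ.2.2.1, hasCompactSupport_timeAvg hα hρs ξ.2.2.1,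
    (tsupport_timeAvg hα hρs ξ.2.2.1).trans ?_⟩, rfl⟩
  rintro _ ⟨q, ⟨hq1, hq2⟩, rfl⟩
  exact h _ (ξ.2.2.2 hq1) _ hq2

/-- Integration by parts in the averaging variable. -/
lemma timeAvg_dt (hγ : γ ≠ 0) (hρ : ContDiff ℝ 1 ρ) (hρs : HasCompactSupport ρ) (ξ : C10 S)
    (z : Space m × ℝ) :
    timeAvg ρ α β γ (dt (ξ : Space m × ℝ → ℝ)) z
      = -γ⁻¹ * timeAvg (deriv ρ) α β γ (ξ : Space m × ℝ → ℝ) z := by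
  have hd : ∀ s : ℝ, HasDerivAt (fun s => (ξ : Space m × ℝ → ℝ) (z.1, α * z.2 + β + γ * s))
      (γ * dt (ξ : Space m × ℝ → ℝ) (z.1, α * z.2 + β + γ * s)) s := fun s => by
    have hl : HasDerivAt (fun s : ℝ => (z.1, α * z.2 + β + γ * s)) ((0 : Space m), γ) s := by
      refine (hasDerivAt_const s z.1).prodMk ?_
      simpa using ((hasDerivAt_id s).const_mul γ).const_add (α * z.2 + β)
    have h := (C10.differentiable ξ (z.1, α * z.2 + β + γ * s)).hasFDerivAt.comp_hasDerivAt s hl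
    have e : ((0 : Space m), γ) = γ • ((0 : Space m), (1 : ℝ)) := by simp
    rw [e, map_smul] at h
    exact h
  have hρ' : ∀ s, HasDerivAt ρ (deriv ρ s) s := fun s =>
    (hρ.differentiable one_ne_zero s).hasDerivAt
  have hρ'c : Continuous (deriv ρ) := hρ.continuous_deriv le_rfl
  have h1 := integral_mul_deriv_eq_deriv_mul_of_integrable (u := ρ)
    (fun s _ => hρ' s) (fun s _ => hd s)
    ((hρ.continuous.mul (continuous_const.mul ((C10.continuous_dt ξ).comp
      (by fun_prop)))).integrable_of_hasCompactSupport hρs.mul_right)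
    ((hρ'c.mul (ξ.2.1.continuous.comp (by fun_prop))).integrable_of_hasCompactSupport
      hρs.deriv.mul_right)
    ((hρ.continuous.mul (ξ.2.1.continuous.comp (by fun_prop))).integrable_of_hasCompactSupport
      hρs.mul_right)
  have h2 : γ * timeAvg ρ α β γ (dt (ξ : Space m × ℝ → ℝ)) z
      = -timeAvg (deriv ρ) α β γ (ξ : Space m × ℝ → ℝ) z := by
    rw [timeAvg, timeAvg, ← integral_const_mul]
    refine Eq.trans (integral_congr_ae (ae_of_all _ fun s => ?_)) h1
    simp only [smul_eq_mul]
    ring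
  rw [neg_mul, ← mul_neg, ← h2, inv_mul_cancel_left₀ hγ]

/-- Affine change of the time variable. -/
lemma integral_comp_affine_time (hα : 0 < α) (c : ℝ) (hf : Continuous f)
    (hfs : HasCompactSupport f) :
    ∫ z : Space m × ℝ, f (z.1, α * z.2 + c) = α⁻¹ • ∫ z, f z := by
  have h1 : Integrable f := hf.integrable_of_hasCompactSupport hfs
  have h2 : Integrable fun z : Space m × ℝ => f (z.1, α * z.2 + c) := by
    refine (hf.comp (by fun_prop)).integrable_of_hasCompactSupport ?_
    exact hfs.comp_homeomorph ((Homeomorph.refl (Space m)).prodCongr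
      (affineHomeomorph α c hα.ne'))
  rw [Measure.volume_eq_prod] at h1 h2 ⊢
  rw [integral_prod _ h1, integral_prod _ h2, ← integral_smul]
  refine integral_congr_ae (ae_of_all _ fun x => ?_)
  dsimp only
  rw [Measure.integral_comp_mul_left (fun t => f (x, t + c)) α, abs_of_pos (inv_pos.2 hα),
    integral_add_right_eq_self (fun t => f (x, t)) c]

lemma sq_integral_mul_le (hρ : Continuous ρ) (hρs : HasCompactSupport ρ) {h : ℝ → ℝ}
    (hh : Continuous h) :
    (∫ s, |ρ s| * h s) ^ 2 ≤ (∫ s, |ρ s|) * ∫ s, |ρ s| * h s ^ 2 := by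
  have hi : ∀ k : ℝ → ℝ, Continuous k → Integrable fun s => |ρ s| * k s := fun k hk =>
    (hρ.abs.mul hk).integrable_of_hasCompactSupport
      (hρs.comp_left (g := fun r : ℝ => |r|) abs_zero).mul_right
  have key : ∀ y : ℝ, 0 ≤ (∫ s, |ρ s|) * (y * y) + (-2 * ∫ s, |ρ s| * h s) * y
      + ∫ s, |ρ s| * h s ^ 2 := fun y => by
    have h0 : 0 ≤ ∫ s, |ρ s| * (h s - y) ^ 2 :=
      integral_nonneg fun s => mul_nonneg (abs_nonneg _) (sq_nonneg _)
    have e : ∫ s, |ρ s| * (h s - y) ^ 2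
        = ∫ s, (|ρ s| * h s ^ 2 + ((-2 * y) * (|ρ s| * h s) + y ^ 2 * (|ρ s| * 1))) := by
      refine integral_congr_ae (ae_of_all _ fun s => ?_)
      dsimp only
      ring
    have i1 := hi (fun s => h s ^ 2) (hh.pow 2)
    have i2 := (hi h hh).const_mul (-2 * y)
    have i3 := (hi (fun _ => 1) continuous_const).const_mul (y ^ 2)
    have i4 : Integrable fun s => -2 * y * (|ρ s| * h s) + y ^ 2 * (|ρ s| * 1) := i2.add i3
    rw [e, integral_add i1 i4, integral_add i2 i3, integral_const_mul,
      integral_const_mul] at h0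
    simp only [mul_one] at h0
    linarith
  have := discrim_le_zero key
  rw [discrim] at this
  nlinarith

/-- Averaging is bounded on `L²`. -/
lemma integral_norm_timeAvg_sq_le (hα : 0 < α) (hρ : Continuous ρ) (hρs : HasCompactSupport ρ)
    (hf : Continuous f) (hfs : HasCompactSupport f) :
    ∫ z : Space m × ℝ, ‖timeAvg ρ α β γ f z‖ ^ 2
      ≤ (∫ s, |ρ s|) ^ 2 * α⁻¹ * ∫ z, ‖f z‖ ^ 2 := by
  have hf2 : Continuous fun z => ‖f z‖ ^ 2 := hf.norm.pow 2
  have hf2s : HasCompactSupport fun z => ‖f z‖ ^ 2 :=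
    hfs.comp_left (g := fun y : E => ‖y‖ ^ 2) (by simp)
  have hρa : HasCompactSupport fun s => |ρ s| := hρs.comp_left (g := fun r : ℝ => |r|) abs_zero
  have hk : Integrable (Function.uncurry fun (z : Space m × ℝ) (s : ℝ) =>
      |ρ s| * ‖f (z.1, α * z.2 + β + γ * s)‖ ^ 2) (volume.prod volume) := by
    have hc := hasCompactSupport_timeAvg_kernel (β := β) (γ := γ) hα.ne' hρa hf2s
    refine Continuous.integrable_of_hasCompactSupport ?_ hc
    exact (hρ.abs.comp continuous_snd).mul (hf2.comp (by fun_prop))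
  have hpt : ∀ z : Space m × ℝ, ‖timeAvg ρ α β γ f z‖ ^ 2
      ≤ (∫ s, |ρ s|) * ∫ s, |ρ s| * ‖f (z.1, α * z.2 + β + γ * s)‖ ^ 2 := fun z => by
    refine le_trans (pow_le_pow_left₀ (norm_nonneg _) ?_ 2)
      (sq_integral_mul_le hρ hρs (h := fun s => ‖f (z.1, α * z.2 + β + γ * s)‖)
        (hf.norm.comp (by fun_prop)))
    refine (norm_integral_le_integral_norm _).trans_eq ?_
    simp [norm_smul]
  calc ∫ z : Space m × ℝ, ‖timeAvg ρ α β γ f z‖ ^ 2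
      ≤ ∫ z : Space m × ℝ, (∫ s, |ρ s|) * ∫ s, |ρ s| * ‖f (z.1, α * z.2 + β + γ * s)‖ ^ 2 := by
        refine integral_mono_of_nonneg (ae_of_all _ fun z => by positivity) ?_ (ae_of_all _ hpt)
        exact hk.integral_prod_left.const_mul _
    _ = (∫ s, |ρ s|) * ∫ s, ∫ z : Space m × ℝ, |ρ s| * ‖f (z.1, α * z.2 + β + γ * s)‖ ^ 2 := by
        rw [integral_const_mul, integral_integral_swap hk]
    _ = (∫ s, |ρ s|) * ∫ s, |ρ s| * (α⁻¹ * ∫ z, ‖f z‖ ^ 2) := by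
        congr 1
        refine integral_congr_ae (ae_of_all _ fun s => ?_)
        dsimp only
        rw [integral_const_mul]
        congr 1
        have := integral_comp_affine_time hα (β + γ * s) hf2 hf2s
        simpa [add_assoc] using this
    _ = _ := by
        rw [integral_mul_const]
        ring

end TimeAverage

section TimeAverageInner

variable {E : Type*} [NormedAddCommGroup E] [InnerProductSpace ℝ E] [CompleteSpace E]
  {ρ : ℝ → ℝ} {α β γ : ℝ} {f g : Space m × ℝ → E}

/-- The adjoint of averaging. -/
lemma integral_inner_timeAvg (hα : 0 < α) (hρ : Continuous ρ) (hρs : HasCompactSupport ρ)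
    (hf : Continuous f) (hfs : HasCompactSupport f) (hg : Continuous g)
    (hgs : HasCompactSupport g) :
    ∫ z : Space m × ℝ, inner ℝ (timeAvg ρ α β γ f z) (g z)
      = α⁻¹ * ∫ z, inner ℝ (f z) (timeAvg ρ α⁻¹ (-β / α) (-γ / α) g z) := by
  have hk1 : Integrable (Function.uncurry fun (z : Space m × ℝ) (s : ℝ) =>
      ρ s * inner ℝ (f (z.1, α * z.2 + β + γ * s)) (g z)) (volume.prod volume) := by
    refine Continuous.integrable_of_hasCompactSupport ?_ ?_
    · exact (hρ.comp continuous_snd).mul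
        ((hf.comp (by fun_prop)).inner (hg.comp continuous_fst))
    · refine (hasCompactSupport_timeAvg_kernel (β := β) (γ := γ) hα.ne' hρs hfs).mono
        fun q hq h => hq ?_
      dsimp only [Function.uncurry] at h ⊢
      rw [← real_inner_smul_left, h, inner_zero_left]
  have hk2 : Integrable (Function.uncurry fun (z : Space m × ℝ) (s : ℝ) =>
      ρ s * inner ℝ (f z) (g (z.1, α⁻¹ * z.2 + -β / α + -γ / α * s))) (volume.prod volume) := by
    refine Continuous.integrable_of_hasCompactSupport ?_ ?_
    · exact (hρ.comp continuous_snd).mul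
        ((hf.comp continuous_fst).inner (hg.comp (by fun_prop)))
    · refine (hasCompactSupport_timeAvg_kernel (β := -β / α) (γ := -γ / α)
        (inv_ne_zero hα.ne') hρs hgs).mono fun q hq h => hq ?_
      dsimp only [Function.uncurry] at h ⊢
      rw [← real_inner_smul_right, h, inner_zero_right]
  have e1 : ∀ z : Space m × ℝ, inner ℝ (timeAvg ρ α β γ f z) (g z)
      = ∫ s, ρ s * inner ℝ (f (z.1, α * z.2 + β + γ * s)) (g z) := fun z => by
    rw [real_inner_comm, timeAvg, ← integral_inner (integrable_timeAvg hρ hρs hf z)]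
    refine integral_congr_ae (ae_of_all _ fun s => ?_)
    dsimp only
    rw [real_inner_smul_right, real_inner_comm]
  have e2 : ∀ z : Space m × ℝ, inner ℝ (f z) (timeAvg ρ α⁻¹ (-β / α) (-γ / α) g z)
      = ∫ s, ρ s * inner ℝ (f z) (g (z.1, α⁻¹ * z.2 + -β / α + -γ / α * s)) := fun z => by
    rw [timeAvg, ← integral_inner (integrable_timeAvg hρ hρs hg z)]
    refine integral_congr_ae (ae_of_all _ fun s => ?_)
    dsimp only
    rw [real_inner_smul_right]
  simp_rw [e1, e2]
  rw [integral_integral_swap hk1, integral_integral_swap hk2, ← integral_const_mul]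
  refine integral_congr_ae (ae_of_all _ fun s => ?_)
  dsimp only
  rw [integral_const_mul, integral_const_mul]
  have h := integral_comp_affine_time (m := m) hα (β + γ * s)
    (f := fun z : Space m × ℝ => inner ℝ (f z) (g (z.1, α⁻¹ * z.2 + -β / α + -γ / α * s)))
    (hf.inner (hg.comp (by fun_prop))) (hfs.mono fun z hz h0 => hz (by simp [h0]))
  rw [smul_eq_mul] at h
  rw [mul_left_comm, ← h]
  congr 1
  refine integral_congr_ae (ae_of_all _ fun z => ?_)
  have e : α⁻¹ * (α * z.2 + (β + γ * s)) + -β / α + -γ / α * s = z.2 := by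
    field_simp
    ring
  dsimp only
  rw [e, add_assoc]

end TimeAverageInner

/-! ### Density of smooth functions in the space `U` -/

section Density

variable {S S' Q : Set (Space m × ℝ)} {Ω : Set (Space m)} {T : ℝ} {ρ : ℝ → ℝ} {α β γ : ℝ}

lemma opNorm_le_of_forall_testToW {f : StrongDual ℝ (W Q)} {M : ℝ} (hM : 0 ≤ M)
    (h : ∀ φ : C10 Q, |f (testToW φ)| ≤ M * ‖testToW φ‖) : ‖f‖ ≤ M := by
  refine f.opNorm_le_bound hM fun w => ?_
  refine denseRange_testToW.induction_on (p := fun w => ‖f w‖ ≤ M * ‖w‖) w ?_ h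
  exact isClosed_le f.continuous.norm (continuous_const.mul continuous_norm)

lemma setIntegral_eq_integral_of_zero {F : Type*} [NormedAddCommGroup F] [NormedSpace ℝ F]
    {k : Space m × ℝ → F} (hk : ∀ z ∉ Q, k z = 0) : ∫ z in Q, k z = ∫ z, k z :=
  setIntegral_eq_integral_of_forall_compl_eq_zero hk

lemma norm_restrictPair_timeAvg_sq_le (hα : 0 < α) (hρ : Continuous ρ)
    (hρs : HasCompactSupport ρ) (ξ : C10 Q) (ζ : C10 S)
    (h : (ζ : Space m × ℝ → ℝ) = timeAvg ρ α β γ (ξ : Space m × ℝ → ℝ)) :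
    ‖restrictPair Q ζ‖ ^ 2 ≤ (∫ s, |ρ s|) ^ 2 * α⁻¹ * ‖testToW ξ‖ ^ 2 := by
  have hg : gradx (ζ : Space m × ℝ → ℝ)
      = timeAvg ρ α β γ (gradx (ξ : Space m × ℝ → ℝ)) := by
    funext z
    rw [h, gradx_timeAvg hρ hρs]
  have h1 := integral_norm_timeAvg_sq_le (β := β) (γ := γ) hα hρ hρs ξ.2.1.continuous ξ.2.2.1
  have h2 := integral_norm_timeAvg_sq_le (β := β) (γ := γ) hα hρ hρs (C10.continuous_gradx ξ)
    (C10.hasCompactSupport_gradx ξ)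
  rw [← h] at h1
  rw [← hg] at h2
  have e1 : ‖testToW ξ‖ ^ 2 = (∫ z, ‖(ξ : Space m × ℝ → ℝ) z‖ ^ 2)
      + ∫ z, ‖gradx (ξ : Space m × ℝ → ℝ) z‖ ^ 2 := by
    refine (norm_restrictPair_sq (Q := Q) ξ).trans ?_
    rw [setIntegral_eq_integral_of_zero fun z hz => by rw [C10.eq_zero ξ hz]; simp,
      setIntegral_eq_integral_of_zero fun z hz => by rw [C10.gradx_eq_zero ξ hz]; simp]
    simp
  rw [norm_restrictPair_sq, e1, mul_add]
  refine add_le_add (le_trans ?_ h1) (le_trans ?_ h2)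
  · simp only [Real.norm_eq_abs, sq_abs]
    exact setIntegral_le_integral (C10.memLp ζ _).integrable_sq
      (ae_of_all _ fun z => sq_nonneg _)
  · exact setIntegral_le_integral (C10.memLp_gradx ζ _).norm.integrable_sq
      (ae_of_all _ fun z => sq_nonneg _)

lemma inner_restrictPair_timeAvg (hα : 0 < α) (hρ : Continuous ρ) (hρs : HasCompactSupport ρ)
    (ξ φ : C10 Q) (ζ : C10 S) (ψ : C10 S')
    (hζ : (ζ : Space m × ℝ → ℝ) = timeAvg ρ α β γ (ξ : Space m × ℝ → ℝ))
    (hψ : (ψ : Space m × ℝ → ℝ)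
      = timeAvg ρ α⁻¹ (-β / α) (-γ / α) (φ : Space m × ℝ → ℝ)) :
    inner ℝ (restrictPair Q ζ) (restrictPair Q φ)
      = α⁻¹ * inner ℝ (restrictPair Q ξ) (restrictPair Q ψ) := by
  have hg : gradx (ζ : Space m × ℝ → ℝ)
      = timeAvg ρ α β γ (gradx (ξ : Space m × ℝ → ℝ)) := by
    funext z
    rw [hζ, gradx_timeAvg hρ hρs]
  have hg' : gradx (ψ : Space m × ℝ → ℝ)
      = timeAvg ρ α⁻¹ (-β / α) (-γ / α) (gradx (φ : Space m × ℝ → ℝ)) := by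
    funext z
    rw [hψ, gradx_timeAvg hρ hρs]
  have h1 := integral_inner_timeAvg (β := β) (γ := γ) hα hρ hρs ξ.2.1.continuous ξ.2.2.1
    φ.2.1.continuous φ.2.2.1
  have h2 := integral_inner_timeAvg (β := β) (γ := γ) hα hρ hρs (C10.continuous_gradx ξ)
    (C10.hasCompactSupport_gradx ξ) (C10.continuous_gradx φ) (C10.hasCompactSupport_gradx φ)
  rw [← hζ, ← hψ] at h1
  rw [← hg, ← hg'] at h2
  rw [inner_restrictPair_restrictPair, inner_restrictPair_restrictPair, mul_add,
    setIntegral_eq_integral_of_zero fun z hz => by rw [C10.eq_zero φ hz, zero_mul],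
    setIntegral_eq_integral_of_zero fun z hz => by rw [C10.gradx_eq_zero φ hz, inner_zero_right],
    setIntegral_eq_integral_of_zero fun z hz => by rw [C10.eq_zero ξ hz, mul_zero],
    setIntegral_eq_integral_of_zero fun z hz => by rw [C10.gradx_eq_zero ξ hz, inner_zero_left]]
  exact congrArg₂ (· + ·) h1 h2

lemma setIntegral_dt_timeAvg_mul (hα : 0 < α) (hρ : Continuous ρ) (hρs : HasCompactSupport ρ)
    (ξ φ : C10 Q) (ζ : C10 S) (ψ : C10 S')
    (hζ : (ζ : Space m × ℝ → ℝ) = timeAvg ρ α β γ (ξ : Space m × ℝ → ℝ))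
    (hψ : (ψ : Space m × ℝ → ℝ)
      = timeAvg ρ α⁻¹ (-β / α) (-γ / α) (φ : Space m × ℝ → ℝ)) :
    ∫ z in Q, dt (ζ : Space m × ℝ → ℝ) z * (φ : Space m × ℝ → ℝ) z
      = -∫ z in Q, (ξ : Space m × ℝ → ℝ) z * dt (ψ : Space m × ℝ → ℝ) z := by
  have hd : ∀ z, dt (ψ : Space m × ℝ → ℝ) z
      = α⁻¹ * timeAvg ρ α⁻¹ (-β / α) (-γ / α) (dt (φ : Space m × ℝ → ℝ)) z := fun z => by
    rw [hψ, dt_timeAvg hρ hρs]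
  have h1 := integral_inner_timeAvg (β := β) (γ := γ) hα hρ hρs ξ.2.1.continuous ξ.2.2.1
    (C10.continuous_dt φ) (C10.hasCompactSupport_dt φ)
  rw [← hζ] at h1
  rw [setIntegral_mul_dt, neg_inj,
    setIntegral_eq_integral_of_zero fun z hz => by rw [C10.dt_eq_zero φ hz, mul_zero],
    setIntegral_eq_integral_of_zero fun z hz => by rw [C10.eq_zero ξ hz, zero_mul]]
  have e1 : ∫ z, (ζ : Space m × ℝ → ℝ) z * dt (φ : Space m × ℝ → ℝ) z
      = ∫ z, inner ℝ ((ζ : Space m × ℝ → ℝ) z) (dt (φ : Space m × ℝ → ℝ) z) := by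
    simp [mul_comm]
  rw [e1, h1, ← integral_const_mul]
  refine integral_congr_ae (ae_of_all _ fun z => ?_)
  simp only [hd, RCLike.inner_apply, conj_trivial]
  ring

lemma integral_dt_timeAvg_sq_le (hα : 0 < α) (hρ : ContDiff ℝ 1 ρ) (hρs : HasCompactSupport ρ)
    (φ : C10 Q) (ψ : C10 S)
    (hψ : (ψ : Space m × ℝ → ℝ)
      = timeAvg ρ α⁻¹ (-β / α) (-1 / α) (φ : Space m × ℝ → ℝ)) :
    ∫ z in Q, dt (ψ : Space m × ℝ → ℝ) z ^ 2
      ≤ (∫ s, |deriv ρ s|) ^ 2 * α * ‖testToW φ‖ ^ 2 := by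
  have hd : ∀ z, dt (ψ : Space m × ℝ → ℝ) z
      = timeAvg (deriv ρ) α⁻¹ (-β / α) (-1 / α) (φ : Space m × ℝ → ℝ) z := fun z => by
    rw [hψ, dt_timeAvg hρ.continuous hρs, timeAvg_dt (by positivity) hρ hρs]
    field_simp
  have h1 := integral_norm_timeAvg_sq_le (β := -β / α) (γ := -1 / α) (inv_pos.2 hα)
    (hρ.continuous_deriv le_rfl) hρs.deriv φ.2.1.continuous φ.2.2.1
  rw [inv_inv] at h1
  simp only [← hd, Real.norm_eq_abs, sq_abs] at h1
  refine (setIntegral_le_integral (C10.memLp_dt ψ _).integrable_sq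
      (ae_of_all _ fun z => sq_nonneg _)).trans (h1.trans ?_)
  refine mul_le_mul_of_nonneg_left ?_ (by positivity)
  have e1 : ‖testToW φ‖ ^ 2 = (∫ z in Q, (φ : Space m × ℝ → ℝ) z ^ 2)
      + ∫ z in Q, ‖gradx (φ : Space m × ℝ → ℝ) z‖ ^ 2 := norm_restrictPair_sq (Q := Q) φ
  have e2 : 0 ≤ ∫ z in Q, ‖gradx (φ : Space m × ℝ → ℝ) z‖ ^ 2 :=
    integral_nonneg fun z => sq_nonneg _
  rw [e1, setIntegral_eq_integral_of_zero (k := fun z => (φ : Space m × ℝ → ℝ) z ^ 2)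
    fun z hz => by rw [C10.eq_zero φ hz]; simp]
  linarith

/-- A nonnegative bump function of integral one supported in `[-δ/2, δ/2]`. -/
lemma exists_timeBump {δ : ℝ} (hδ : 0 < δ) : ∃ ρ : ℝ → ℝ, ContDiff ℝ 1 ρ ∧ HasCompactSupport ρ ∧
    tsupport ρ ⊆ Icc (-(δ / 2)) (δ / 2) ∧ (∀ s, 0 ≤ ρ s) ∧ ∫ s, ρ s = 1 := by
  let f : ContDiffBump (0 : ℝ) := ⟨δ / 4, δ / 2, by positivity, by linarith⟩
  refine ⟨f.normed volume, f.contDiff_normed, f.hasCompactSupport_normed, ?_,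
    fun s => f.nonneg_normed s, f.integral_normed⟩
  rw [f.tsupport_normed_eq, Real.closedBall_eq_Icc]
  simp [f]

lemma norm_timeAvg_sub_le {E : Type*} [NormedAddCommGroup E] [NormedSpace ℝ E] [CompleteSpace E]
    (hT : 0 < T) {f : Space m × ℝ → E} (hf : Continuous f) (hfs : HasCompactSupport f)
    {ε : ℝ} (hε : 0 < ε) :
    ∃ δ₀ > 0, ∀ δ ∈ Ioo 0 δ₀, ∀ ρ : ℝ → ℝ, Continuous ρ → HasCompactSupport ρ →
      tsupport ρ ⊆ Icc (-(δ / 2)) (δ / 2) → (∀ s, 0 ≤ ρ s) → ∫ s, ρ s = 1 →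
      ∀ z : Space m × ℝ, z.2 ∈ Ioo 0 T →
        ‖timeAvg ρ (1 - 2 * δ / T) δ 1 f z - f z‖ ≤ ε := by
  obtain ⟨d, hd, H⟩ := Metric.uniformContinuous_iff.1
    (hfs.uniformContinuous_of_continuous hf) ε hε
  refine ⟨d / 2, by positivity, fun δ hδ ρ hρ hρs hsupp hpos hint z hz => ?_⟩
  have hi := integrable_timeAvg (α := 1 - 2 * δ / T) (β := δ) (γ := 1) hρ hρs hf z
  have hρi : Integrable ρ := hρ.integrable_of_hasCompactSupport hρs
  have e : timeAvg ρ (1 - 2 * δ / T) δ 1 f z - f z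
      = ∫ s, ρ s • (f (z.1, (1 - 2 * δ / T) * z.2 + δ + 1 * s) - f z) := by
    have h1 : f z = ∫ s, ρ s • f z := by rw [integral_smul_const, hint, one_smul]
    simp_rw [smul_sub]
    rw [integral_sub hi (hρi.smul_const _), ← h1]
    rfl
  rw [e]
  have hb : ∀ s, ‖ρ s • (f (z.1, (1 - 2 * δ / T) * z.2 + δ + 1 * s) - f z)‖ ≤ ρ s * ε := fun s => by
    rw [norm_smul, Real.norm_of_nonneg (hpos s)]
    by_cases hs : s ∈ tsupport ρ
    · refine mul_le_mul_of_nonneg_left ?_ (hpos s)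
      rw [← dist_eq_norm]
      refine (H ?_).le
      have hs' := hsupp hs
      have h3 : 0 ≤ 2 * δ / T * z.2 := by
        have := hz.1
        have := hδ.1
        positivity
      have h4 : 2 * δ / T * z.2 ≤ 2 * δ := by
        rw [div_mul_eq_mul_div, div_le_iff₀ hT]
        nlinarith [hz.2, hδ.1]
      have h5 : |(1 - 2 * δ / T) * z.2 + δ + 1 * s - z.2| < d := by
        rw [abs_lt]
        constructor <;> nlinarith [hs'.1, hs'.2, hδ.1, hδ.2]
      rw [Prod.dist_eq]
      simp only [dist_self]
      exact max_lt hd (by rwa [Real.dist_eq])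
    · rw [image_eq_zero_of_notMem_tsupport hs]
      simp
  calc _ ≤ ∫ s, ρ s * ε := norm_integral_le_of_norm_le (hρi.mul_const _) (ae_of_all _ hb)
    _ = ε := by rw [integral_mul_const, hint, one_mul]

lemma isFiniteMeasure_cylinder (hb : Bornology.IsBounded Ω) :
    IsFiniteMeasure (volume.restrict (cylinder Ω T)) := ⟨by
  rw [Measure.restrict_apply_univ]
  exact (hb.prod (Metric.isBounded_Ioo 0 T)).measure_lt_top⟩

/-- Averages over short times are close to the function in `W`. -/
lemma norm_restrictPair_timeAvg_sub_le (hb : Bornology.IsBounded Ω) (hT : 0 < T)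
    (ξ : C10 (cylinder Ω T)) {ε : ℝ} (hε : 0 < ε) :
    ∃ δ₀ > 0, ∀ δ ∈ Ioo 0 δ₀, ∀ ρ : ℝ → ℝ, Continuous ρ → HasCompactSupport ρ →
      tsupport ρ ⊆ Icc (-(δ / 2)) (δ / 2) → (∀ s, 0 ≤ ρ s) → ∫ s, ρ s = 1 →
      ∀ ζ : TimeTest Ω, (ζ : Space m × ℝ → ℝ)
          = timeAvg ρ (1 - 2 * δ / T) δ 1 (ξ : Space m × ℝ → ℝ) →
        ‖timeTestToW T ζ - testToW ξ‖ ≤ ε := by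
  have hfin := isFiniteMeasure_cylinder (T := T) hb
  set C : ℝ := (measureUnivNNReal (volume.restrict (cylinder Ω T)) : ℝ) ^ ((2 : ENNReal).toReal⁻¹)
  have hC : 0 ≤ C := Real.rpow_nonneg (NNReal.coe_nonneg _) _
  set ε' := ε / (2 * (C + 1)) with hε'
  have hε'0 : 0 < ε' := by positivity
  obtain ⟨d1, hd1, H1⟩ := norm_timeAvg_sub_le hT ξ.2.1.continuous ξ.2.2.1 hε'0
  obtain ⟨d2, hd2, H2⟩ := norm_timeAvg_sub_le hT (C10.continuous_gradx ξ)
    (C10.hasCompactSupport_gradx ξ) hε'0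
  refine ⟨min d1 d2, lt_min hd1 hd2, fun δ hδ ρ hρ hρs hsupp hpos hint ζ hζ => ?_⟩
  have b1 : ‖valW (timeTestToW T ζ - testToW ξ)‖ ≤ C * ε' := by
    refine Lp.norm_le_of_ae_bound hε'0.le ?_
    have e : valW (timeTestToW T ζ - testToW ξ)
        = valW (timeTestToW T ζ) - valW (testToW ξ) := rfl
    rw [e]
    filter_upwards [Lp.coeFn_sub (valW (timeTestToW T ζ)) (valW (testToW ξ)),
      valW_timeTestToW (T := T) ζ, restrictPair_fst (Q := cylinder Ω T) ξ, ae_mem_timeSlab]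
      with z h1 h2 h3 h4
    rw [h1, Pi.sub_apply, h2, hζ]
    have h3' : valW (testToW ξ) z = (ξ : Space m × ℝ → ℝ) z := h3
    rw [h3']
    exact H1 δ ⟨hδ.1, hδ.2.trans_le (min_le_left _ _)⟩ ρ hρ hρs hsupp hpos hint z h4
  have b2 : ‖gradW (timeTestToW T ζ - testToW ξ)‖ ≤ C * ε' := by
    refine Lp.norm_le_of_ae_bound hε'0.le ?_
    have e : gradW (timeTestToW T ζ - testToW ξ)
        = gradW (timeTestToW T ζ) - gradW (testToW ξ) := rfl
    rw [e]
    filter_upwards [Lp.coeFn_sub (gradW (timeTestToW T ζ)) (gradW (testToW ξ)),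
      gradW_timeTestToW (T := T) ζ, restrictPair_snd (Q := cylinder Ω T) ξ, ae_mem_timeSlab]
      with z h1 h2 h3 h4
    rw [h1, Pi.sub_apply, h2, hζ, gradx_timeAvg hρ hρs]
    have h3' : gradW (testToW ξ) z = gradx (ξ : Space m × ℝ → ℝ) z := h3
    rw [h3']
    exact H2 δ ⟨hδ.1, hδ.2.trans_le (min_le_right _ _)⟩ ρ hρ hρs hsupp hpos hint z h4
  have b3 : C * ε' ≤ ε / 2 := by
    rw [hε', mul_div_assoc', div_le_div_iff₀ (by positivity) (by positivity)]
    nlinarith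
  refine le_of_sq_le_sq ?_ hε.le
  rw [norm_W_sq]
  have c1 := pow_le_pow_left₀ (norm_nonneg _) (b1.trans b3) 2
  have c2 := pow_le_pow_left₀ (norm_nonneg _) (b2.trans b3) 2
  nlinarith

set_option maxHeartbeats 1000000 in
/-- `C¹₀(Ω × ℝ)` is dense in `U` for the graph norm. -/
theorem exists_timeTest_near (hb : Bornology.IsBounded Ω) (hT : 0 < T)
    {w : W (cylinder Ω T)} {ℓ : StrongDual ℝ (W (cylinder Ω T))} (h : IsTimeDeriv w ℓ)
    {ε : ℝ} (hε : 0 < ε) :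
    ∃ ξ : TimeTest Ω, ‖timeTestToW T ξ - w‖ < ε ∧ ‖timeTestDt T ξ - ℓ‖ < ε := by
  set η := ε / 7 with hη
  have hη0 : 0 < η := by positivity
  set g : W (cylinder Ω T) := (InnerProductSpace.toDual ℝ _).symm ℓ with hg
  have hgℓ : ∀ φ, ℓ φ = inner ℝ g φ := fun φ => by
    rw [hg, InnerProductSpace.toDual_symm_apply]
  have hdense : ∀ (y : W (cylinder Ω T)) (r : ℝ), 0 < r →
      ∃ ζ : C10 (cylinder Ω T), ‖testToW ζ - y‖ < r := fun y r hr => by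
    obtain ⟨ζ, hζ⟩ := denseRange_testToW.exists_dist_lt y hr
    exact ⟨ζ, by rwa [← dist_eq_norm, dist_comm]⟩
  obtain ⟨ζ₀, hζ₀⟩ := hdense w η hη0
  obtain ⟨g₀, hg₀⟩ := hdense g η hη0
  obtain ⟨d1, hd1, H1⟩ := norm_restrictPair_timeAvg_sub_le hb hT ζ₀ hη0
  obtain ⟨d2, hd2, H2⟩ := norm_restrictPair_timeAvg_sub_le hb hT g₀ hη0
  set G := ‖testToW g₀‖
  have hG : 0 ≤ G := norm_nonneg _
  obtain ⟨δ, hδ0, hδ⟩ : ∃ δ, 0 < δ ∧ δ < min (min d1 d2) (min (T / 4) (η * T / (2 * (G + 1)))) :=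
    exists_between (lt_min (lt_min hd1 hd2) (lt_min (by positivity) (by positivity)))
  have hδ1 : δ < d1 := hδ.trans_le ((min_le_left _ _).trans (min_le_left _ _))
  have hδ2 : δ < d2 := hδ.trans_le ((min_le_left _ _).trans (min_le_right _ _))
  have hδT : δ < T / 4 := hδ.trans_le ((min_le_right _ _).trans (min_le_left _ _))
  have hδG : δ < η * T / (2 * (G + 1)) := hδ.trans_le ((min_le_right _ _).trans (min_le_right _ _))
  obtain ⟨ρ, hρ, hρs, hsupp, hpos, hint⟩ := exists_timeBump hδ0
  have hρc := hρ.continuous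
  have hρabs : ∫ s, |ρ s| = 1 := by
    rw [← hint]
    exact integral_congr_ae (ae_of_all _ fun s => abs_of_nonneg (hpos s))
  set α := 1 - 2 * δ / T with hα
  have hαT : α * T = T - 2 * δ := by
    rw [hα]
    field_simp
  have hα2 : 1 / 2 ≤ α := by
    have : 2 * δ / T ≤ 1 / 2 := by
      rw [div_le_iff₀ hT]
      linarith
    linarith
  have hα0 : 0 < α := by linarith
  have hα1 : α ≤ 1 := by
    have : 0 ≤ 2 * δ / T := by positivity
    linarith
  -- the averaging operator and its adjoint on test functions
  have hK : ∀ ξ : C10 (cylinder Ω T), ∃ ζ : TimeTest Ω,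
      (ζ : Space m × ℝ → ℝ) = timeAvg ρ α δ 1 (ξ : Space m × ℝ → ℝ) := fun ξ =>
    exists_C10_timeAvg hα0.ne' hρc hρs ξ fun z hz s _ => ⟨hz.1, mem_univ _⟩
  choose K hK using hK
  have hA : ∀ φ : C10 (cylinder Ω T), ∃ ψ : C10 (cylinder Ω T),
      (ψ : Space m × ℝ → ℝ) = timeAvg ρ α⁻¹ (-δ / α) (-1 / α) (φ : Space m × ℝ → ℝ) := fun φ => by
    refine exists_C10_timeAvg (inv_ne_zero hα0.ne') hρc hρs φ fun z hz s hs => ⟨hz.1, ?_⟩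
    have e : (z.2 - -δ / α - -1 / α * s) / α⁻¹ = α * z.2 + δ + s := by
      field_simp
      ring
    have h1 := hsupp hs
    have h2 : 0 < z.2 := hz.2.1
    have h3 : z.2 < T := hz.2.2
    rw [e]
    constructor
    · nlinarith [h1.1, mul_pos hα0 h2]
    · nlinarith [h1.2]
  choose A hA using hA
  have hKnorm : ∀ ξ, ‖timeTestToW T (K ξ)‖ ≤ 2 * ‖testToW ξ‖ := fun ξ => by
    have h1 : ‖timeTestToW T (K ξ)‖ ^ 2 ≤ _ :=
      norm_restrictPair_timeAvg_sq_le hα0 hρc hρs ξ (K ξ) (hK ξ)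
    rw [hρabs] at h1
    refine le_of_sq_le_sq (h1.trans ?_) (by positivity)
    have h2 : α⁻¹ ≤ 2 := by
      rw [inv_le_comm₀ hα0 (by norm_num)]
      linarith
    nlinarith [sq_nonneg ‖testToW ξ‖]
  have hAnorm : ∀ φ, ‖testToW (A φ)‖ ≤ ‖testToW φ‖ := fun φ => by
    have h1 : ‖testToW (A φ)‖ ^ 2 ≤ _ :=
      norm_restrictPair_timeAvg_sq_le (inv_pos.2 hα0) hρc hρs φ (A φ) (hA φ)
    rw [hρabs, inv_inv] at h1
    refine le_of_sq_le_sq (h1.trans ?_) (by positivity)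
    nlinarith [sq_nonneg ‖testToW φ‖]
  set C := ∫ s, |deriv ρ s|
  have hC : 0 ≤ C := integral_nonneg fun s => abs_nonneg _
  obtain ⟨ζ, hζ⟩ := hdense w (min η (η / (C + 1))) (lt_min hη0 (by positivity))
  have hζ1 : ‖testToW ζ - w‖ < η := hζ.trans_le (min_le_left _ _)
  have hζ2 : ‖testToW ζ - w‖ * C ≤ η := by
    have h1 : ‖testToW ζ - w‖ ≤ η / (C + 1) := (hζ.trans_le (min_le_right _ _)).le
    have h2 : η / (C + 1) * C ≤ η := by
      rw [div_mul_eq_mul_div, div_le_iff₀ (by positivity)]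
      nlinarith
    exact (mul_le_mul_of_nonneg_right h1 hC).trans h2
  refine ⟨K ζ, ?_, ?_⟩
  · have e : timeTestToW T (K ζ) - timeTestToW T (K ζ₀) = timeTestToW T (K (ζ - ζ₀)) := by
      rw [← map_sub]
      congr 1
      refine Subtype.ext ?_
      have e1 : ((K ζ - K ζ₀ : TimeTest Ω) : Space m × ℝ → ℝ)
          = (K ζ : Space m × ℝ → ℝ) - (K ζ₀ : Space m × ℝ → ℝ) := rfl
      rw [e1, hK, hK, hK]
      funext z
      simp only [Pi.sub_apply, timeAvg]
      rw [← integral_sub (integrable_timeAvg hρc hρs ζ.2.1.continuous z)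
        (integrable_timeAvg hρc hρs ζ₀.2.1.continuous z)]
      refine integral_congr_ae (ae_of_all _ fun s => ?_)
      simp [mul_sub]
    have e2 : testToW (ζ - ζ₀) = testToW ζ - testToW ζ₀ :=
      Subtype.ext (map_sub (testToL2Pair (cylinder Ω T)) ζ ζ₀)
    have n1 : ‖timeTestToW T (K ζ) - timeTestToW T (K ζ₀)‖ ≤ 2 * (2 * η) := by
      rw [e]
      refine (hKnorm _).trans (mul_le_mul_of_nonneg_left ?_ (by norm_num))
      rw [e2]
      calc ‖testToW ζ - testToW ζ₀‖ ≤ ‖testToW ζ - w‖ + ‖testToW ζ₀ - w‖ := by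
            rw [← sub_sub_sub_cancel_right _ _ w]
            exact norm_sub_le _ _
        _ ≤ 2 * η := by linarith
    have n2 := H1 δ ⟨hδ0, hδ1⟩ ρ hρc hρs hsupp hpos hint (K ζ₀) (hK ζ₀)
    calc ‖timeTestToW T (K ζ) - w‖
        = ‖(timeTestToW T (K ζ) - timeTestToW T (K ζ₀))
            + (timeTestToW T (K ζ₀) - testToW ζ₀) + (testToW ζ₀ - w)‖ := by congr 1; abel
      _ ≤ 2 * (2 * η) + η + η := (norm_add₃_le).trans
          (add_le_add (add_le_add n1 n2) hζ₀.le)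
      _ < ε := by rw [hη]; linarith
  · have hKg := H2 δ ⟨hδ0, hδ2⟩ ρ hρc hρs hsupp hpos hint (K g₀) (hK g₀)
    have hKg' : ‖α • timeTestToW T (K g₀) - testToW g₀‖ ≤ 2 * η := by
      have e : α • timeTestToW T (K g₀) - testToW g₀
          = α • (timeTestToW T (K g₀) - testToW g₀) - (1 - α) • testToW g₀ := by
        module
      rw [e]
      refine (norm_sub_le _ _).trans ?_
      rw [norm_smul, norm_smul, Real.norm_of_nonneg hα0.le, Real.norm_of_nonneg (by linarith)]
      have h1 : (1 - α) * G ≤ η := by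
        have h2 : 1 - α = 2 * δ / T := by rw [hα]; ring
        rw [h2, div_mul_eq_mul_div, div_le_iff₀ hT]
        rw [lt_div_iff₀ (by positivity)] at hδG
        nlinarith
      have h3 : α * ‖timeTestToW T (K g₀) - testToW g₀‖ ≤ 1 * η :=
        mul_le_mul hα1 hKg (norm_nonneg _) zero_le_one
      linarith
    refine (opNorm_le_of_forall_testToW (M := 5 * η) (by positivity) fun φ => ?_).trans_lt
      (by rw [hη]; linarith)
    have s1 : |timeTestDt T (K ζ) (testToW φ) - ℓ (testToW (A φ))| ≤ η * ‖testToW φ‖ := by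
      have e1 : timeTestDt T (K ζ) (testToW φ)
          = -inner ℝ ((C10.memLp_dt (A φ) (volume.restrict (cylinder Ω T))).toLp _)
            (valW (testToW ζ)) := by
        rw [timeTestDt_apply]
        have e2 : ∫ z in cylinder Ω T, dt (K ζ : Space m × ℝ → ℝ) z * valW (testToW φ) z
            = ∫ z in cylinder Ω T, dt (K ζ : Space m × ℝ → ℝ) z * (φ : Space m × ℝ → ℝ) z := by
          refine integral_congr_ae ?_
          filter_upwards [restrictPair_fst (Q := cylinder Ω T) φ] with z hz
          exact congrArg _ hz
        rw [e2, setIntegral_dt_timeAvg_mul hα0 hρc hρs ζ φ (K ζ) (A φ) (hK ζ) (hA φ), neg_inj,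
          inner_toLp_eq_integral]
        refine integral_congr_ae ?_
        filter_upwards [restrictPair_fst (Q := cylinder Ω T) ζ] with z hz
        have hz' : valW (testToW ζ) z = (ζ : Space m × ℝ → ℝ) z := hz
        rw [hz']
        simp
      have e3 : ℓ (testToW (A φ))
          = -inner ℝ ((C10.memLp_dt (A φ) (volume.restrict (cylinder Ω T))).toLp _) (valW w) := by
        rw [h (A φ), inner_toLp_eq_integral]
        rfl
      have e4 : valW (testToW ζ) - valW w = valW (testToW ζ - w) := rfl
      rw [e1, e3, neg_sub_neg, ← abs_neg, neg_sub, ← inner_sub_right, e4]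
      refine (abs_real_inner_le_norm _ _).trans ?_
      have n1 : ‖(C10.memLp_dt (A φ) (volume.restrict (cylinder Ω T))).toLp _‖
          ≤ C * ‖testToW φ‖ := by
        refine le_of_sq_le_sq ?_ (by positivity)
        rw [norm_toLp_sq]
        simp only [Real.norm_eq_abs, sq_abs]
        refine (integral_dt_timeAvg_sq_le hα0 hρ hρs φ (A φ) (hA φ)).trans ?_
        rw [mul_pow]
        have : 0 ≤ C ^ 2 * ‖testToW φ‖ ^ 2 := by positivity
        nlinarith
      calc _ ≤ C * ‖testToW φ‖ * ‖testToW ζ - w‖ :=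
            mul_le_mul n1 (norm_valW_le _) (norm_nonneg _) (by positivity)
        _ = (‖testToW ζ - w‖ * C) * ‖testToW φ‖ := by ring
        _ ≤ _ := mul_le_mul_of_nonneg_right hζ2 (norm_nonneg _)
    have s2 : |ℓ (testToW (A φ)) - ℓ (testToW φ)| ≤ 4 * η * ‖testToW φ‖ := by
      have e1 : inner ℝ (testToW g₀) (testToW (A φ))
          = inner ℝ (α • timeTestToW T (K g₀)) (testToW φ) := by
        have h1 : inner ℝ (timeTestToW T (K g₀)) (testToW φ)
            = α⁻¹ * inner ℝ (testToW g₀) (testToW (A φ)) :=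
          inner_restrictPair_timeAvg hα0 hρc hρs g₀ φ (K g₀) (A φ) (hK g₀) (hA φ)
        have h2 : inner ℝ (α • timeTestToW T (K g₀)) (testToW φ)
            = α * inner ℝ (timeTestToW T (K g₀)) (testToW φ) :=
          real_inner_smul_left (F := W (cylinder Ω T)) _ _ _
        rw [h2, h1, mul_inv_cancel_left₀ hα0.ne']
      have e2 : ℓ (testToW (A φ)) - ℓ (testToW φ)
          = inner ℝ (g - testToW g₀) (testToW (A φ) - testToW φ)
            + inner ℝ (α • timeTestToW T (K g₀) - testToW g₀) (testToW φ) := by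
        rw [hgℓ, hgℓ, inner_sub_left, inner_sub_right, inner_sub_right, e1, inner_sub_left]
        ring
      have n1 : ‖g - testToW g₀‖ ≤ η := by
        rw [norm_sub_rev]
        exact hg₀.le
      have n2 : ‖testToW (A φ) - testToW φ‖ ≤ 2 * ‖testToW φ‖ :=
        (norm_sub_le _ _).trans (by linarith [hAnorm φ])
      rw [e2]
      refine (abs_add_le _ _).trans ?_
      have m1 := (abs_real_inner_le_norm (g - testToW g₀) (testToW (A φ) - testToW φ)).trans
        (mul_le_mul n1 n2 (norm_nonneg _) hη0.le)
      have m2 := (abs_real_inner_le_norm (α • timeTestToW T (K g₀) - testToW g₀)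
        (testToW φ)).trans (mul_le_mul_of_nonneg_right hKg' (norm_nonneg _))
      linarith
    have e5 : (timeTestDt T (K ζ) - ℓ) (testToW φ)
        = (timeTestDt T (K ζ) (testToW φ) - ℓ (testToW (A φ)))
          + (ℓ (testToW (A φ)) - ℓ (testToW φ)) := by
      rw [sub_apply]
      ring
    rw [e5]
    refine (abs_add_le _ _).trans ?_
    linarith

end Density

/-! ### Traces in time -/

lemma tendsto_dual_apply {ι E : Type*} [NormedAddCommGroup E] [NormedSpace ℝ E] {l : Filter ι}
    {f : ι → StrongDual ℝ E} {f₀ : StrongDual ℝ E} {x : ι → E} {x₀ : E}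
    (hf : Tendsto f l (𝓝 f₀)) (hx : Tendsto x l (𝓝 x₀)) :
    Tendsto (fun n => f n (x n)) l (𝓝 (f₀ x₀)) :=
  (isBoundedBilinearMap_apply.continuous.tendsto (f₀, x₀)).comp (hf.prodMk_nhds hx)

section Trace

variable {S : Set (Space m × ℝ)} {Ω : Set (Space m)} {T : ℝ}

/-- `c` is a representative of `w` in `C([0, T], L²(Ω))`. -/
def IsTimeRep (Ω : Set (Space m)) (T : ℝ) (w : L2 (cylinder Ω T))
    (c : ℝ → Lp ℝ 2 (volume.restrict Ω)) : Prop :=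
  ContinuousOn c (Icc 0 T) ∧
    ∀ᵐ t ∂(volume.restrict (Ioo 0 T)), c t =ᵐ[volume.restrict Ω] fun x => w (x, t)

lemma vanishesAt_iff_exists_isTimeRep {s : ℝ} {w : L2 (cylinder Ω T)} :
    VanishesAt Ω T s w ↔ ∃ c, IsTimeRep Ω T w c ∧ c s = 0 := by
  simp only [VanishesAt, IsTimeRep, and_assoc]

lemma ae_ae_of_ae_cylinder {p : Space m × ℝ → Prop}
    (h : ∀ᵐ z ∂(volume.restrict (cylinder Ω T)), p z) :
    ∀ᵐ t ∂(volume.restrict (Ioo 0 T)), ∀ᵐ x ∂(volume.restrict Ω), p (x, t) := by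
  rw [cylinder, Measure.volume_eq_prod, ← Measure.prod_restrict] at h
  exact Measure.ae_ae_of_ae_prod
    ((Measure.measurePreserving_swap (μ := volume.restrict (Ioo 0 T))
      (ν := volume.restrict Ω)).quasiMeasurePreserving.ae h)

lemma IsTimeRep.eqOn (hT : 0 < T) {w : L2 (cylinder Ω T)} {c c' : ℝ → Lp ℝ 2 (volume.restrict Ω)}
    (h : IsTimeRep Ω T w c) (h' : IsTimeRep Ω T w c') : EqOn c c' (Icc 0 T) := by
  refine Measure.eqOn_Icc_of_ae_eq (μ := volume) hT.ne ?_ h.1 h'.1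
  rw [← restrict_Ioo_eq_restrict_Icc]
  filter_upwards [h.2, h'.2] with t h1 h2
  exact Lp.ext (h1.trans h2.symm)

lemma isTimeRep_slice (hb : Bornology.IsBounded Ω) (ξ : TimeTest Ω) :
    IsTimeRep Ω T (valW (timeTestToW T ξ)) (slice Ω ξ) := by
  refine ⟨(continuous_slice hb ξ).continuousOn, ?_⟩
  filter_upwards [ae_ae_of_ae_cylinder (valW_timeTestToW (T := T) ξ)] with t ht
  filter_upwards [ht, (C10.memLp_slice ξ t (volume.restrict Ω)).coeFn_toLp] with x h1 h2
  rw [slice, h2, h1]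

/-- Every element of `U` has a representative in `C([0, T], L²(Ω))`, which is the uniform limit of
the slices of smooth functions. -/
theorem exists_isTimeRep (hb : Bornology.IsBounded Ω) (hT : 0 < T)
    {w : W (cylinder Ω T)} {ℓ : StrongDual ℝ (W (cylinder Ω T))} (h : IsTimeDeriv w ℓ) :
    ∃ (c : ℝ → Lp ℝ 2 (volume.restrict Ω)) (ξ : ℕ → TimeTest Ω), IsTimeRep Ω T (valW w) c ∧
      Tendsto (fun n => timeTestToW T (ξ n)) atTop (𝓝 w) ∧
      Tendsto (fun n => timeTestDt T (ξ n)) atTop (𝓝 ℓ) ∧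
      ∀ s ∈ Icc 0 T, Tendsto (fun n => slice Ω (ξ n) s) atTop (𝓝 (c s)) := by
  have hr : ∀ n : ℕ, (0 : ℝ) < 1 / ((n : ℝ) + 1) := fun n => by positivity
  choose ξ hξ1 hξ2 using fun n : ℕ => exists_timeTest_near hb hT h (hr n)
  have t1 : Tendsto (fun n => timeTestToW T (ξ n)) atTop (𝓝 w) :=
    tendsto_iff_norm_sub_tendsto_zero.2 (squeeze_zero (fun n => norm_nonneg _)
      (fun n => (hξ1 n).le) tendsto_one_div_add_atTop_nhds_zero_nat)
  have t2 : Tendsto (fun n => timeTestDt T (ξ n)) atTop (𝓝 ℓ) :=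
    (tendsto_iff_norm_sub_tendsto_zero (E := StrongDual ℝ (W (cylinder Ω T)))).2 (squeeze_zero
      (fun n => ContinuousLinearMap.opNorm_nonneg _)
      (fun n => (hξ2 n).le) tendsto_one_div_add_atTop_nhds_zero_nat)
  have hC : UniformCauchySeqOn (fun n s => slice Ω (ξ n) s) atTop (Icc 0 T) := by
    rw [Metric.uniformCauchySeqOn_iff]
    intro ε hε
    set r := ε / (T⁻¹ + 3) with hr
    have hTi : 0 < T⁻¹ := inv_pos.2 hT
    have hr0 : 0 < r := by positivity
    obtain ⟨N1, h1⟩ := Metric.cauchySeq_iff.1 t1.cauchySeq r hr0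
    obtain ⟨N2, h2⟩ := (Metric.cauchySeq_iff (α := StrongDual ℝ (W (cylinder Ω T)))).1 t2.cauchySeq r hr0
    refine ⟨max N1 N2, fun k hk n hn s hs => ?_⟩
    have a1 := h1 k ((le_max_left _ _).trans hk) n ((le_max_left _ _).trans hn)
    have a2 := h2 k ((le_max_right _ _).trans hk) n ((le_max_right _ _).trans hn)
    rw [dist_eq_norm, ← map_sub] at a1
    rw [dist_eq_norm (E := StrongDual ℝ (W (cylinder Ω T))), ← map_sub] at a2
    have a3 := norm_slice_sq_le hT (ξ k - ξ n) hs
    rw [slice_sub] at a3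
    rw [dist_eq_norm]
    refine lt_of_pow_lt_pow_left₀ 2 hε.le (a3.trans_lt ?_)
    have hε' : ε = r * (T⁻¹ + 3) := by
      rw [hr]
      field_simp
    have b1 : ‖timeTestToW T (ξ k - ξ n)‖ ^ 2 ≤ r ^ 2 :=
      pow_le_pow_left₀ (norm_nonneg _) a1.le 2
    have b2 : ‖timeTestDt T (ξ k - ξ n)‖ * ‖timeTestToW T (ξ k - ξ n)‖ ≤ r * r :=
      mul_le_mul a2.le a1.le (norm_nonneg _) hr0.le
    calc _ ≤ T⁻¹ * r ^ 2 + 2 * (r * r) :=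
          add_le_add (mul_le_mul_of_nonneg_left b1 hTi.le) (by linarith)
      _ < ε ^ 2 := by
          rw [hε']
          have : 0 < r ^ 2 := by positivity
          nlinarith [mul_pos this hTi, mul_pos (mul_pos this hTi) hTi]
  have hlim : ∀ s, ∃ y, s ∈ Icc 0 T → Tendsto (fun n => slice Ω (ξ n) s) atTop (𝓝 y) := fun s => by
    by_cases hs : s ∈ Icc 0 T
    · obtain ⟨y, hy⟩ := cauchySeq_tendsto_of_complete (hC.cauchySeq hs)
      exact ⟨y, fun _ => hy⟩
    · exact ⟨0, fun h => absurd h hs⟩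
  choose c hc using hlim
  have hcont : ContinuousOn c (Icc 0 T) :=
    (hC.tendstoUniformlyOn_of_tendsto fun s hs => hc s hs).continuousOn
      (Eventually.of_forall fun n => (continuous_slice hb (ξ n)).continuousOn).frequently
  refine ⟨c, ξ, ⟨hcont, ?_⟩, t1, t2, fun s hs => hc s hs⟩
  have t3 : Tendsto (fun n => valW (timeTestToW T (ξ n))) atTop (𝓝 (valW w)) :=
    ((valCLM (cylinder Ω T)).continuous.tendsto w).comp t1
  obtain ⟨ns, hns, hae⟩ := (tendstoInMeasure_of_tendsto_Lp t3).exists_seq_tendsto_ae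
  have hall : ∀ᵐ z ∂(volume.restrict (cylinder Ω T)),
      ∀ n, valW (timeTestToW T (ξ n)) z = (ξ n : Space m × ℝ → ℝ) z :=
    ae_all_iff.2 fun n => valW_timeTestToW (T := T) (ξ n)
  filter_upwards [ae_ae_of_ae_cylinder (hae.and hall), ae_restrict_mem measurableSet_Ioo]
    with t ht hmem
  have t4 := (hc t (Ioo_subset_Icc_self hmem)).comp hns.tendsto_atTop
  obtain ⟨ks, hks, hae'⟩ := (tendstoInMeasure_of_tendsto_Lp t4).exists_seq_tendsto_ae
  have hall' : ∀ᵐ x ∂(volume.restrict Ω), ∀ n, slice Ω (ξ n) t x = (ξ n : Space m × ℝ → ℝ) (x, t) :=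
    ae_all_iff.2 fun n => (C10.memLp_slice (ξ n) t (volume.restrict Ω)).coeFn_toLp
  filter_upwards [ht, hae', hall'] with x h1 h2 h3
  refine tendsto_nhds_unique h2 ?_
  have h4 := h1.1.comp hks.tendsto_atTop
  refine h4.congr fun n => ?_
  simp only [Function.comp_apply]
  rw [h1.2, h3]

lemma timeTestDt_add_timeTestDt (hT : 0 < T) (ξ ζ : TimeTest Ω) :
    timeTestDt T ξ (timeTestToW T ζ) + timeTestDt T ζ (timeTestToW T ξ)
      = inner ℝ (slice Ω ξ T) (slice Ω ζ T) - inner ℝ (slice Ω ξ 0) (slice Ω ζ 0) := by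
  have e : ∀ ξ ζ : TimeTest Ω, timeTestDt T ξ (timeTestToW T ζ)
      = ∫ z in cylinder Ω T, dt (ξ : Space m × ℝ → ℝ) z * (ζ : Space m × ℝ → ℝ) z := by
    intro ξ ζ
    rw [timeTestDt_apply]
    refine integral_congr_ae ?_
    filter_upwards [valW_timeTestToW (T := T) ζ] with z hz
    rw [hz]
  have hi : ∀ ξ ζ : TimeTest Ω, Integrable
      (fun z => dt (ξ : Space m × ℝ → ℝ) z * (ζ : Space m × ℝ → ℝ) z)
      (volume.restrict (cylinder Ω T)) := fun ξ ζ =>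
    (C10.memLp_dt ξ _).integrable_mul (C10.memLp ζ _)
  rw [inner_slice_sub_inner_slice ξ ζ hT.le, e, e, ← integral_add (hi ξ ζ) (hi ζ ξ)]
  refine integral_congr_ae (ae_of_all _ fun z => ?_)
  dsimp only
  ring

/-- Integration by parts in time for elements of `U`. -/
theorem IsTimeDeriv.add_eq_inner_sub_inner (hb : Bornology.IsBounded Ω) (hT : 0 < T)
    {w w' : W (cylinder Ω T)} {ℓ ℓ' : StrongDual ℝ (W (cylinder Ω T))}
    {c c' : ℝ → Lp ℝ 2 (volume.restrict Ω)} (h : IsTimeDeriv w ℓ) (h' : IsTimeDeriv w' ℓ')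
    (hc : IsTimeRep Ω T (valW w) c) (hc' : IsTimeRep Ω T (valW w') c') :
    ℓ w' + ℓ' w = inner ℝ (c T) (c' T) - inner ℝ (c 0) (c' 0) := by
  obtain ⟨d, ξ, hd, t1, t2, t3⟩ := exists_isTimeRep hb hT h
  obtain ⟨d', ξ', hd', t1', t2', t3'⟩ := exists_isTimeRep hb hT h'
  have h0 : (0 : ℝ) ∈ Icc 0 T := ⟨le_rfl, hT.le⟩
  have hTm : T ∈ Icc 0 T := ⟨hT.le, le_rfl⟩
  rw [hc.eqOn hT hd h0, hc.eqOn hT hd hTm, hc'.eqOn hT hd' h0, hc'.eqOn hT hd' hTm]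
  have l1 : Tendsto (fun n => timeTestDt T (ξ n) (timeTestToW T (ξ' n))
      + timeTestDt T (ξ' n) (timeTestToW T (ξ n))) atTop (𝓝 (ℓ w' + ℓ' w)) :=
    (tendsto_dual_apply t2 t1').add (tendsto_dual_apply t2' t1)
  refine tendsto_nhds_unique l1 ?_
  simp_rw [timeTestDt_add_timeTestDt hT]
  exact ((t3 T hTm).inner (t3' T hTm)).sub ((t3 0 h0).inner (t3' 0 h0))

lemma IsTimeDeriv.apply_self_nonneg (hb : Bornology.IsBounded Ω) (hT : 0 < T)
    {w : W (cylinder Ω T)} {ℓ : StrongDual ℝ (W (cylinder Ω T))} (h : IsTimeDeriv w ℓ)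
    (h0 : VanishesAt Ω T 0 (valW w)) : 0 ≤ ℓ w := by
  obtain ⟨c, hc, hc0⟩ := vanishesAt_iff_exists_isTimeRep.1 h0
  have e := h.add_eq_inner_sub_inner hb hT h hc hc
  rw [hc0, inner_zero_left, sub_zero, real_inner_self_eq_norm_sq] at e
  nlinarith [sq_nonneg ‖c T‖]

lemma eq_zero_of_forall_integral_mul_eq_zero (hΩ : IsOpen Ω) (y : Lp ℝ 2 (volume.restrict Ω))
    (h : ∀ ψ : Space m → ℝ, ContDiff ℝ 1 ψ → HasCompactSupport ψ → tsupport ψ ⊆ Ω →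
      ∫ x in Ω, ψ x * y x = 0) : y = 0 := by
  have hl : LocallyIntegrableOn (y : Space m → ℝ) Ω volume :=
    locallyIntegrableOn_of_locallyIntegrable_restrict
      ((Lp.memLp y).locallyIntegrable (by norm_num))
  have h1 := hΩ.ae_eq_zero_of_integral_contDiff_smul_eq_zero hl fun ψ hψ hψs hψΩ => by
    rw [← h ψ (hψ.of_le (by exact_mod_cast le_top)) hψs hψΩ]
    refine (setIntegral_eq_integral_of_forall_compl_eq_zero fun x hx => ?_).symm
    rw [image_eq_zero_of_notMem_tsupport fun h' => hx (hψΩ h'), zero_smul]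
  refine Lp.ext ?_
  filter_upwards [(ae_restrict_iff' hΩ.measurableSet).2 h1, Lp.coeFn_zero ℝ 2 (volume.restrict Ω)]
    with x hx hx0
  rw [hx, hx0, Pi.zero_apply]

lemma exists_timeTest_eq {ψ : Space m → ℝ} (hψ : ContDiff ℝ 1 ψ) (hψs : HasCompactSupport ψ)
    (hψΩ : tsupport ψ ⊆ Ω) (s : ℝ) {r : ℝ} (hr : 0 < r) :
    ∃ ϕ : TimeTest Ω, (∀ x, (ϕ : Space m × ℝ → ℝ) (x, s) = ψ x) ∧
      ∀ x t, r ≤ |t - s| → (ϕ : Space m × ℝ → ℝ) (x, t) = 0 := by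
  let f : ContDiffBump s := ⟨r / 2, r, by positivity, by linarith⟩
  have hsupp : ∀ z : Space m × ℝ, ψ z.1 * f z.2 ≠ 0 → z ∈ tsupport ψ ×ˢ tsupport f := fun z hz =>
    ⟨subset_closure (left_ne_zero_of_mul hz), subset_closure (right_ne_zero_of_mul hz)⟩
  have hK : IsCompact (tsupport ψ ×ˢ tsupport f) := hψs.isCompact.prod f.hasCompactSupport.isCompact
  refine ⟨⟨fun z => ψ z.1 * f z.2, (hψ.comp contDiff_fst).mul (f.contDiff.comp contDiff_snd),
    HasCompactSupport.of_support_subset_isCompact hK hsupp,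
    (closure_minimal hsupp hK.isClosed).trans fun z hz => ⟨hψΩ hz.1, mem_univ _⟩⟩,
    fun x => ?_, fun x t ht => ?_⟩
  · change ψ x * f s = ψ x
    rw [f.one_of_mem_closedBall (Metric.mem_closedBall_self f.rIn_pos.le), mul_one]
  · change ψ x * f t = 0
    rw [f.zero_of_le_dist (by rwa [Real.dist_eq]), mul_zero]

/-- A representative vanishes at `s` if its value there is orthogonal to the slices of all test
functions that vanish at `s'`. -/
lemma eq_zero_of_forall_inner_slice (hΩ : IsOpen Ω) {s s' : ℝ} (hs : s ≠ s')
    (y : Lp ℝ 2 (volume.restrict Ω))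
    (h : ∀ ϕ : TimeTest Ω, (∀ x, (ϕ : Space m × ℝ → ℝ) (x, s') = 0) →
      inner ℝ y (slice Ω ϕ s) = 0) : y = 0 := by
  refine eq_zero_of_forall_integral_mul_eq_zero hΩ y fun ψ hψ hψs hψΩ => ?_
  obtain ⟨ϕ, h1, h2⟩ := exists_timeTest_eq hψ hψs hψΩ s (abs_pos.2 (sub_ne_zero.2 hs.symm))
  rw [← h ϕ fun x => h2 x s' le_rfl, real_inner_comm, slice, inner_toLp_eq_integral]
  refine integral_congr_ae (ae_of_all _ fun x => ?_)
  simp [h1, mul_comm]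

lemma slice_eq_zero {ϕ : C10 S} {s : ℝ} (h : ∀ x, (ϕ : Space m × ℝ → ℝ) (x, s) = 0) :
    slice Ω ϕ s = 0 := by
  rw [← norm_eq_zero, ← sq_eq_zero_iff, slice, norm_toLp_sq]
  simp [h]

/-- The initial condition in weak form. -/
theorem vanishesAt_zero_iff (hΩ : IsOpen Ω) (hb : Bornology.IsBounded Ω) (hT : 0 < T)
    {w : W (cylinder Ω T)} {ℓ : StrongDual ℝ (W (cylinder Ω T))} (h : IsTimeDeriv w ℓ) :
    VanishesAt Ω T 0 (valW w) ↔ ∀ ϕ : TimeTest Ω, (∀ x, (ϕ : Space m × ℝ → ℝ) (x, T) = 0) →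
      ℓ (timeTestToW T ϕ) + timeTestDt T ϕ w = 0 := by
  obtain ⟨c, -, hc, -⟩ := exists_isTimeRep hb hT h
  have key : ∀ ϕ : TimeTest Ω, (∀ x, (ϕ : Space m × ℝ → ℝ) (x, T) = 0) →
      ℓ (timeTestToW T ϕ) + timeTestDt T ϕ w = -inner ℝ (c 0) (slice Ω ϕ 0) := fun ϕ hϕ => by
    rw [h.add_eq_inner_sub_inner hb hT (isTimeDeriv_timeTest ϕ) hc (isTimeRep_slice hb ϕ),
      slice_eq_zero hϕ, inner_zero_right, zero_sub]
  rw [vanishesAt_iff_exists_isTimeRep]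
  constructor
  · rintro ⟨c', hc', h0⟩ ϕ hϕ
    rw [key ϕ hϕ, hc.eqOn hT hc' ⟨le_rfl, hT.le⟩, h0, inner_zero_left, neg_zero]
  · refine fun H => ⟨c, hc, eq_zero_of_forall_inner_slice hΩ hT.ne _ fun ϕ hϕ => ?_⟩
    rw [← neg_eq_zero, ← key ϕ hϕ, H ϕ hϕ]

/-- The final condition follows from its weak form. -/
theorem vanishesAt_final (hΩ : IsOpen Ω) (hb : Bornology.IsBounded Ω) (hT : 0 < T)
    {w : W (cylinder Ω T)} {ℓ : StrongDual ℝ (W (cylinder Ω T))} (h : IsTimeDeriv w ℓ)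
    (H : ∀ ϕ : TimeTest Ω, (∀ x, (ϕ : Space m × ℝ → ℝ) (x, 0) = 0) →
      ℓ (timeTestToW T ϕ) + timeTestDt T ϕ w = 0) : VanishesAt Ω T T (valW w) := by
  obtain ⟨c, -, hc, -⟩ := exists_isTimeRep hb hT h
  refine vanishesAt_iff_exists_isTimeRep.2
    ⟨c, hc, eq_zero_of_forall_inner_slice hΩ hT.ne' _ fun ϕ hϕ => ?_⟩
  have e := h.add_eq_inner_sub_inner hb hT (isTimeDeriv_timeTest ϕ) hc (isTimeRep_slice hb ϕ)
  rw [H ϕ hϕ, slice_eq_zero hϕ, inner_zero_right, sub_zero] at e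
  exact e.symm

lemma vanishesAt_timeTest (hb : Bornology.IsBounded Ω) {ϕ : TimeTest Ω} {s : ℝ}
    (hϕ : ∀ x, (ϕ : Space m × ℝ → ℝ) (x, s) = 0) : VanishesAt Ω T s (valW (timeTestToW T ϕ)) :=
  vanishesAt_iff_exists_isTimeRep.2 ⟨_, isTimeRep_slice hb ϕ, slice_eq_zero hϕ⟩

end Trace

/-! ### Poincaré's inequality -/

section Poincare

variable {Ω : Set (Space m)} {T : ℝ}

lemma C10.integral_sq_le {Q : Set (Space m × ℝ)} (i : Fin m) {R : ℝ}
    (hR : ∀ z ∈ Q, |z.1 i| ≤ R) (ξ : C10 Q) :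
    ∫ z, (ξ : Space m × ℝ → ℝ) z ^ 2
      ≤ 4 * R ^ 2 * ∫ z, ‖gradx (ξ : Space m × ℝ → ℝ) z‖ ^ 2 := by
  set P : Space m × ℝ →L[ℝ] ℝ :=
    (EuclideanSpace.proj (𝕜 := ℝ) i).comp (ContinuousLinearMap.fst ℝ (Space m) ℝ)
  have hP : ∀ z : Space m × ℝ, P z = z.1 i := fun z => rfl
  have hP1 : ContDiff ℝ 1 P := P.contDiff
  let ζ : C10 Q := ⟨fun z => P z * (ξ : Space m × ℝ → ℝ) z, hP1.mul ξ.2.1,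
    ξ.2.2.1.mul_left, (closure_mono (Function.support_mul_subset_right _ _)).trans ξ.2.2.2⟩
  have hζd : ∀ z, fderiv ℝ (ζ : Space m × ℝ → ℝ) z (EuclideanSpace.single i 1, 0)
      = P z * dx i (ξ : Space m × ℝ → ℝ) z + (ξ : Space m × ℝ → ℝ) z := fun z => by
    have h : fderiv ℝ (ζ : Space m × ℝ → ℝ) z = _ :=
      (P.hasFDerivAt.mul (C10.differentiable ξ z).hasFDerivAt).fderiv
    rw [h]
    simp [dx, hP]
  have hibp := C10.integral_mul_fderiv ζ ξ (EuclideanSpace.single i 1, 0)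
  simp_rw [hζd] at hibp
  have hξ := ξ.2.1.continuous
  have hPc : Continuous P := P.continuous
  have i1 : Integrable fun z => (ξ : Space m × ℝ → ℝ) z ^ 2 := (C10.memLp ξ _).integrable_sq
  have i2 : Integrable fun z => P z * (ξ : Space m × ℝ → ℝ) z * dx i (ξ : Space m × ℝ → ℝ) z :=
    ((hPc.mul hξ).mul (C10.continuous_dx ξ i)).integrable_of_hasCompactSupport
      (C10.hasCompactSupport_dx ξ i).mul_left
  have i3 : Integrable fun z => ‖gradx (ξ : Space m × ℝ → ℝ) z‖ ^ 2 :=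
    (C10.memLp_gradx ξ _).norm.integrable_sq
  have e : ∫ z, (ξ : Space m × ℝ → ℝ) z ^ 2
      = ∫ z, -2 * (P z * (ξ : Space m × ℝ → ℝ) z * dx i (ξ : Space m × ℝ → ℝ) z) := by
    have h1 : ∫ z, (P z * dx i (ξ : Space m × ℝ → ℝ) z + (ξ : Space m × ℝ → ℝ) z)
          * (ξ : Space m × ℝ → ℝ) z
        = (∫ z, P z * (ξ : Space m × ℝ → ℝ) z * dx i (ξ : Space m × ℝ → ℝ) z)
          + ∫ z, (ξ : Space m × ℝ → ℝ) z ^ 2 := by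
      rw [← integral_add i2 i1]
      refine integral_congr_ae (ae_of_all _ fun z => ?_)
      dsimp only
      ring
    rw [h1] at hibp
    have h2 : ∫ z, (ζ : Space m × ℝ → ℝ) z
          * fderiv ℝ (ξ : Space m × ℝ → ℝ) z (EuclideanSpace.single i 1, 0)
        = ∫ z, P z * (ξ : Space m × ℝ → ℝ) z * dx i (ξ : Space m × ℝ → ℝ) z := rfl
    rw [h2] at hibp
    rw [integral_const_mul]
    linarith
  have hle : ∫ z, -2 * (P z * (ξ : Space m × ℝ → ℝ) z * dx i (ξ : Space m × ℝ → ℝ) z)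
      ≤ ∫ z, (1 / 2 * (ξ : Space m × ℝ → ℝ) z ^ 2
        + 2 * R ^ 2 * ‖gradx (ξ : Space m × ℝ → ℝ) z‖ ^ 2) := by
    refine integral_mono (i2.const_mul _) ((i1.const_mul _).add (i3.const_mul _)) fun z => ?_
    dsimp only
    by_cases hz : z ∈ Q
    · have h1 : (P z) ^ 2 ≤ R ^ 2 := sq_le_sq' (abs_le.1 (hR z hz)).1 (abs_le.1 (hR z hz)).2
      have h2 : dx i (ξ : Space m × ℝ → ℝ) z ^ 2 ≤ ‖gradx (ξ : Space m × ℝ → ℝ) z‖ ^ 2 := by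
        have h3 := PiLp.norm_apply_le (gradx (ξ : Space m × ℝ → ℝ) z) i
        have h4 : gradx (ξ : Space m × ℝ → ℝ) z i = dx i (ξ : Space m × ℝ → ℝ) z := rfl
        rw [h4, Real.norm_eq_abs] at h3
        exact sq_le_sq' (by linarith [(abs_le.1 h3).1]) (abs_le.1 h3).2
      have h5 : P z ^ 2 * dx i (ξ : Space m × ℝ → ℝ) z ^ 2
          ≤ R ^ 2 * ‖gradx (ξ : Space m × ℝ → ℝ) z‖ ^ 2 :=
        mul_le_mul h1 h2 (sq_nonneg _) (sq_nonneg _)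
      nlinarith [sq_nonneg ((ξ : Space m × ℝ → ℝ) z + 2 * (P z * dx i (ξ : Space m × ℝ → ℝ) z))]
    · rw [C10.eq_zero ξ hz, C10.gradx_eq_zero ξ hz]
      simp
  rw [← e, integral_add (i1.const_mul _) (i3.const_mul _), integral_const_mul,
    integral_const_mul] at hle
  linarith

/-- Poincaré's inequality on `W`. -/
lemma exists_poincare (hm : 1 ≤ m) (hb : Bornology.IsBounded Ω) :
    ∃ C : ℝ, 0 < C ∧ ∀ w : W (cylinder Ω T), C * ‖w‖ ^ 2 ≤ ‖gradW w‖ ^ 2 := by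
  obtain ⟨R, hR⟩ := hb.exists_norm_le
  have hR' : ∀ z ∈ cylinder Ω T, |z.1 ⟨0, hm⟩| ≤ R := fun z hz =>
    (PiLp.norm_apply_le z.1 ⟨0, hm⟩).trans (hR z.1 hz.1)
  have key : ∀ w : W (cylinder Ω T), ‖w‖ ^ 2 ≤ (4 * R ^ 2 + 1) * ‖gradW w‖ ^ 2 := fun w => by
    refine denseRange_testToW.induction_on
      (p := fun w => ‖w‖ ^ 2 ≤ (4 * R ^ 2 + 1) * ‖gradW w‖ ^ 2) w ?_ fun ξ => ?_
    · exact isClosed_le (continuous_norm.pow 2)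
        (continuous_const.mul ((gradCLM (cylinder Ω T)).continuous.norm.pow 2))
    · have h1 : ‖valW (testToW ξ)‖ ^ 2 = ∫ z, (ξ : Space m × ℝ → ℝ) z ^ 2 := by
        refine (norm_toLp_sq (C10.memLp ξ _)).trans ?_
        rw [setIntegral_eq_integral_of_zero fun z hz => by rw [C10.eq_zero ξ hz]; simp]
        simp
      have h2 : ‖gradW (testToW ξ)‖ ^ 2 = ∫ z, ‖gradx (ξ : Space m × ℝ → ℝ) z‖ ^ 2 := by
        refine (norm_toLp_sq (C10.memLp_gradx ξ _)).trans ?_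
        rw [setIntegral_eq_integral_of_zero fun z hz => by rw [C10.gradx_eq_zero ξ hz]; simp]
      have h3 := C10.integral_sq_le ⟨0, hm⟩ hR' ξ
      rw [norm_W_sq, h1, h2]
      linarith
  refine ⟨(4 * R ^ 2 + 1)⁻¹, by positivity, fun w => ?_⟩
  rw [inv_mul_le_iff₀ (by positivity)]
  exact key w

end Poincare

/-! ### The coefficients -/

section Multiplier

variable {α E F : Type*} [MeasurableSpace α] {μ : Measure α} [NormedAddCommGroup E]
  [NormedSpace ℝ E] [NormedAddCommGroup F] [NormedSpace ℝ F]

/-- Pointwise application of a bounded field of operators is bounded on `L²`. -/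
lemma exists_multiplier {A : α → E →L[ℝ] F} (hA : AEStronglyMeasurable A μ) {M : ℝ}
    (hAM : ∀ᵐ z ∂μ, ‖A z‖ ≤ M) :
    ∃ L : Lp E 2 μ →L[ℝ] Lp F 2 μ, ∀ f : Lp E 2 μ, L f =ᵐ[μ] fun z => A z (f z) := by
  have hmem : ∀ f : Lp E 2 μ, MemLp (fun z => A z (f z)) 2 μ := fun f => by
    refine (Lp.memLp f).of_le_mul (c := M) ?_ ?_
    · exact (isBoundedBilinearMap_apply (𝕜 := ℝ) (E := E) (F := F)).continuous.comp_aestronglyMeasurable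
        (hA.prodMk (Lp.memLp f).1)
    · filter_upwards [hAM] with z hz
      exact ((A z).le_opNorm _).trans (mul_le_mul_of_nonneg_right hz (norm_nonneg _))
  refine ⟨LinearMap.mkContinuous
    { toFun := fun f => (hmem f).toLp _
      map_add' := fun f g => ?_
      map_smul' := fun c f => ?_ } M fun f => ?_, fun f => (hmem f).coeFn_toLp⟩
  · refine Lp.ext ?_
    filter_upwards [(hmem (f + g)).coeFn_toLp, Lp.coeFn_add f g, (hmem f).coeFn_toLp,
      (hmem g).coeFn_toLp, Lp.coeFn_add ((hmem f).toLp _) ((hmem g).toLp _)] with z h1 h2 h3 h4 h5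
    rw [h1, h5, Pi.add_apply, h3, h4, h2, Pi.add_apply, map_add]
  · refine Lp.ext ?_
    filter_upwards [(hmem (c • f)).coeFn_toLp, Lp.coeFn_smul c f, (hmem f).coeFn_toLp,
      Lp.coeFn_smul c ((hmem f).toLp _)] with z h1 h2 h3 h4
    rw [RingHom.id_apply, h1, h4, Pi.smul_apply, h3, h2, Pi.smul_apply, map_smul]
  · refine Lp.norm_le_mul_norm_of_ae_le_mul ?_
    filter_upwards [(hmem f).coeFn_toLp, hAM] with z h1 h2
    change ‖(hmem f).toLp _ z‖ ≤ _
    rw [h1]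
    exact ((A z).le_opNorm _).trans (mul_le_mul_of_nonneg_right h2 (norm_nonneg _))

end Multiplier

section Convection

variable {Ω : Set (Space m)}

/-- A divergence free field is skew-symmetric. -/
lemma integral_inner_grad_mul_eq_zero (hΩ : IsOpen Ω) {V : Space m → Space m}
    (hV : ContDiffOn ℝ 1 V Ω)
    (hdiv : ∀ x ∈ Ω, ∑ i : Fin m, fderiv ℝ V x (EuclideanSpace.single i 1) i = 0)
    {h : Space m → ℝ} (hh : ContDiff ℝ 1 h) (hhs : HasCompactSupport h) (hhΩ : tsupport h ⊆ Ω) :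
    ∫ x in Ω, (∑ i : Fin m, V x i * fderiv ℝ h x (EuclideanSpace.single i 1)) * h x = 0 := by
  have hz : ∀ x ∉ Ω, h x = 0 := fun x hx =>
    image_eq_zero_of_notMem_tsupport fun h' => hx (hhΩ h')
  rw [setIntegral_eq_integral_of_forall_compl_eq_zero fun x hx => by rw [hz x hx, mul_zero]]
  set P : Fin m → Space m →L[ℝ] ℝ := fun i => EuclideanSpace.proj i
  have hf : ∀ i, ContDiff ℝ 1 fun x => h x * V x i := fun i => by
    rw [contDiff_iff_contDiffAt]
    intro x
    by_cases hx : x ∈ Ω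
    · exact hh.contDiffAt.mul ((P i).contDiff.contDiffAt.comp x
        ((hV x hx).contDiffAt (hΩ.mem_nhds hx)))
    · have h0 : (fun x => h x * V x i) =ᶠ[𝓝 x] fun _ => 0 := by
        filter_upwards [(isClosed_tsupport h).isOpen_compl.mem_nhds fun h' => hx (hhΩ h')]
          with y hy
        rw [image_eq_zero_of_notMem_tsupport hy, zero_mul]
      exact contDiffAt_const.congr_of_eventuallyEq h0
  have hfs : ∀ i, HasCompactSupport fun x => h x * V x i := fun i => hhs.mul_right
  have hdc : ∀ i, Continuous fun x => fderiv ℝ h x (EuclideanSpace.single i 1) := fun i =>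
    (hh.continuous_fderiv one_ne_zero).clm_apply continuous_const
  have hfdc : ∀ i, Continuous fun x =>
      fderiv ℝ (fun x => h x * V x i) x (EuclideanSpace.single i 1) := fun i =>
    ((hf i).continuous_fderiv one_ne_zero).clm_apply continuous_const
  have i1 : ∀ i, Integrable fun x => (h x * V x i) * fderiv ℝ h x (EuclideanSpace.single i 1) :=
    fun i => ((hf i).continuous.mul (hdc i)).integrable_of_hasCompactSupport (hfs i).mul_right
  have i2 : ∀ i, Integrable fun x =>
      fderiv ℝ (fun x => h x * V x i) x (EuclideanSpace.single i 1) * h x :=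
    fun i => ((hfdc i).mul hh.continuous).integrable_of_hasCompactSupport hhs.mul_left
  have hibp : ∀ i, ∫ x, ((h x * V x i) * fderiv ℝ h x (EuclideanSpace.single i 1)
      + fderiv ℝ (fun x => h x * V x i) x (EuclideanSpace.single i 1) * h x) = 0 := fun i => by
    have e := integral_mul_fderiv_eq_neg_fderiv_mul_of_integrable (μ := volume)
      (f := fun x => h x * V x i) (g := h) (v := EuclideanSpace.single i (1 : ℝ)) (i2 i) (i1 i)
      (((hf i).continuous.mul hh.continuous).integrable_of_hasCompactSupport hhs.mul_left)
      (fun x _ => (hf i).differentiable one_ne_zero x)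
      (fun x _ => hh.differentiable one_ne_zero x)
    rw [integral_add (i1 i) (i2 i), e]
    ring
  have hpt : ∀ x, (∑ i : Fin m, V x i * fderiv ℝ h x (EuclideanSpace.single i 1)) * h x
      = 1 / 2 * ∑ i : Fin m, ((h x * V x i) * fderiv ℝ h x (EuclideanSpace.single i 1)
      + fderiv ℝ (fun x => h x * V x i) x (EuclideanSpace.single i 1) * h x) := fun x => by
    by_cases hx : x ∈ Ω
    · have hd : ∀ i, fderiv ℝ (fun x => h x * V x i) x (EuclideanSpace.single i 1)
          = h x * fderiv ℝ V x (EuclideanSpace.single i 1) i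
            + V x i * fderiv ℝ h x (EuclideanSpace.single i 1) := fun i => by
        have h1 : HasFDerivAt (fun x => V x i) ((P i).comp (fderiv ℝ V x)) x :=
          (P i).hasFDerivAt.comp x (((hV x hx).contDiffAt (hΩ.mem_nhds hx)).differentiableAt
            one_ne_zero).hasFDerivAt
        have h2 : fderiv ℝ (fun x => h x * V x i) x = _ :=
          ((hh.differentiable one_ne_zero x).hasFDerivAt.mul h1).fderiv
        rw [h2]
        simp [P]
      have e : ∀ i, (h x * V x i) * fderiv ℝ h x (EuclideanSpace.single i 1)
          + fderiv ℝ (fun x => h x * V x i) x (EuclideanSpace.single i 1) * h x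
          = 2 * (V x i * fderiv ℝ h x (EuclideanSpace.single i 1) * h x)
            + h x ^ 2 * fderiv ℝ V x (EuclideanSpace.single i 1) i := fun i => by
        rw [hd]
        ring
      simp_rw [e, Finset.sum_add_distrib, ← Finset.mul_sum, hdiv x hx, ← Finset.sum_mul]
      ring
    · rw [hz x hx]
      simp
  simp_rw [hpt]
  have i3 : ∀ i, Integrable fun x =>
      (h x * V x i) * fderiv ℝ h x (EuclideanSpace.single i 1)
      + fderiv ℝ (fun x => h x * V x i) x (EuclideanSpace.single i 1) * h x :=
    fun i => (i1 i).add (i2 i)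
  rw [integral_const_mul, integral_finsetSum _ fun i _ => i3 i]
  simp [hibp]

end Convection

namespace Data

variable {D : Data m}

lemma IsAdmissible.exists_continuousOn_velocity (hD : D.IsAdmissible) :
    ∃ V : Space m × ℝ → Space m, ContinuousOn V (closure D.Ω ×ˢ Icc 0 D.T) ∧
      ∀ z ∈ D.Q, V z = D.v z := by
  obtain ⟨G, hG, hGv⟩ := hD.v_regular.2 0 (by norm_num)
  refine ⟨fun z => G z 0, ?_, fun z hz => ?_⟩
  · exact (ContinuousMultilinearMap.apply ℝ (fun _ : Fin 0 => Space m) (Space m)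
      0).continuous.comp_continuousOn hG
  · have := hGv z.2 ⟨hz.2.1.le, hz.2.2.le⟩ z.1 hz.1
    change G (z.1, z.2) 0 = _
    rw [this, iteratedFDeriv_zero_apply]

lemma IsAdmissible.measurableSet_Q (hD : D.IsAdmissible) : MeasurableSet D.Q :=
  measurableSet_cylinder hD.isOpen_Ω.measurableSet

lemma IsAdmissible.velocity_bounded (hD : D.IsAdmissible) :
    AEStronglyMeasurable D.v (volume.restrict D.Q) ∧ ∃ M, 0 ≤ M ∧ ∀ z ∈ D.Q, ‖D.v z‖ ≤ M := by
  obtain ⟨V, hV, hVv⟩ := hD.exists_continuousOn_velocity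
  have hsub : D.Q ⊆ closure D.Ω ×ˢ Icc 0 D.T :=
    prod_mono subset_closure Ioo_subset_Icc_self
  constructor
  · refine ((hV.mono hsub).aestronglyMeasurable hD.measurableSet_Q).congr ?_
    filter_upwards [ae_restrict_mem hD.measurableSet_Q] with z hz
    exact hVv z hz
  · obtain ⟨M, hM⟩ := (hD.isBounded_Ω.isCompact_closure.prod
      isCompact_Icc).exists_bound_of_continuousOn hV
    exact ⟨max M 0, le_max_right _ _, fun z hz => by
      rw [← hVv z hz]
      exact (hM z (hsub hz)).trans (le_max_left _ _)⟩

lemma IsAdmissible.exists_convection (hD : D.IsAdmissible) :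
    ∃ L : L2Vec D.Q →L[ℝ] L2 D.Q,
      ∀ g, L g =ᵐ[volume.restrict D.Q] fun z => inner ℝ (D.v z) (g z) := by
  obtain ⟨hm, M, -, hM⟩ := hD.velocity_bounded
  refine exists_multiplier (A := fun z => innerSL ℝ (D.v z))
    ((innerSL ℝ).continuous.comp_aestronglyMeasurable hm) (M := M) ?_
  filter_upwards [ae_restrict_mem hD.measurableSet_Q] with z hz
  rw [innerSL_apply_norm]
  exact hM z hz

lemma κ_mem (D : Data m) (z : Space m × ℝ) : D.κ z = D.κ₁ ∨ D.κ z = D.κ₂ := by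
  unfold κ
  split_ifs <;> simp

lemma IsAdmissible.exists_diffusion (hD : D.IsAdmissible) :
    ∃ L : L2Vec D.Q →L[ℝ] L2Vec D.Q,
      ∀ g, L g =ᵐ[volume.restrict D.Q] fun z => D.κ z • g z := by
  have hmeas : Measurable D.κ := by
    have e : D.κ = fun z => (tube D.T D.Ω₁).indicator (fun _ => D.κ₁ - D.κ₂) z + D.κ₂ := by
      funext z
      by_cases hz : z ∈ tube D.T D.Ω₁
      · rw [indicator_of_mem hz, κ, if_pos hz, sub_add_cancel]
      · rw [indicator_of_notMem hz, κ, if_neg hz, zero_add]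
    rw [e]
    exact (measurable_const.indicator hD.isOpen_Q₁.measurableSet).add_const _
  have hA : AEStronglyMeasurable (fun z => D.κ z • ContinuousLinearMap.id ℝ (Space m))
      (volume.restrict D.Q) :=
    hmeas.aestronglyMeasurable.smul_const _
  obtain ⟨L, hL⟩ := exists_multiplier hA (M := max D.κ₁ D.κ₂)
    (ae_of_all _ fun z => by
      rw [norm_smul]
      have h1 : 0 ≤ D.κ z ∧ D.κ z ≤ max D.κ₁ D.κ₂ := by
        rcases D.κ_mem z with h | h <;> rw [h]
        · exact ⟨hD.κ₁_pos.le, le_max_left _ _⟩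
        · exact ⟨hD.κ₂_pos.le, le_max_right _ _⟩
      rw [Real.norm_of_nonneg h1.1]
      exact (mul_le_of_le_one_right h1.1 ContinuousLinearMap.norm_id_le).trans h1.2)
  exact ⟨L, fun g => hL g⟩

/-- The convective term does not contribute to the energy. -/
lemma IsAdmissible.integral_convection_self (hD : D.IsAdmissible) (w : W D.Q) :
    ∫ z in D.Q, inner ℝ (D.v z) (gradW w z) * valW w z = 0 := by
  obtain ⟨L, hL⟩ := hD.exists_convection
  have hform : ∀ w : W D.Q, ∫ z in D.Q, inner ℝ (D.v z) (gradW w z) * valW w z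
      = inner ℝ (valW w) (L (gradW w)) := fun w => by
    rw [L2.inner_def]
    refine integral_congr_ae ?_
    filter_upwards [hL (gradW w)] with z hz
    simp [hz]
  rw [hform]
  refine denseRange_testToW.induction_on
    (p := fun w : W D.Q => inner ℝ (valW w) (L (gradW w)) = 0) w ?_ fun ξ => ?_
  · exact isClosed_eq ((valCLM D.Q).continuous.inner (L.continuous.comp (gradCLM D.Q).continuous))
      continuous_const
  rw [← hform]
  have e1 : ∫ z in D.Q, inner ℝ (D.v z) (gradW (testToW ξ) z) * valW (testToW ξ) z
      = ∫ z in D.Q, inner ℝ (D.v z) (gradx (ξ : Space m × ℝ → ℝ) z)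
        * (ξ : Space m × ℝ → ℝ) z := by
    refine integral_congr_ae ?_
    filter_upwards [restrictPair_fst (Q := D.Q) ξ, restrictPair_snd (Q := D.Q) ξ] with z h1 h2
    have h1' : valW (testToW ξ) z = (ξ : Space m × ℝ → ℝ) z := h1
    have h2' : gradW (testToW ξ) z = gradx (ξ : Space m × ℝ → ℝ) z := h2
    rw [h1', h2']
  have hi : Integrable (fun z => inner ℝ (D.v z) (gradx (ξ : Space m × ℝ → ℝ) z)
      * (ξ : Space m × ℝ → ℝ) z) (volume.restrict D.Q) := by
    have h1 : MemLp (fun z => inner ℝ (D.v z) (gradx (ξ : Space m × ℝ → ℝ) z)) 2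
        (volume.restrict D.Q) := by
      refine (memLp_congr_ae ?_).1 (Lp.memLp (L (gradW (testToW ξ))))
      filter_upwards [hL (gradW (testToW ξ)), restrictPair_snd (Q := D.Q) ξ] with z h1 h2
      have h2' : gradW (testToW ξ) z = gradx (ξ : Space m × ℝ → ℝ) z := h2
      rw [h1, h2']
    exact h1.integrable_mul (C10.memLp ξ _)
  rw [e1]
  have hQ : (volume : Measure (Space m × ℝ)).restrict D.Q
      = (volume.restrict D.Ω).prod (volume.restrict (Ioo 0 D.T)) := by
    rw [Measure.prod_restrict, ← Measure.volume_eq_prod]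
    rfl
  rw [hQ] at hi ⊢
  rw [integral_prod_symm _ hi]
  refine integral_eq_zero_of_ae ?_
  filter_upwards [ae_restrict_mem measurableSet_Ioo] with t ht
  have htI : t ∈ Icc 0 D.T := Ioo_subset_Icc_self ht
  have hd : ∀ x, HasFDerivAt (fun x => (ξ : Space m × ℝ → ℝ) (x, t))
      ((fderiv ℝ (ξ : Space m × ℝ → ℝ) (x, t)).comp
        ((ContinuousLinearMap.id ℝ (Space m)).prod 0)) x := fun x =>
    (C10.differentiable ξ (x, t)).hasFDerivAt.comp x
      ((hasFDerivAt_id x).prodMk (hasFDerivAt_const t x))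
  have hh : ContDiff ℝ 1 fun x => (ξ : Space m × ℝ → ℝ) (x, t) :=
    ξ.2.1.comp (contDiff_id.prodMk contDiff_const)
  have hsupp : tsupport (fun x => (ξ : Space m × ℝ → ℝ) (x, t)) ⊆ D.Ω := by
    have hcl : IsClosed ((fun x : Space m => (x, t)) ⁻¹' tsupport (ξ : Space m × ℝ → ℝ)) :=
      (isClosed_tsupport _).preimage (by fun_prop)
    have hsub : Function.support (fun x => (ξ : Space m × ℝ → ℝ) (x, t))
        ⊆ (fun x : Space m => (x, t)) ⁻¹' tsupport (ξ : Space m × ℝ → ℝ) :=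
      fun x hx => subset_tsupport _ hx
    exact fun x hx => (ξ.2.2.2 (closure_minimal hsub hcl hx)).1
  have key := integral_inner_grad_mul_eq_zero hD.isOpen_Ω
    ((hD.v_regular.1 t htI).of_le one_le_two) (fun x hx => hD.v_div_free x hx t htI) hh
    (C10.hasCompactSupport_slice ξ t) hsupp
  rw [Pi.zero_apply, ← key]
  refine integral_congr_ae (ae_of_all _ fun x => ?_)
  dsimp only
  congr 1
  rw [PiLp.inner_apply]
  refine Finset.sum_congr rfl fun i _ => ?_
  rw [(hd x).fderiv]
  simp [gradx, dx, mul_comm]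

end Data

/-! ### An abstract saddle point problem -/

section SaddlePoint

variable {X Y H : Type*} [NormedAddCommGroup X] [InnerProductSpace ℝ X] [CompleteSpace X]
  [NormedAddCommGroup Y] [InnerProductSpace ℝ Y] [CompleteSpace Y]
  [NormedAddCommGroup H] [InnerProductSpace ℝ H] [CompleteSpace H]

/-- The Lax-Milgram theorem for operators. -/
lemma exists_equiv_of_coercive (S : X →L[ℝ] X) {C : ℝ} (hC : 0 < C)
    (h : ∀ x, C * ‖x‖ ^ 2 ≤ inner ℝ (S x) x) : ∃ e : X ≃L[ℝ] X, ∀ x, e x = S x := by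
  let B : X →L[ℝ] X →L[ℝ] ℝ := LinearMap.mkContinuous₂
    (LinearMap.mk₂ ℝ (fun x y => inner ℝ (S x) y)
      (fun x y z => by rw [map_add, inner_add_left])
      (fun c x y => by rw [map_smul, real_inner_smul_left, smul_eq_mul])
      (fun x y z => inner_add_right _ _ _)
      (fun c x y => by rw [real_inner_smul_right, smul_eq_mul])) ‖S‖
    (fun x y => (norm_inner_le_norm _ _).trans
      (mul_le_mul_of_nonneg_right (S.le_opNorm x) (norm_nonneg _)))
  have hB : ∀ x y, B x y = inner ℝ (S x) y := fun x y => rfl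
  have hco : IsCoercive B := ⟨C, hC, fun x => by
    rw [hB, mul_assoc, ← sq]
    exact h x⟩
  exact ⟨hco.continuousLinearEquivOfBilin, fun x => ext_inner_right ℝ fun y => by
    rw [hco.continuousLinearEquivOfBilin_apply, hB]⟩

/-- Unique solvability of a saddle point problem whose constraint operator is bounded below. -/
theorem exists_unique_saddlePoint (L : X →L[ℝ] Y) (A : Y →L[ℝ] Y) (J : X →L[ℝ] H)
    {c a η : ℝ} (hc : 0 < c) (hL : ∀ x, c * ‖x‖ ≤ ‖L x‖)
    (ha : 0 < a) (hA : ∀ y, a * ‖y‖ ^ 2 ≤ inner ℝ (A y) y) (hη : 0 < η) (f : StrongDual ℝ X) :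
    ∃ x : X, ∃ p : Y, (L x + (1 / η) • A p = 0 ∧
        ∀ y, inner ℝ (J x) (J y) - inner ℝ (L y) p = f y) ∧
      ∀ x' p', L x' + (1 / η) • A p' = 0 →
        (∀ y, inner ℝ (J x') (J y) - inner ℝ (L y) p' = f y) → x' = x ∧ p' = p := by
  obtain ⟨e, he⟩ := exists_equiv_of_coercive A ha hA
  let S : X →L[ℝ] X := (ContinuousLinearMap.adjoint J).comp J
    + η • (ContinuousLinearMap.adjoint L).comp ((e.symm : Y →L[ℝ] Y).comp L)
  have hS : ∀ x y, inner ℝ (S x) y = inner ℝ (J x) (J y) + η * inner ℝ (e.symm (L x)) (L y) :=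
    fun x y => by
      change inner ℝ (ContinuousLinearMap.adjoint J (J x)
        + η • ContinuousLinearMap.adjoint L (e.symm (L x))) y = _
      rw [inner_add_left, real_inner_smul_left, ContinuousLinearMap.adjoint_inner_left,
        ContinuousLinearMap.adjoint_inner_left]
  have hAn : 0 < ‖A‖ + 1 := by positivity
  have hSc : ∀ x, (η * a * (c / (‖A‖ + 1)) ^ 2) * ‖x‖ ^ 2 ≤ inner ℝ (S x) x := fun x => by
    rw [hS, real_inner_self_eq_norm_sq]
    set q := e.symm (L x)
    have hq : L x = A q := by rw [← he, e.apply_symm_apply]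
    have h1 : c / (‖A‖ + 1) * ‖x‖ ≤ ‖q‖ := by
      rw [div_mul_eq_mul_div, div_le_iff₀ hAn]
      refine (hL x).trans ?_
      rw [hq]
      refine (A.le_opNorm q).trans ?_
      nlinarith [norm_nonneg q]
    have h2 : (c / (‖A‖ + 1) * ‖x‖) ^ 2 ≤ ‖q‖ ^ 2 := pow_le_pow_left₀ (by positivity) h1 2
    have h3 : a * ‖q‖ ^ 2 ≤ inner ℝ q (L x) := by
      rw [hq, real_inner_comm]
      exact hA q
    have h4 : η * (a * (c / (‖A‖ + 1) * ‖x‖) ^ 2) ≤ η * inner ℝ q (L x) :=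
      mul_le_mul_of_nonneg_left ((mul_le_mul_of_nonneg_left h2 ha.le).trans h3) hη.le
    nlinarith [sq_nonneg ‖J x‖]
  obtain ⟨E, hE⟩ := exists_equiv_of_coercive S (by positivity) hSc
  have hp : ∀ x p, L x + (1 / η) • A p = 0 ↔ p = -(η • e.symm (L x)) := fun x p => by
    rw [← he p]
    constructor
    · intro h
      have h1 : L x = -((1 / η) • e p) := eq_neg_of_add_eq_zero_left h
      rw [h1, map_neg, map_smul, e.symm_apply_apply, smul_neg, neg_neg, smul_smul,
        mul_one_div_cancel hη.ne', one_smul]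
    · rintro rfl
      rw [map_neg, map_smul, e.apply_symm_apply, smul_neg, smul_smul,
        one_div_mul_cancel hη.ne', one_smul, add_neg_cancel]
  set r := (InnerProductSpace.toDual ℝ X).symm f
  have hr : ∀ y, f y = inner ℝ r y := fun y => by
    rw [InnerProductSpace.toDual_symm_apply]
  have hx : ∀ x p, p = -(η • e.symm (L x)) →
      ((∀ y, inner ℝ (J x) (J y) - inner ℝ (L y) p = f y) ↔ x = E.symm r) := by
    rintro x p rfl
    have h1 : ∀ y, inner ℝ (J x) (J y) - inner ℝ (L y) (-(η • e.symm (L x)))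
        = inner ℝ (S x) y := fun y => by
      rw [hS, inner_neg_right, real_inner_smul_right, real_inner_comm (L y), sub_neg_eq_add]
    simp_rw [h1, hr]
    have h2 : x = E.symm r ↔ S x = r := by
      rw [← hE]
      exact ⟨fun h => by rw [h, E.apply_symm_apply], fun h => by rw [← h, E.symm_apply_apply]⟩
    rw [h2]
    exact ⟨fun h => ext_inner_right ℝ h, fun h y => by rw [h]⟩
  refine ⟨E.symm r, -(η • e.symm (L (E.symm r))), ⟨(hp _ _).2 rfl, (hx _ _ rfl).2 rfl⟩, ?_⟩
  intro x' p' h1 h2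
  have h3 := (hp _ _).1 h1
  have h4 := (hx _ _ h3).1 h2
  exact ⟨h4, by rw [h3, h4]⟩

end SaddlePoint

/-! ### An abstract parabolic saddle point problem -/

section ParabolicSaddlePoint

variable {Y H : Type*} [NormedAddCommGroup Y] [InnerProductSpace ℝ Y]
  [NormedAddCommGroup H] [InnerProductSpace ℝ H]

/-- The operator `(w, g) ↦ g + B w + A w` on a subspace of `Y × Y`. -/
def stateOp (V : Submodule ℝ (WithLp 2 (Y × Y))) (A B : Y →L[ℝ] Y) : V →L[ℝ] Y :=
  (WithLp.sndL 2 ℝ Y Y + (B + A).comp (WithLp.fstL 2 ℝ Y Y)).comp V.subtypeL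

/-- The state operator of an accretive relation is bounded below. -/
lemma exists_le_norm_stateOp {V : Submodule ℝ (WithLp 2 (Y × Y))} {A B : Y →L[ℝ] Y} {a : ℝ}
    (hV : ∀ q ∈ V, 0 ≤ inner ℝ q.snd q.fst) (ha : 0 < a)
    (hA : ∀ w, a * ‖w‖ ^ 2 ≤ inner ℝ (A w) w) (hB : ∀ w, inner ℝ (B w) w = 0) :
    ∃ c, 0 < c ∧ ∀ x, c * ‖x‖ ≤ ‖stateOp V A B x‖ := by
  set M := 1 + ‖B + A‖ / a + 1 / a
  have hM : 0 < M := by positivity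
  refine ⟨1 / M, by positivity, fun x => ?_⟩
  set w := (x : WithLp 2 (Y × Y)).fst
  set g := (x : WithLp 2 (Y × Y)).snd
  have hL : stateOp V A B x = g + (B + A) w := rfl
  set y := stateOp V A B x
  have hg : 0 ≤ inner ℝ g w := hV x x.2
  have h1 : a * ‖w‖ ^ 2 ≤ ‖y‖ * ‖w‖ := by
    refine le_trans ?_ (real_inner_le_norm y w)
    have e : inner ℝ y w = inner ℝ g w + (inner ℝ (B w) w + inner ℝ (A w) w) := by
      rw [hL, add_apply, inner_add_left, inner_add_left]
    rw [e, hB]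
    linarith [hA w]
  have h2 : ‖w‖ ≤ ‖y‖ / a := by
    rw [le_div_iff₀ ha]
    rcases (norm_nonneg w).eq_or_lt with h | h
    · rw [← h, zero_mul]
      exact norm_nonneg y
    · exact le_of_mul_le_mul_right (by linarith) h
  have h3 : ‖g‖ ≤ ‖y‖ + ‖B + A‖ * (‖y‖ / a) := by
    have e : g = y - (B + A) w := by rw [hL, add_sub_cancel_right]
    rw [e]
    exact (norm_sub_le _ _).trans (add_le_add le_rfl (((B + A).le_opNorm w).trans
      (mul_le_mul_of_nonneg_left h2 (ContinuousLinearMap.opNorm_nonneg _))))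
  have h4 : ‖x‖ ≤ ‖w‖ + ‖g‖ := by
    have e : ‖x‖ ^ 2 = ‖w‖ ^ 2 + ‖g‖ ^ 2 := WithLp.prod_norm_sq_eq_of_L2 (x : WithLp 2 (Y × Y))
    refine abs_le_of_sq_le_sq' ?_ (by positivity) |>.2
    nlinarith [mul_nonneg (norm_nonneg w) (norm_nonneg g)]
  rw [one_div, inv_mul_le_iff₀ hM]
  have e : M * ‖y‖ = ‖y‖ / a + (‖y‖ + ‖B + A‖ * (‖y‖ / a)) := by
    simp only [M]
    ring
  linarith

/-- Unique solvability of the optimality system of a parabolic control problem in operator form. -/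
theorem exists_unique_parabolic_saddlePoint [CompleteSpace Y] [CompleteSpace H]
    {V : Submodule ℝ (WithLp 2 (Y × Y))}
    (hVc : IsClosed (V : Set (WithLp 2 (Y × Y)))) (hV : ∀ q ∈ V, 0 ≤ inner ℝ q.snd q.fst)
    {A B : Y →L[ℝ] Y} {a η : ℝ} (ha : 0 < a) (hA : ∀ w, a * ‖w‖ ^ 2 ≤ inner ℝ (A w) w)
    (hB : ∀ w, inner ℝ (B w) w = 0) (hη : 0 < η) (E : Y →L[ℝ] H) (d : H) :
    ∃ x ∈ V, ∃ p : Y, (x.snd + (B x.fst + A x.fst) + (1 / η) • A p = 0 ∧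
        ∀ y ∈ V, inner ℝ (E x.fst) (E y.fst) - inner ℝ (y.snd + (B y.fst + A y.fst)) p
          = inner ℝ d (E y.fst)) ∧
      ∀ x' ∈ V, ∀ p', x'.snd + (B x'.fst + A x'.fst) + (1 / η) • A p' = 0 →
        (∀ y ∈ V, inner ℝ (E x'.fst) (E y.fst) - inner ℝ (y.snd + (B y.fst + A y.fst)) p'
          = inner ℝ d (E y.fst)) → x' = x ∧ p' = p := by
  have : CompleteSpace V := hVc.completeSpace_coe
  obtain ⟨c, hc, hL⟩ := exists_le_norm_stateOp hV ha hA hB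
  let J : V →L[ℝ] H := (E.comp (WithLp.fstL 2 ℝ Y Y)).comp V.subtypeL
  obtain ⟨x, p, ⟨h1, h2⟩, h3⟩ :=
    exists_unique_saddlePoint (stateOp V A B) A J hc hL ha hA hη ((innerSL ℝ d).comp J)
  refine ⟨x, x.2, p, ⟨h1, fun y hy => h2 ⟨y, hy⟩⟩, fun x' hx' p' h1' h2' => ?_⟩
  obtain ⟨e, hp⟩ := h3 ⟨x', hx'⟩ p' h1' fun y => h2' y y.2
  exact ⟨congrArg Subtype.val e, hp⟩

end ParabolicSaddlePoint

/-! ### The state-adjoint problem -/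

section InitialSpace

variable {Ω : Set (Space m)} {T : ℝ}

/-- Elements of `W` together with the Riesz representative of their time derivative. -/
abbrev GraphSpace (Ω : Set (Space m)) (T : ℝ) : Type :=
  WithLp 2 (W (cylinder Ω T) × W (cylinder Ω T))

/-- The defect `⟨g, ϕ⟩ + ⟨∂ₜϕ, w⟩` in the integration by parts formula. -/
def timeDefect (ϕ : TimeTest Ω) : StrongDual ℝ (GraphSpace Ω T) :=
  (innerSL ℝ (timeTestToW T ϕ)).comp (WithLp.sndL 2 ℝ _ _)
    + (timeTestDt T ϕ).comp (WithLp.fstL 2 ℝ _ _)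

/-- The space `U₀`, as a closed subspace of `W × W`. -/
def initialSpace (Ω : Set (Space m)) (T : ℝ) : Submodule ℝ (GraphSpace Ω T) :=
  ⨅ (ϕ : TimeTest Ω) (_ : ∀ x, (ϕ : Space m × ℝ → ℝ) (x, T) = 0),
    LinearMap.ker (timeDefect (T := T) ϕ).toLinearMap

lemma mem_initialSpace {q : GraphSpace Ω T} : q ∈ initialSpace Ω T ↔
    ∀ ϕ : TimeTest Ω, (∀ x, (ϕ : Space m × ℝ → ℝ) (x, T) = 0) →
      inner ℝ q.snd (timeTestToW T ϕ) + timeTestDt T ϕ q.fst = 0 := by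
  simp only [initialSpace, Submodule.mem_iInf]
  refine forall_congr' fun ϕ => forall_congr' fun _ => ?_
  rw [real_inner_comm]
  rfl

lemma isClosed_initialSpace : IsClosed (initialSpace Ω T : Set (GraphSpace Ω T)) := by
  simp only [initialSpace, Submodule.coe_iInf]
  exact isClosed_iInter fun ϕ => isClosed_iInter fun _ => (timeDefect ϕ).isClosed_ker

/-- A test function of the open cylinder as a test function on `Ω × ℝ`. -/
def C10.toTimeTest (ξ : C10 (cylinder Ω T)) : TimeTest Ω :=
  ⟨ξ, ξ.2.1, ξ.2.2.1, ξ.2.2.2.trans (prod_mono subset_rfl (subset_univ _))⟩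

lemma C10.toTimeTest_zero (ξ : C10 (cylinder Ω T)) (x : Space m) :
    (C10.toTimeTest ξ : Space m × ℝ → ℝ) (x, 0) = 0 :=
  C10.eq_zero ξ fun h => lt_irrefl _ h.2.1

lemma C10.toTimeTest_final (ξ : C10 (cylinder Ω T)) (x : Space m) :
    (C10.toTimeTest ξ : Space m × ℝ → ℝ) (x, T) = 0 :=
  C10.eq_zero ξ fun h => lt_irrefl _ h.2.2

lemma isTimeDeriv_of_forall {w : W (cylinder Ω T)} {ℓ : StrongDual ℝ (W (cylinder Ω T))}
    (h : ∀ ξ : C10 (cylinder Ω T), ℓ (timeTestToW T (C10.toTimeTest ξ))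
      + timeTestDt T (C10.toTimeTest ξ) w = 0) : IsTimeDeriv w ℓ := by
  intro ξ
  have h1 : testToW ξ = timeTestToW T (C10.toTimeTest ξ) := rfl
  have h2 := h ξ
  rw [timeTestDt_apply] at h2
  rw [h1, eq_neg_of_add_eq_zero_left h2]
  congr 1
  refine integral_congr_ae (ae_of_all _ fun z => ?_)
  exact mul_comm _ _

/-- The Riesz representative of an element of `W'`. -/
def rieszW (ℓ : StrongDual ℝ (W (cylinder Ω T))) : W (cylinder Ω T) :=
  (InnerProductSpace.toDual ℝ _).symm ℓ

lemma inner_rieszW (ℓ : StrongDual ℝ (W (cylinder Ω T))) (φ : W (cylinder Ω T)) :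
    inner ℝ (rieszW ℓ) φ = ℓ φ := InnerProductSpace.toDual_symm_apply

lemma exists_mem_initialSpace_of_mem_U0 (hΩ : IsOpen Ω) (hb : Bornology.IsBounded Ω) (hT : 0 < T)
    {u : U (cylinder Ω T)} (hu : u ∈ U0 Ω T) :
    ∃ q ∈ initialSpace Ω T, (u : W (cylinder Ω T)) = q.fst ∧
      ∀ φ, timeDeriv u φ = inner ℝ q.snd φ := by
  have key : ∀ (w g : W (cylinder Ω T)), (u : W (cylinder Ω T)) = w →
      (∀ φ, timeDeriv u φ = inner ℝ g φ) → ∃ q ∈ initialSpace Ω T,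
        (u : W (cylinder Ω T)) = q.fst ∧ ∀ φ, timeDeriv u φ = inner ℝ q.snd φ := by
    intro w g hw hg
    refine ⟨WithLp.toLp 2 (w, g), mem_initialSpace.2 fun ϕ hϕ => ?_, hw, hg⟩
    have h := (vanishesAt_zero_iff hΩ hb hT (isTimeDeriv_timeDeriv u)).1 hu ϕ hϕ
    rw [hg, hw] at h
    exact h
  exact key _ _ rfl fun φ => (inner_rieszW _ φ).symm

lemma exists_U0_of_mem_initialSpace (hΩ : IsOpen Ω) (hb : Bornology.IsBounded Ω) (hT : 0 < T)
    {q : GraphSpace Ω T} (hq : q ∈ initialSpace Ω T) :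
    ∃ u : U (cylinder Ω T), u ∈ U0 Ω T ∧ (u : W (cylinder Ω T)) = q.fst ∧
      ∀ φ, timeDeriv u φ = inner ℝ q.snd φ := by
  rw [mem_initialSpace] at hq
  set ℓ : StrongDual ℝ (W (cylinder Ω T)) := innerSL ℝ q.snd
  have hd : IsTimeDeriv q.fst ℓ :=
    isTimeDeriv_of_forall fun ξ => hq _ (C10.toTimeTest_final ξ)
  let u : U (cylinder Ω T) := ⟨q.fst, ℓ, hd⟩
  have hu : timeDeriv u = ℓ := (isTimeDeriv_timeDeriv u).unique hd
  exact ⟨u, (vanishesAt_zero_iff hΩ hb hT hd).2 hq, rfl, fun φ => by rw [hu]; rfl⟩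

end InitialSpace

namespace Data

variable {D : Data m}

/-- The spatial part of the bilinear form `a` is given by bounded operators on `W`. -/
lemma IsAdmissible.exists_operators (hD : D.IsAdmissible) (hm : 1 ≤ m) :
    ∃ (A B : W D.Q →L[ℝ] W D.Q) (c : ℝ), 0 < c ∧ (∀ w : W D.Q, c * ‖w‖ ^ 2 ≤ inner ℝ (A w) w) ∧
      (∀ w : W D.Q, inner ℝ (B w) w = 0) ∧
      (∀ w φ : W D.Q, D.diffusion w φ = inner ℝ (A w) φ) ∧
      ∀ (u : U D.Q) (φ : W D.Q), D.a u φ = timeDeriv u φ + inner ℝ (B u) φ + inner ℝ (A u) φ := by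
  obtain ⟨Lv, hLv⟩ := hD.exists_convection
  obtain ⟨Lκ, hLκ⟩ := hD.exists_diffusion
  obtain ⟨C, hC, hP⟩ := exists_poincare (Ω := D.Ω) (T := D.T) hm hD.isBounded_Ω
  let A : W D.Q →L[ℝ] W D.Q := (ContinuousLinearMap.adjoint (gradCLM D.Q)).comp
    (Lκ.comp (gradCLM D.Q))
  let B : W D.Q →L[ℝ] W D.Q := (ContinuousLinearMap.adjoint (valCLM D.Q)).comp
    (Lv.comp (gradCLM D.Q))
  have hA : ∀ w φ : W D.Q, inner ℝ (A w) φ = inner ℝ (Lκ (gradW w)) (gradW φ) := fun w φ =>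
    ContinuousLinearMap.adjoint_inner_left (gradCLM D.Q) φ (Lκ (gradW w))
  have hB : ∀ w φ : W D.Q, inner ℝ (B w) φ = inner ℝ (Lv (gradW w)) (valW φ) := fun w φ =>
    ContinuousLinearMap.adjoint_inner_left (valCLM D.Q) φ (Lv (gradW w))
  have hAi : ∀ w φ : W D.Q, (fun z => inner ℝ (Lκ (gradW w) z) (gradW φ z)) =ᵐ[volume.restrict D.Q]
      fun z => D.κ z * inner ℝ (gradW w z) (gradW φ z) := fun w φ => by
    filter_upwards [hLκ (gradW w)] with z hz
    rw [hz, real_inner_smul_left]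
  have hBi : ∀ w φ : W D.Q, (fun z => inner ℝ (Lv (gradW w) z) (valW φ z)) =ᵐ[volume.restrict D.Q]
      fun z => inner ℝ (D.v z) (gradW w z) * valW φ z := fun w φ => by
    filter_upwards [hLv (gradW w)] with z hz
    simp [hz, mul_comm]
  have hAd : ∀ w φ : W D.Q, inner ℝ (A w) φ = D.diffusion w φ := fun w φ => by
    rw [hA, L2.inner_def, diffusion]
    exact integral_congr_ae (hAi w φ)
  have hBd : ∀ w φ : W D.Q, inner ℝ (B w) φ = ∫ z in D.Q, inner ℝ (D.v z) (gradW w z) * valW φ z :=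
    fun w φ => by
      rw [hB, L2.inner_def]
      exact integral_congr_ae (hBi w φ)
  have hκ : 0 < min D.κ₁ D.κ₂ := lt_min hD.κ₁_pos hD.κ₂_pos
  refine ⟨A, B, min D.κ₁ D.κ₂ * C, mul_pos hκ hC, fun w => ?_, fun w => ?_,
    fun w φ => (hAd w φ).symm, fun u φ => ?_⟩
  · have h1 : min D.κ₁ D.κ₂ * ‖gradW w‖ ^ 2 ≤ inner ℝ (A w) w := by
      rw [hA, ← real_inner_self_eq_norm_sq, L2.inner_def, L2.inner_def, ← integral_const_mul]
      refine integral_mono_ae ((L2.integrable_inner (𝕜 := ℝ) _ _).const_mul _)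
        (L2.integrable_inner (𝕜 := ℝ) _ _) ?_
      filter_upwards [hAi w w] with z hz
      rw [hz]
      refine mul_le_mul_of_nonneg_right ?_ real_inner_self_nonneg
      rcases D.κ_mem z with h | h <;> rw [h]
      · exact min_le_left _ _
      · exact min_le_right _ _
    rw [mul_assoc]
    exact (mul_le_mul_of_nonneg_left (hP w) hκ.le).trans h1
  · rw [hBd, hD.integral_convection_self]
  · rw [a, add_assoc, hBd, hAd, diffusion, ← integral_add]
    · exact (L2.integrable_inner (𝕜 := ℝ) _ _).congr (hBi u φ)
    · exact (L2.integrable_inner (𝕜 := ℝ) _ _).congr (hAi u φ)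

end Data

namespace Data

variable {D : Data m}

section Solution

variable {A B : W D.Q →L[ℝ] W D.Q}

/-- The coupled problem splits into the state equation and the adjoint equation. -/
lemma IsAdmissible.isSolution_iff (hD : D.IsAdmissible)
    (hA : ∀ w φ : W D.Q, D.diffusion w φ = inner ℝ (A w) φ)
    (hB : ∀ (u : U D.Q) (φ : W D.Q),
      D.a u φ = timeDeriv u φ + inner ℝ (B u) φ + inner ℝ (A u) φ)
    {ud : L2 D.Q} {u : U D.Q} {p : W D.Q} :
    D.IsSolution ud u p ↔ u ∈ U0 D.Ω D.T ∧ (∀ φ, D.a u φ + 1 / D.η * D.diffusion p φ = 0) ∧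
      ∀ ϕ ∈ U0 D.Ω D.T, inner ℝ (valW (u : W D.Q)) (valW (ϕ : W D.Q)) - D.a ϕ p
        = inner ℝ ud (valW (ϕ : W D.Q)) := by
  have hI : ∀ f g : L2 D.Q, ∫ z in D.Q, f z * g z = inner ℝ f g := fun f g => by
    rw [L2.inner_def]
    refine integral_congr_ae (ae_of_all _ fun z => ?_)
    simp [mul_comm]
  refine and_congr_right fun _ => ?_
  simp only [bilin, hI]
  constructor
  · intro h
    obtain ⟨u0, hu0, hw, hd⟩ := exists_U0_of_mem_initialSpace hD.isOpen_Ω hD.isBounded_Ω hD.T_pos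
      (zero_mem (initialSpace D.Ω D.T))
    have hw : (u0 : W D.Q) = 0 := hw
    have hd : ∀ φ, timeDeriv u0 φ = 0 := fun φ => (hd φ).trans (inner_zero_left _)
    have hv : valW (0 : W D.Q) = 0 := rfl
    constructor
    · intro φ
      have h1 := h φ u0 hu0
      rw [hB u0, hd, hw, hv, map_zero, map_zero, inner_zero_left, inner_zero_right,
        inner_zero_right] at h1
      linarith
    · intro ϕ hϕ
      have h1 := h 0 ϕ hϕ
      rw [hB u, hA, map_zero, inner_zero_right, inner_zero_right, inner_zero_right] at h1
      linarith
  · rintro ⟨h1, h2⟩ φ ϕ hϕ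
    linarith [h1 φ, h2 ϕ hϕ]

/-- The adjoint state has a time derivative in `W'` and vanishes at the final time. -/
lemma IsAdmissible.exists_UT_of_adjoint (hD : D.IsAdmissible)
    (hB : ∀ (u : U D.Q) (φ : W D.Q),
      D.a u φ = timeDeriv u φ + inner ℝ (B u) φ + inner ℝ (A u) φ)
    {r : L2 D.Q} {p : W D.Q}
    (h : ∀ ϕ ∈ U0 D.Ω D.T, D.a ϕ p = inner ℝ r (valW (ϕ : W D.Q))) :
    ∃ q ∈ UT D.Ω D.T, (q : W D.Q) = p := by
  let ℓ : StrongDual ℝ (W D.Q) := (innerSL ℝ p).comp (B + A) - pairing r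
  have hℓ : ∀ ϕ : TimeTest D.Ω, (∀ x, (ϕ : Space m × ℝ → ℝ) (x, 0) = 0) →
      ℓ (timeTestToW D.T ϕ) + timeTestDt D.T ϕ p = 0 := fun ϕ hϕ => by
    let u : U D.Q := ⟨timeTestToW D.T ϕ, _, isTimeDeriv_timeTest ϕ⟩
    have hu : timeDeriv u = timeTestDt D.T ϕ :=
      (isTimeDeriv_timeDeriv u).unique (isTimeDeriv_timeTest ϕ)
    have h1 := h u (vanishesAt_timeTest hD.isBounded_Ω hϕ)
    rw [hB, hu] at h1
    have h2 : ℓ (timeTestToW D.T ϕ) = inner ℝ (B u) p + inner ℝ (A u) p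
        - inner ℝ r (valW (u : W D.Q)) := by
      rw [← inner_add_left, real_inner_comm]
      rfl
    linarith
  have hp : IsTimeDeriv p ℓ := isTimeDeriv_of_forall fun ξ => hℓ _ (C10.toTimeTest_zero ξ)
  exact ⟨⟨p, ℓ, hp⟩, vanishesAt_final hD.isOpen_Ω hD.isBounded_Ω hD.T_pos hp hℓ, rfl⟩

lemma state_equation_iff (hA : ∀ w φ : W D.Q, D.diffusion w φ = inner ℝ (A w) φ)
    {u : U D.Q} {q y : W D.Q} (h : ∀ φ, D.a u φ = inner ℝ y φ) :
    (∀ φ, D.a u φ + 1 / D.η * D.diffusion q φ = 0) ↔ y + (1 / D.η) • A q = 0 := by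
  have e : ∀ φ, D.a u φ + 1 / D.η * D.diffusion q φ
      = inner ℝ (y + (1 / D.η) • A q) φ := fun φ => by
    rw [h, hA, inner_add_left]
    exact congrArg _ (real_inner_smul_left (F := W D.Q) _ _ _).symm
  simp_rw [e]
  exact ⟨fun h => ext_inner_right ℝ fun φ => (h φ).trans (inner_zero_left _).symm,
    fun h φ => by rw [h, inner_zero_left]⟩

end Solution

/-- Unique solvability of the coupled problem in `U₀ × W`. -/
theorem IsAdmissible.exists_unique_isSolution (hD : D.IsAdmissible) (hm : 1 ≤ m) (ud : L2 D.Q) :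
    ∃ u ∈ U0 D.Ω D.T, ∃ p ∈ UT D.Ω D.T, D.IsSolution ud u p ∧
      ∀ (u' : U D.Q) (p' : W D.Q), D.IsSolution ud u' p' → u' = u ∧ p' = p := by
  have hΩ := hD.isOpen_Ω
  have hb := hD.isBounded_Ω
  have hT := hD.T_pos
  obtain ⟨A, B, a, ha, hAc, hBs, hA, hB⟩ := hD.exists_operators hm
  have hV : ∀ q ∈ initialSpace D.Ω D.T, 0 ≤ inner ℝ q.snd q.fst := fun q hq => by
    obtain ⟨u, hu, huw, hud⟩ := exists_U0_of_mem_initialSpace hΩ hb hT hq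
    have h := (isTimeDeriv_timeDeriv u).apply_self_nonneg hb hT hu
    rwa [hud, huw] at h
  obtain ⟨x, hx, p, ⟨hx1, hx2⟩, huniq⟩ := exists_unique_parabolic_saddlePoint
    isClosed_initialSpace hV ha hAc hBs hD.η_pos (valCLM D.Q) ud
  have key : ∀ (y : GraphSpace D.Ω D.T) (u : U D.Q), (u : W D.Q) = y.fst →
      (∀ φ, timeDeriv u φ = inner ℝ y.snd φ) →
      ∀ φ, D.a u φ = inner ℝ (y.snd + (B y.fst + A y.fst)) φ := fun y u h1 h2 φ => by
    rw [hB, h1, h2, inner_add_left, inner_add_left, add_assoc]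
  obtain ⟨u, hu, huw, hud⟩ := exists_U0_of_mem_initialSpace hΩ hb hT hx
  have hadj : ∀ ϕ ∈ U0 D.Ω D.T, inner ℝ (valW (u : W D.Q)) (valW (ϕ : W D.Q)) - D.a ϕ p
      = inner ℝ ud (valW (ϕ : W D.Q)) := fun ϕ hϕ => by
    obtain ⟨y, hy, hyw, hyd⟩ := exists_mem_initialSpace_of_mem_U0 hΩ hb hT hϕ
    have h := hx2 y hy
    rw [← key y ϕ hyw hyd, ← huw, ← hyw] at h
    exact h
  obtain ⟨q, hq, rfl⟩ := hD.exists_UT_of_adjoint (r := valW (u : W D.Q) - ud) hB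
    fun ϕ hϕ => by
      rw [inner_sub_left]
      linarith [hadj ϕ hϕ]
  refine ⟨u, hu, q, hq, (hD.isSolution_iff hA hB).2
    ⟨hu, (state_equation_iff hA (key x u huw hud)).2 hx1, hadj⟩, fun u' p' h' => ?_⟩
  obtain ⟨hu', h1, h2⟩ := (hD.isSolution_iff hA hB).1 h'
  obtain ⟨x', hx', hw', hd'⟩ := exists_mem_initialSpace_of_mem_U0 hΩ hb hT hu'
  obtain ⟨hxx, hpp⟩ := huniq x' hx' p' ((state_equation_iff hA (key x' u' hw' hd')).1 h1)
    fun y hy => by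
      obtain ⟨ϕ, hϕ, hϕw, hϕd⟩ := exists_U0_of_mem_initialSpace hΩ hb hT hy
      have h := h2 ϕ hϕ
      rw [key y ϕ hϕw hϕd, hϕw, hw'] at h
      exact h
  refine ⟨Subtype.ext ?_, hpp⟩
  rw [huw, ← hxx, hw']

end Data

end MovingInterface

end

/-- For every desired state the reduced coupled state-adjoint problem has exactly one solution
`(u, p) ∈ U₀ × W`, and this solution lies in `U₀ × U_T`. -/
theorem corollary3p2 (m : ℕ) (hm1 : 1 ≤ m) (hm3 : m ≤ 3) (D : MovingInterface.Data m)
    (hD : D.IsAdmissible) (ud : MovingInterface.L2 D.Q) :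
    ∃ u ∈ MovingInterface.U0 D.Ω D.T, ∃ p ∈ MovingInterface.UT D.Ω D.T,
      D.IsSolution ud u p ∧
      ∀ (u' : MovingInterface.U D.Q) (p' : MovingInterface.W D.Q),
        D.IsSolution ud u' p' → u' = u ∧ p' = p := by
  exact hD.exists_unique_isSolution hm1 ud
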